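/- **Setting.** There are $K$ independent arms; arm $k$ has a finite state space $S_k$, a known reward function $r_k:S_k\to[0,1]$, and two transition matrices $P_k^{\rm active},P_k^{\rm passive}$ on $S_k$. A system parameter $\theta$ is the collection of all these matrices. In each round exactly $N$ arms ($1\le N\le K$) are pulled. A pulled arm yields the reward $r_k(s_k)$ of its current state $s_k$, the state is observed, and the arm moves by $P_k^{\rm active}$; the states of the other arms are not observed and move by $P_k^{\rm passive}$. The meta-state $\xi_t=(\sigma^t_k,n^t_k)_{k}$ records for each arm the last observed state $\sigma^t_k$ and the number $n^t_k\ge1$ of rounds since then; $S=\prod_kS_k\times\{1,2,\dots\}^K$ is the set of meta-states. Given $\xi_t$, the states of the arms in round $t$ are independent, and arm $k$ has the law $p_\theta(\cdot\,;k,\sigma^t_k,n^t_k)$, the $\sigma^t_k$-th row of $P_k^{\rm active}(P_k^{\rm passive})^{n^t_k-1}$. The initial meta-state $\xi_1$ is known. Let $r_\theta(\xi,A)$ be the expected reward of pulling the set $A$ of arms in the meta-state $\xi$. The true parameter $\theta^\star$ is drawn from a known prior $Q$ with support $\Theta$. A policy mapping $\mu$ assigns to every $\theta$ a stationary deterministic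 policy $\pi_\theta=\mu(\theta)$, a map from meta-states to sets of $N$ arms. Assume: 1. for all $\theta\in\Theta$ and all $k$, $P_k^{\rm passive}$ is irreducible and aperiodic, and $T^{\rm mix}(\tfrac14)=\max_{k,\,\theta\in\Theta}T_k^{\rm mix}(\tfrac14)$ exists and is known, where $T_k^{\rm mix}(\epsilon)=\inf\{t\ge1:\max_{s}\|(P_k^{\rm passive})^t(s,\cdot)-p_k\|_1\le\epsilon\}$ and $p_k$ is the stationary distribution of $P_k^{\rm passive}$; 2. (bounded span) for every $\theta\in\Theta$ the discounted values $v^\beta_{\pi_\theta}(\xi)=\mathbb E_\theta\big[\sum_{t\ge1}\beta^t r_\theta(\xi_t,\pi_\theta(\xi_t))\,\big|\,\xi_1=\xi\big]$ satisfy $\sup_{0<\beta<1}\sup_{\xi,\xi'\in S}\big(v^\beta_{\pi_\theta}(\xi)-v^\beta_{\pi_\theta}(\xi')\big)<\infty$. **TSDE** with horizon $T\ge2$. Put $T^{\rm mix}=(\log_2T)\,T^{\rm mix}(\tfrac14)$. Let $N_t(k,s,n)$ be the number of rounds $\tau<t$ in which arm $k$ was pulled with $\sigma^\tau_k=s$ and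 $n^\tau_k=n$; all values $n\ge T^{\rm mix}$ are aggregated into one counter. Episode $1$ starts at $t_1=1$, and $T_0=0$. At the start $t_i$ of episode $i$ the learner draws $\theta_i$ from the posterior of $\theta^\star$ given the observations so far, and it plays $\mu(\theta_i)$ until the first round $t$ with $t>t_i+T_{i-1}$, or with $N_t(\zeta)>2N_{t_i}(\zeta)$ for some $\zeta=(k,s,n)$. In this round the next episode starts, and $T_i=t_{i+1}-t_i$. **Theorem.** For every $\theta\in\Theta$ the average reward $J_{\pi_\theta}(\theta)=\lim_{T\to\infty}\frac1T\mathbb E_\theta\big[\sum_{t=1}^Tr_\theta(\xi_t,\pi_\theta(\xi_t))\,\big|\,\xi_1=\xi\big]$ exists and does not depend on $\xi$, and there is a function $h_\theta\ge0$ on $S$ of bounded span with $$J_{\pi_\theta}(\theta)+h_\theta(\xi)=r_\theta(\xi,\pi_\theta(\xi))+\mathbb E_\theta[h_\theta(\xi')\mid\xi,\pi_\theta(\xi)]\qquad\text{for all }\xi\in S .$$ For any choice of such functions $h_\theta$ with $\sup_{\xi,\xi'}(h_\theta(\xi)-h_\theta(\xi'))\le H<\infty$ for all $\theta\in\Theta$,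 the Bayesian regret $$BR(T)=\mathbb E_{\theta^\star\sim Q}\Big[J_{\pi_{\theta^\star}}(\theta^\star)\,T-\mathbb E_{\theta^\star}\sum_{t=1}^Tr_t\Big]$$ of TSDE, where $r_t$ is the reward that the learner collects in round $t$, satisfies for every $T\ge2$ $$BR(T)\le2(H+N)\sqrt{\Big(\sum_{k=1}^K|S_k|\Big)T^{\rm mix}\,T\log(NT)}+28(H+1)\Big(\sum_{k=1}^K|S_k|\Big)\sqrt{N\,T^{\rm mix}\,T\log(T^{\rm mix}T)} .$$ In particular, $BR(T)=O(\sqrt T\log T)$ as $T\to\infty$. -/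

import Mathlib

open MeasureTheory Filter Topology

noncomputable section

namespace RestlessBandit

/-! ## Finite Markov chains -/

section Chains

variable {α : Type*} [Fintype α] [DecidableEq α]

/-- Row-stochastic kernels on a finite state space; `P i j` is the probability of moving from `i`
to `j`. -/
abbrev StochMat (α : Type*) [Fintype α] [DecidableEq α] : Type _ :=
  {P : α → α → ℝ // Matrix.of P ∈ Matrix.rowStochastic ℝ α}

/-- The transition matrix. -/
def StochMat.mat (P : StochMat α) : Matrix α α ℝ := Matrix.of P.1

/-- Every state can be reached from every state with positive probability. -/
def IsIrreducible (P : Matrix α α ℝ) : Prop :=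
  ∀ s s', ∃ n : ℕ, 0 < (P ^ n) s s'

/-- For every state, the greatest common divisor of the possible return times is `1`. -/
def IsAperiodic (P : Matrix α α ℝ) : Prop :=
  ∀ s, ∀ d : ℕ, (∀ n : ℕ, 1 ≤ n → 0 < (P ^ n) s s → d ∣ n) → d = 1

/-- `p` is a stationary probability distribution of `P`. -/
def IsStationary (P : Matrix α α ℝ) (p : α → ℝ) : Prop :=
  (∀ s, 0 ≤ p s) ∧ ∑ s, p s = 1 ∧ ∀ s', ∑ s, p s * P s s' = p s'

/-- The mixing time `inf {t ≥ 1 : max_s ‖P^t(s, ·) - p‖₁ ≤ ε}`, where `p` is the stationary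
distribution (it is unique for an irreducible chain); the infimum of the empty set is `∞`. -/
def mixingTime (P : Matrix α α ℝ) (ε : ℝ) : ℕ∞ :=
  sInf {m : ℕ∞ | ∃ t : ℕ, m = t ∧ 1 ≤ t ∧
    ∃ p, IsStationary P p ∧ ∀ s, ∑ s', |(P ^ t) s s' - p s'| ≤ ε}

end Chains

/-! ## The bandit -/

/-- A system parameter: an active and a passive transition matrix for each arm. -/
abbrev Params {K : ℕ} (S : Fin K → Type*) [∀ k, Fintype (S k)] [∀ k, DecidableEq (S k)] : Type _ :=
  (∀ k, StochMat (S k)) × (∀ k, StochMat (S k))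

/-- An action: a set of `N` active arms. -/
abbrev Action (K N : ℕ) : Type := {A : Finset (Fin K) // A.card = N}

/-- A meta-state: for each arm, its last observed state and the time elapsed since then. -/
structure Meta {K : ℕ} (S : Fin K → Type*) where
  last : ∀ k, S k
  age : Fin K → ℕ+

/-- A stationary deterministic policy. -/
abbrev Policy {K : ℕ} (S : Fin K → Type*) (N : ℕ) : Type _ := Meta S → Action K N

variable {K N : ℕ} {S : Fin K → Type*}

/-- The meta-state that follows `ξ` when the arms in `A` are pulled while the current states of the
arms are `s`; only the states of the arms in `A` are observed. -/
def Meta.next (ξ : Meta S) (A : Action K N) (s : ∀ k, S k) : Meta S where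
  last := fun k => if k ∈ A.1 then s k else ξ.last k
  age := fun k => if k ∈ A.1 then 1 else ξ.age k + 1

variable [∀ k, Fintype (S k)] [∀ k, DecidableEq (S k)]

/-- The active transition matrix of arm `k`. -/
def Params.active (θ : Params S) (k : Fin K) : Matrix (S k) (S k) ℝ := (θ.1 k).mat

/-- The passive transition matrix of arm `k`. -/
def Params.passive (θ : Params S) (k : Fin K) : Matrix (S k) (S k) ℝ := (θ.2 k).mat

/-- `stateProb θ k s n s'`: the probability that arm `k` is in state `s'`, given that it was pulled
in state `s` exactly `n` rounds ago and has been passive since then. -/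
def stateProb (θ : Params S) (k : Fin K) (s : S k) (n : ℕ+) (s' : S k) : ℝ :=
  (Params.active θ k * Params.passive θ k ^ ((n : ℕ) - 1)) s s'

/-! ## The meta-state decision process and the planning notions -/

/-- `E_θ[v(ξ') | ξ, A]`: given the meta-state `ξ`, the current states of the arms are independent
with the distributions `stateProb`. -/
def metaExp (θ : Params S) (ξ : Meta S) (A : Action K N) (v : Meta S → ℝ) : ℝ :=
  ∑ s : ∀ k, S k, (∏ k, stateProb θ k (ξ.last k) (ξ.age k) (s k)) * v (ξ.next A s)

/-- `r_θ(ξ, A)`: the expected reward of the arms in `A`, given the meta-state `ξ`. -/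
def metaReward (r : ∀ k, S k → ℝ) (θ : Params S) (ξ : Meta S) (A : Action K N) : ℝ :=
  ∑ k ∈ A.1, ∑ s, stateProb θ k (ξ.last k) (ξ.age k) s * r k s

/-- `E_θ[r_θ(ξ_{t+1}, π(ξ_{t+1})) | ξ_1 = ξ]` for the Markov process of meta-states under the
policy `π`: the `t`-th iterate of the transition operator, applied to the reward function. -/
def expReward (r : ∀ k, S k → ℝ) (θ : Params S) (π : Policy S N) (t : ℕ) : Meta S → ℝ :=
  (fun (v : Meta S → ℝ) (ξ : Meta S) => metaExp θ ξ (π ξ) v)^[t]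
    (fun ξ => metaReward r θ ξ (π ξ))

/-- The discounted value `E_θ[∑_{t ≥ 1} β^t r_θ(ξ_t, π(ξ_t)) | ξ_1 = ξ]`. -/
def discountedValue (r : ∀ k, S k → ℝ) (θ : Params S) (π : Policy S N) (β : ℝ) (ξ : Meta S) : ℝ :=
  ∑' t : ℕ, β ^ (t + 1) * expReward r θ π t ξ

/-- The span of the discounted value function is bounded uniformly in the discount factor. -/
def BoundedSpan (r : ∀ k, S k → ℝ) (θ : Params S) (π : Policy S N) : Prop :=
  ∃ C : ℝ, ∀ β : ℝ, 0 < β → β < 1 → ∀ ξ ξ' : Meta S,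
    discountedValue r θ π β ξ - discountedValue r θ π β ξ' ≤ C

/-- `(1/T) E_θ[∑_{t=1}^T r_θ(ξ_t, π(ξ_t)) | ξ_1 = ξ]`. -/
def meanReward (r : ∀ k, S k → ℝ) (θ : Params S) (π : Policy S N) (ξ : Meta S) (T : ℕ) : ℝ :=
  (1 / (T : ℝ)) * ∑ t ∈ Finset.range T, expReward r θ π t ξ

/-- The long-term average reward `J_π(θ)` from the initial meta-state `ξ`. -/
def avgReward (r : ∀ k, S k → ℝ) (θ : Params S) (π : Policy S N) (ξ : Meta S) : ℝ :=
  limUnder atTop (meanReward r θ π ξ)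

/-- `h` is a non-negative solution of the Bellman equation with average reward `J`. -/
def IsBias (r : ∀ k, S k → ℝ) (θ : Params S) (π : Policy S N) (J : ℝ) (h : Meta S → ℝ) : Prop :=
  (∀ ξ, 0 ≤ h ξ) ∧ ∀ ξ, J + h ξ = metaReward r θ ξ (π ξ) + metaExp θ ξ (π ξ) h

/-! ## The learner -/

/-- One round as recorded by the learner: the meta-state, the action, and the next meta-state, whose
entries `last k` for the active arms `k` are the states observed in the round. -/
structure Round {K : ℕ} (S : Fin K → Type*) (N : ℕ) where
  pre : Meta S
  act : Action K N
  post : Meta S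

/-- The likelihood of the observed states under the parameter `θ`. -/
def likelihood (hist : List (Round S N)) (θ : Params S) : ℝ :=
  (hist.map fun z =>
    ∏ k ∈ z.act.1, stateProb θ k (z.pre.last k) (z.pre.age k) (z.post.last k)).prod

open Classical in
/-- The posterior by Bayes' rule, from the prior `Q` and the recorded rounds. (For a record of
probability zero it is set to `Q`.) -/
def posterior (Q : Measure (Params S)) (hist : List (Round S N)) : Measure (Params S) :=
  let W := Q.withDensity fun θ => ENNReal.ofReal (likelihood hist θ)
  if W Set.univ = 0 then Q else (W Set.univ)⁻¹ • W

/-- The counter of the tuple `(k, s, n)`, where all `n ≥ Tmix` are aggregated. -/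
def counter (Tmix : ℝ) (hist : List (Round S N)) (k : Fin K) (s : S k) (n : ℕ+) : ℕ := by
  classical
  exact if ((n : ℕ) : ℝ) < Tmix then
      hist.countP fun z => k ∈ z.act.1 ∧ z.pre.last k = s ∧ z.pre.age k = n
    else
      hist.countP fun z => k ∈ z.act.1 ∧ z.pre.last k = s ∧ Tmix ≤ ((z.pre.age k : ℕ) : ℝ)

/-- The situation at the beginning of a round `t`: the (hidden) current states of the arms, the
recorded rounds `1, …, t - 1` in chronological order, the current meta-state, the start `t_i` of the
current episode, and the length `T_{i-1}` of the previous one. -/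
structure World {K : ℕ} (S : Fin K → Type*) (N : ℕ) where
  arms : ∀ k, S k
  hist : List (Round S N)
  cur : Meta S
  start : ℕ
  prevLen : ℕ

instance {K : ℕ} (S : Fin K → Type*) (N : ℕ) : MeasurableSpace (World S N) := ⊤

/-- The index `t` of the current round. -/
def World.time (w : World S N) : ℕ := w.hist.length + 1

/-- The termination condition of the current episode:
`t > t_i + T_{i-1}` or `N_t(ζ) > 2 N_{t_i}(ζ)` for some `ζ = (k, s, n)`. -/
def World.Terminates (Tmix : ℝ) (w : World S N) : Prop :=
  w.time > w.start + w.prevLen ∨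
    ∃ (k : Fin K) (s : S k) (n : ℕ+),
      counter Tmix w.hist k s n > 2 * counter Tmix (w.hist.take (w.start - 1)) k s n

/-- Start a new episode in the current round. -/
def World.newEpisode (w : World S N) : World S N :=
  { w with start := w.time, prevLen := w.time - w.start }

/-- Pull the arms in `A`, record the round, and let the arms move to the states `s'`. -/
def World.advance (w : World S N) (A : Action K N) (s' : ∀ k, S k) : World S N :=
  { w with
    arms := s'
    hist := w.hist ++ [⟨w.cur, A, w.cur.next A w.arms⟩]
    cur := w.cur.next A w.arms }

open Classical in
/-- If the current episode terminates, start a new one and draw its parameter from the posterior;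
otherwise keep the parameter `ϑ` of the current episode. -/
def resample (Q : Measure (Params S)) (Tmix : ℝ) (w : World S N) (ϑ : Params S) :
    Measure (World S N × Params S) :=
  if w.Terminates Tmix then (posterior Q w.hist).map fun ϑ' => (w.newEpisode, ϑ')
  else Measure.dirac (w, ϑ)

/-- The probability that the arms move from `s` to `s'` in the system `θ` when the arms in `A` are
pulled. -/
def moveProb (θ : Params S) (A : Action K N) (s s' : ∀ k, S k) : ℝ :=
  ∏ k, (if k ∈ A.1 then Params.active θ k else Params.passive θ k) (s k) (s' k)

/-- One round of the algorithm in the system `θ`, from the situation `x.1` with the episode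
parameter `x.2`. -/
def step (Q : Measure (Params S)) (μ : Params S → Policy S N) (Tmix : ℝ) (θ : Params S)
    (x : World S N × Params S) : Measure (World S N × Params S) :=
  let A := μ x.2 x.1.cur
  ∑ s' : ∀ k, S k, ENNReal.ofReal (moveProb θ A x.1.arms s') •
    resample Q Tmix (x.1.advance A s') x.2

/-- The law of the situation and of the episode parameter after `t` rounds of TSDE with prior `Q`,
policy mapping `μ`, and initial meta-state `ξ₁` in the system `θ`. Initially the states of the arms
are independent with the distributions given by `ξ₁`, the first episode starts in round `1` with
`T_0 = 0`, and its parameter is drawn from `Q`. -/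
def law (Q : Measure (Params S)) (μ : Params S → Policy S N) (Tmix : ℝ) (ξ₁ : Meta S)
    (θ : Params S) : ℕ → Measure (World S N × Params S)
  | 0 => ∑ s : ∀ k, S k,
      ENNReal.ofReal (∏ k, stateProb θ k (ξ₁.last k) (ξ₁.age k) (s k)) •
        Q.map fun ϑ => (⟨s, [], ξ₁, 1, 0⟩, ϑ)
  | t + 1 => (law Q μ Tmix ξ₁ θ t).bind (step Q μ Tmix θ)

/-- The sum of the rewards `∑_{k active} r_k(s_k^t)` over the recorded rounds. -/
def totalReward (r : ∀ k, S k → ℝ) (hist : List (Round S N)) : ℝ :=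
  (hist.map fun z => ∑ k ∈ z.act.1, r k (z.post.last k)).sum

/-! ## Regret -/

/-- `T^mix = (log₂ T) T^mix(1/4)` for the horizon `T`, where `τ = T^mix(1/4)`. -/
def horizonMix (τ T : ℕ) : ℝ := Real.logb 2 T * τ

/-- The frequentist regret `R(T; θ) = J_{μ(θ)}(θ) T - E_θ[∑_{t=1}^T r_t]` of TSDE run with the known
horizon `T`. -/
def regret (r : ∀ k, S k → ℝ) (Q : Measure (Params S)) (μ : Params S → Policy S N) (τ : ℕ)
    (ξ₁ : Meta S) (T : ℕ) (θ : Params S) : ℝ :=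
  avgReward r θ (μ θ) ξ₁ * T - ∫ x, totalReward r x.1.hist ∂(law Q μ (horizonMix τ T) ξ₁ θ T)

/-- The Bayesian regret `BR(T) = E_{θ ∼ Q} R(T; θ)`. -/
def bayesRegret (r : ∀ k, S k → ℝ) (Q : Measure (Params S)) (μ : Params S → Policy S N) (τ : ℕ)
    (ξ₁ : Meta S) (T : ℕ) : ℝ :=
  ∫ θ, regret r Q μ τ ξ₁ T θ ∂Q

end RestlessBandit

end

/-!
The average reward and the bias function come from the vanishing discount method. By the bounded
span, the differences `v β ξ - v β ξ₁` of the discounted values and the numbers `(1 - β) * v β ξ₁`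
stay bounded, and their limits along an ultrafilter `β → 1` solve the Bellman equation, where only
finitely many successors enter (`exists_bias_of_boundedSpan`). A bounded solution forces the
Cesàro means of the rewards to converge (`tendsto_meanReward_of_bias`).

For the regret, the unobserved states of the arms are integrated out: given the meta-state they
are independent with the laws `stateProb`, so the process can be run by drawing, in every round,
fresh states for the arms (`obsLaw`, `law_eq_bind_drawArms`). In this form the law of the
observations under `θ` has the product of the observed `stateProb`s, up to normalization, as its
density against the law under a fixed system with uniform transition matrices
(`lintegral_obsLaw_mul_likelihood`). Bayes' rule is then Fubini's theorem, and gives the property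
of posterior sampling: at the start of an episode, the sampled parameter and the true one have the
same law jointly with the observations (`integral_newInd_mul_posterior`).

Fix a true parameter `θ` and write `ϑ` for the parameter of the running episode. The Bellman
inequality of `ϑ` bounds the regret by three sums (`regret_le_of_subsolution`).

* The gains `J θ - J ϑ`. An episode lasts at most one round longer than the one before it, so the
  sum over an episode is, up to `N` for every episode, its value at the start times a length known
  at that time (`sum_integral_gain_le`), and these values have mean zero by posterior sampling
  (`integral_gain_eq_zero`).
* The differences of the bias of `ϑ` between consecutive meta-states. They telescope within an
  episode, and cost at most its span for every episode (`sum_integral_bias_le`).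
* The error of evaluating the bias of `ϑ` under the observation law of `θ`. It is at most `(H + 1)
  / 2` times the `ℓ¹`-distance between the laws that `θ` and `ϑ` give to the states of the pulled
  arms.

The number of episodes is bounded by a potential that grows by one with every new episode
(`sum_integral_newInd_le`): episodes that end by their length are longer and longer, and those
that end by a doubled counter are few. For the distances, Hoeffding's inequality bounds, for every
counter, the deviation of the observed states from their conditional means under the true
parameter (`integral_badInd_le`). By posterior sampling the bound holds for the sampled parameter
too, so two parameters that both fit the data give nearby laws. The ages at least `T^mix` share
one counter; there the laws differ by at most a multiple of `1 / T ^ 2`, since the passive chains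
contract towards their stationary laws (`sum_abs_stateProb_sub_le`). A pigeonhole potential sums
the resulting widths `1 / √(visits)` along the run (`sum_integral_visitWidth_le`).

The bias functions are given for each parameter separately and need not depend measurably on it.
They enter only through the Bellman inequality, for which decreasing iterates of the Bellman
operator provide a measurable solution with the same bounds (`exists_measurable_subsolution`).
When the horizon is so small that the second term of the bound exceeds `N * T` there is nothing to
prove; otherwise the constants have room (`integral_regret_le`). The order of the regret requires
a lower bound as well, which is the upper bound for the rewards `1 - r`.
-/

noncomputable section

namespace RestlessBandit

set_option linter.unusedSectionVars false

/-! ### The states of the arms given the meta-state -/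

section Basic

/-- In a sum of products over a finite product space, the factors of the coordinates on which the
remaining factor does not depend only matter through their sums. -/
lemma sum_prod_mul_congr {R ι : Type*} [CommSemiring R] [Fintype ι] [DecidableEq ι] {S : ι → Type*}
    [∀ i, Fintype (S i)] (A : Finset ι) (a b : ∀ i, S i → R) (hA : ∀ i ∈ A, a i = b i)
    (hAc : ∀ i ∉ A, ∑ x, a i x = ∑ x, b i x) (F : (∀ i, S i) → R)
    (hF : ∀ s s' : ∀ i, S i, (∀ i ∈ A, s i = s' i) → F s = F s') :
    ∑ s, (∏ i, a i (s i)) * F s = ∑ s, (∏ i, b i (s i)) * F s := by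
  classical
  have key : ∀ c : ∀ i, S i → R, ∑ s, (∏ i, c i (s i)) * F s =
      ∑ u : ∀ i : {i // i ∈ A}, S i, ((∏ i : {i // i ∈ A}, c i (u i)) *
        ∏ i : {i // i ∉ A}, ∑ x, c i x) *
          (if h : Nonempty (∀ i : {i // i ∉ A}, S i) then
            F ((Equiv.piEquivPiSubtypeProd (· ∈ A) S).symm (u, h.some)) else 0) := by
    intro c
    rw [← (Equiv.piEquivPiSubtypeProd (· ∈ A) S).symm.sum_comp, Fintype.sum_prod_type]
    refine Finset.sum_congr rfl fun u _ => ?_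
    rw [Finset.prod_univ_sum, Finset.mul_sum, Finset.sum_mul, Fintype.piFinset_univ]
    refine Finset.sum_congr rfl fun v _ => ?_
    rw [dif_pos ⟨v⟩]
    congr 1
    · rw [← Fintype.prod_subtype_mul_prod_subtype (· ∈ A)]
      congr 1
      · refine Finset.prod_congr (by ext; simp) fun i _ => ?_
        simp [Equiv.piEquivPiSubtypeProd, i.2]
      · refine Finset.prod_congr (by ext; simp) fun i _ => ?_
        simp [Equiv.piEquivPiSubtypeProd, i.2]
    · refine hF _ _ fun i hi => ?_
      simp [Equiv.piEquivPiSubtypeProd, hi]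
  rw [key a, key b]
  refine Finset.sum_congr rfl fun u _ => ?_
  congr 2
  · exact Finset.prod_congr rfl fun i _ => by rw [hA i i.2]
  · exact Finset.prod_congr rfl fun i _ => hAc i i.2

variable {K N : ℕ} {S : Fin K → Type*} [∀ k, Fintype (S k)] [∀ k, DecidableEq (S k)]

lemma stateMatrix_mem (θ : Params S) (k : Fin K) (n : ℕ) :
    Params.active θ k * Params.passive θ k ^ n ∈ Matrix.rowStochastic ℝ (S k) :=
  mul_mem (θ.1 k).2 (pow_mem (θ.2 k).2 n)

lemma stateProb_nonneg (θ : Params S) (k : Fin K) (s : S k) (n : ℕ+) (s' : S k) :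
    0 ≤ stateProb θ k s n s' :=
  Matrix.nonneg_of_mem_rowStochastic (stateMatrix_mem θ k _)

lemma sum_stateProb (θ : Params S) (k : Fin K) (s : S k) (n : ℕ+) :
    ∑ s', stateProb θ k s n s' = 1 :=
  Matrix.sum_row_of_mem_rowStochastic (stateMatrix_mem θ k _) s

lemma stateProb_one (θ : Params S) (k : Fin K) (s s' : S k) :
    stateProb θ k s 1 s' = Params.active θ k s s' := by
  simp [stateProb]

lemma stateProb_succ (θ : Params S) (k : Fin K) (s : S k) (n : ℕ+) (s' : S k) :
    stateProb θ k s (n + 1) s' = ∑ x, stateProb θ k s n x * Params.passive θ k x s' := by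
  have h : ((n + 1 : ℕ+) : ℕ) - 1 = ((n : ℕ) - 1) + 1 := by
    have := n.pos
    rw [PNat.add_coe, PNat.one_coe]; omega
  rw [stateProb, h, pow_succ, ← mul_assoc, Matrix.mul_apply]
  rfl

/-- The probability that the current states of the arms are `s`, given the meta-state `ξ`. -/
def armsProb (θ : Params S) (ξ : Meta S) (s : ∀ k, S k) : ℝ :=
  ∏ k, stateProb θ k (ξ.last k) (ξ.age k) (s k)

lemma armsProb_nonneg (θ : Params S) (ξ : Meta S) (s : ∀ k, S k) : 0 ≤ armsProb θ ξ s :=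
  Finset.prod_nonneg fun _ _ => stateProb_nonneg ..

lemma sum_armsProb (θ : Params S) (ξ : Meta S) : ∑ s, armsProb θ ξ s = 1 := by
  have := (Finset.prod_univ_sum (fun k : Fin K => (Finset.univ : Finset (S k)))
    (fun k x => stateProb θ k (ξ.last k) (ξ.age k) x)).symm
  rw [Fintype.piFinset_univ] at this
  exact this.trans (Finset.prod_eq_one fun k _ => sum_stateProb ..)

/-- The current state of arm `k` has the distribution `stateProb`. -/
lemma sum_armsProb_mul (θ : Params S) (ξ : Meta S) (k : Fin K) (f : S k → ℝ) :
    ∑ s, armsProb θ ξ s * f (s k) = ∑ x, stateProb θ k (ξ.last k) (ξ.age k) x * f x := by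
  have := (Finset.prod_univ_sum (fun k : Fin K => (Finset.univ : Finset (S k)))
    (fun j x => stateProb θ j (ξ.last j) (ξ.age j) x *
      (if h : j = k then f (h ▸ x) else 1)))
  rw [Fintype.piFinset_univ] at this
  have h1 : ∀ s : ∀ k, S k, ∏ j, (stateProb θ j (ξ.last j) (ξ.age j) (s j) *
      (if h : j = k then f (h ▸ (s j)) else 1)) = armsProb θ ξ s * f (s k) := by
    intro s
    rw [Finset.prod_mul_distrib]
    refine congrArg (armsProb θ ξ s * ·) ?_
    rw [Finset.prod_eq_single k]
    · simp
    · intro j _ hj; simp [hj]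
    · simp
  simp_rw [h1] at this
  rw [← this, Finset.prod_eq_single k]
  · simp
  · intro j _ hj; simp [hj, sum_stateProb]
  · simp

lemma metaExp_eq (θ : Params S) (ξ : Meta S) (A : Action K N) (v : Meta S → ℝ) :
    metaExp θ ξ A v = ∑ s, armsProb θ ξ s * v (ξ.next A s) := rfl

lemma metaExp_mono (θ : Params S) (ξ : Meta S) (A : Action K N) {v w : Meta S → ℝ}
    (h : ∀ ξ, v ξ ≤ w ξ) : metaExp θ ξ A v ≤ metaExp θ ξ A w :=
  Finset.sum_le_sum fun s _ => mul_le_mul_of_nonneg_left (h _) (armsProb_nonneg θ ξ s)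

lemma metaExp_const (θ : Params S) (ξ : Meta S) (A : Action K N) (c : ℝ) :
    metaExp θ ξ A (fun _ => c) = c := by
  rw [metaExp_eq, ← Finset.sum_mul, sum_armsProb, one_mul]

lemma metaExp_add (θ : Params S) (ξ : Meta S) (A : Action K N) (v w : Meta S → ℝ) :
    metaExp θ ξ A (fun ξ => v ξ + w ξ) = metaExp θ ξ A v + metaExp θ ξ A w := by
  simp [metaExp, mul_add, Finset.sum_add_distrib]

lemma metaExp_sub (θ : Params S) (ξ : Meta S) (A : Action K N) (v w : Meta S → ℝ) :
    metaExp θ ξ A (fun ξ => v ξ - w ξ) = metaExp θ ξ A v - metaExp θ ξ A w := by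
  simp [metaExp, mul_sub, Finset.sum_sub_distrib]

lemma metaExp_mem_Icc (θ : Params S) (ξ : Meta S) (A : Action K N) {v : Meta S → ℝ} {a b : ℝ}
    (h : ∀ ξ, v ξ ∈ Set.Icc a b) : metaExp θ ξ A v ∈ Set.Icc a b := by
  constructor
  · have := metaExp_mono θ ξ A (v := fun _ => a) fun ξ => (h ξ).1
    rwa [metaExp_const] at this
  · have := metaExp_mono θ ξ A (w := fun _ => b) fun ξ => (h ξ).2
    rwa [metaExp_const] at this

lemma metaReward_eq_sum_armsProb (r : ∀ k, S k → ℝ) (θ : Params S) (ξ : Meta S) (A : Action K N) :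
    metaReward r θ ξ A = ∑ s, armsProb θ ξ s * ∑ k ∈ A.1, r k (s k) := by
  simp_rw [Finset.mul_sum]
  rw [Finset.sum_comm]
  exact Finset.sum_congr rfl fun k _ => (sum_armsProb_mul θ ξ k (r k)).symm

lemma metaReward_mem_Icc {r : ∀ k, S k → ℝ} (hr : ∀ k s, r k s ∈ Set.Icc (0 : ℝ) 1)
    (θ : Params S) (ξ : Meta S) (A : Action K N) : metaReward r θ ξ A ∈ Set.Icc (0 : ℝ) N := by
  constructor
  · exact Finset.sum_nonneg fun k _ => Finset.sum_nonneg fun s _ =>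
      mul_nonneg (stateProb_nonneg ..) (hr k s).1
  · have : metaReward r θ ξ A ≤ ∑ k ∈ A.1, (1 : ℝ) := by
      refine Finset.sum_le_sum fun k _ => ?_
      rw [← sum_stateProb θ k (ξ.last k) (ξ.age k)]
      exact Finset.sum_le_sum fun s _ => mul_le_of_le_one_right (stateProb_nonneg ..) (hr k s).2
    simpa [A.2] using this

lemma metaReward_one_sub (r : ∀ k, S k → ℝ) (θ : Params S) (ξ : Meta S) (A : Action K N) :
    metaReward (fun k s => 1 - r k s) θ ξ A = N - metaReward r θ ξ A := by
  simp [metaReward, mul_sub, Finset.sum_sub_distrib, sum_stateProb, A.2]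

end Basic

/-! ### Average reward and bias by the vanishing discount method -/

section Planning

variable {K N : ℕ} {S : Fin K → Type*} [∀ k, Fintype (S k)] [∀ k, DecidableEq (S k)]

/-- The transition operator of the Markov process of meta-states under the policy `π`. -/
def policyOp (θ : Params S) (π : Policy S N) (v : Meta S → ℝ) (ξ : Meta S) : ℝ :=
  metaExp θ ξ (π ξ) v

lemma expReward_zero (r : ∀ k, S k → ℝ) (θ : Params S) (π : Policy S N) (ξ : Meta S) :
    expReward r θ π 0 ξ = metaReward r θ ξ (π ξ) := rfl

lemma expReward_succ (r : ∀ k, S k → ℝ) (θ : Params S) (π : Policy S N) (t : ℕ) (ξ : Meta S) :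
    expReward r θ π (t + 1) ξ = metaExp θ ξ (π ξ) (expReward r θ π t) := by
  rw [expReward, Function.iterate_succ_apply']; rfl

lemma expReward_mem_Icc {r : ∀ k, S k → ℝ} (hr : ∀ k s, r k s ∈ Set.Icc (0 : ℝ) 1)
    (θ : Params S) (π : Policy S N) (t : ℕ) (ξ : Meta S) :
    expReward r θ π t ξ ∈ Set.Icc (0 : ℝ) N := by
  induction t generalizing ξ with
  | zero => exact metaReward_mem_Icc hr θ ξ _
  | succ t ih => rw [expReward_succ]; exact metaExp_mem_Icc θ ξ _ ih

lemma meanReward_mem_Icc {r : ∀ k, S k → ℝ} (hr : ∀ k s, r k s ∈ Set.Icc (0 : ℝ) 1)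
    (θ : Params S) (π : Policy S N) (ξ : Meta S) (T : ℕ) :
    meanReward r θ π ξ T ∈ Set.Icc (0 : ℝ) N := by
  rw [meanReward]
  constructor
  · exact mul_nonneg (by positivity)
      (Finset.sum_nonneg fun t _ => (expReward_mem_Icc hr θ π t ξ).1)
  · rcases Nat.eq_zero_or_pos T with rfl | hT
    · simp
    · have : ∑ t ∈ Finset.range T, expReward r θ π t ξ ≤ ∑ t ∈ Finset.range T, (N : ℝ) :=
        Finset.sum_le_sum fun t _ => (expReward_mem_Icc hr θ π t ξ).2
      rw [Finset.sum_const, Finset.card_range, nsmul_eq_mul] at this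
      have hT' : (0 : ℝ) < T := by exact_mod_cast hT
      rw [one_div, inv_mul_le_iff₀ hT']
      exact this

lemma summable_discounted {r : ∀ k, S k → ℝ} (hr : ∀ k s, r k s ∈ Set.Icc (0 : ℝ) 1)
    (θ : Params S) (π : Policy S N) {β : ℝ} (h0 : 0 < β) (h1 : β < 1) (ξ : Meta S) :
    Summable fun t : ℕ => β ^ (t + 1) * expReward r θ π t ξ := by
  refine Summable.of_nonneg_of_le (f := fun t : ℕ => β ^ t * (β * N)) ?_ ?_ ?_
  · exact fun t => mul_nonneg (by positivity) (expReward_mem_Icc hr θ π t ξ).1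
  · intro t
    rw [pow_succ, mul_assoc]
    have := (expReward_mem_Icc hr θ π t ξ).2
    gcongr
  · exact (summable_geometric_of_lt_one h0.le h1).mul_right _

lemma discountedValue_mem_Icc {r : ∀ k, S k → ℝ} (hr : ∀ k s, r k s ∈ Set.Icc (0 : ℝ) 1)
    (θ : Params S) (π : Policy S N) {β : ℝ} (h0 : 0 < β) (h1 : β < 1) (ξ : Meta S) :
    (1 - β) * discountedValue r θ π β ξ ∈ Set.Icc (0 : ℝ) N := by
  have hs := summable_discounted hr θ π h0 h1 ξ
  constructor
  · exact mul_nonneg (by linarith) (tsum_nonneg fun t =>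
      mul_nonneg (by positivity) (expReward_mem_Icc hr θ π t ξ).1)
  · have h2 : discountedValue r θ π β ξ ≤ ∑' t : ℕ, β ^ t * (N : ℝ) := by
      refine hs.tsum_le_tsum (fun t => ?_) ((summable_geometric_of_lt_one h0.le h1).mul_right _)
      have := expReward_mem_Icc hr θ π t ξ
      have h3 : β ^ (t + 1) ≤ β ^ t := pow_le_pow_of_le_one h0.le h1.le (by omega)
      exact mul_le_mul h3 this.2 this.1 (by positivity)
    rw [tsum_mul_right, tsum_geometric_of_lt_one h0.le h1] at h2
    have h4 : (0 : ℝ) < 1 - β := by linarith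
    calc (1 - β) * discountedValue r θ π β ξ ≤ (1 - β) * ((1 - β)⁻¹ * N) := by gcongr
      _ = N := by field_simp

lemma discountedValue_eq {r : ∀ k, S k → ℝ} (hr : ∀ k s, r k s ∈ Set.Icc (0 : ℝ) 1)
    (θ : Params S) (π : Policy S N) {β : ℝ} (h0 : 0 < β) (h1 : β < 1) (ξ : Meta S) :
    discountedValue r θ π β ξ =
      β * metaReward r θ ξ (π ξ) + β * metaExp θ ξ (π ξ) (discountedValue r θ π β) := by
  have hs := summable_discounted hr θ π h0 h1
  rw [discountedValue, (hs ξ).tsum_eq_zero_add]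
  congr 1
  · simp [expReward_zero]
  · simp only [metaExp_eq, discountedValue, Finset.mul_sum]
    have h2 : ∀ s : ∀ k, S k, Summable fun t : ℕ => β * (armsProb θ ξ s *
        (β ^ (t + 1) * expReward r θ π t (ξ.next (π ξ) s))) := fun s =>
      ((hs _).mul_left _).mul_left _
    simp_rw [← tsum_mul_left]
    rw [← Summable.tsum_finsetSum fun s _ => h2 s]
    refine tsum_congr fun t => ?_
    rw [expReward_succ, metaExp_eq, Finset.mul_sum]
    exact Finset.sum_congr rfl fun s _ => by ring

/-- A bounded span of the discounted values gives a solution of the Bellman equation: the limit of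
the normalized discounted values along an ultrafilter that converges to the discount factor `1`. -/
lemma exists_bias_of_boundedSpan {r : ∀ k, S k → ℝ} (hr : ∀ k s, r k s ∈ Set.Icc (0 : ℝ) 1)
    (θ : Params S) (π : Policy S N) (hspan : BoundedSpan r θ π) (ξ₀ : Meta S) :
    ∃ J h, IsBias r θ π J h ∧ ∃ C : ℝ, ∀ ξ ξ', h ξ - h ξ' ≤ C := by
  obtain ⟨C, hC⟩ := hspan
  let U : Ultrafilter ℝ := Ultrafilter.of (𝓝[<] (1 : ℝ))
  have hU : (U : Filter ℝ) ≤ 𝓝[<] 1 := Ultrafilter.of_le _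
  have hmem : ∀ᶠ β in (U : Filter ℝ), 0 < β ∧ β < 1 := by
    refine hU ?_
    have : Set.Ioo (0 : ℝ) 1 ∈ 𝓝[<] (1 : ℝ) := Ioo_mem_nhdsLT one_pos
    exact this
  have hβ : Tendsto (fun β : ℝ => β) U (𝓝 1) := hU.trans nhdsWithin_le_nhds
  have hlim : ∀ (f : ℝ → ℝ) (a b : ℝ), (∀ β, 0 < β → β < 1 → f β ∈ Set.Icc a b) →
      ∃ x ∈ Set.Icc a b, Tendsto f U (𝓝 x) := by
    intro f a b hf
    have : Set.Icc a b ∈ U.map f :=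
      hmem.mono fun β hβ => hf β hβ.1 hβ.2
    exact isCompact_Icc.ultrafilter_le_nhds' (U.map f) this
  obtain ⟨J, -, hJ⟩ := hlim (fun β => (1 - β) * discountedValue r θ π β ξ₀) 0 N
    fun β h0 h1 => discountedValue_mem_Icc hr θ π h0 h1 ξ₀
  have hex : ∀ ξ, ∃ x ∈ Set.Icc (-C) C, Tendsto (fun β => discountedValue r θ π β ξ -
      discountedValue r θ π β ξ₀) U (𝓝 x) := fun ξ => hlim _ _ _ fun β h0 h1 =>
    ⟨by have := hC β h0 h1 ξ₀ ξ; linarith, hC β h0 h1 ξ ξ₀⟩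
  choose h hh hlimh using hex
  refine ⟨J, fun ξ => h ξ + C, ⟨fun ξ => by have := (hh ξ).1; linarith, fun ξ => ?_⟩,
    C - -C, fun ξ ξ' => by have := (hh ξ).2; have := (hh ξ').1; linarith⟩
  have hP : Tendsto (fun β => metaExp θ ξ (π ξ) fun ξ' => discountedValue r θ π β ξ' -
      discountedValue r θ π β ξ₀) U (𝓝 (metaExp θ ξ (π ξ) h)) :=
    tendsto_finsetSum _ fun s _ => (hlimh _).const_mul _
  have hl := hJ.add (hlimh ξ)
  have hr' := (hβ.mul_const (metaReward r θ ξ (π ξ))).add (hβ.mul hP)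
  have heq : J + h ξ = 1 * metaReward r θ ξ (π ξ) + 1 * metaExp θ ξ (π ξ) h := by
    refine tendsto_nhds_unique_of_eventuallyEq hl hr' ?_
    filter_upwards [hmem] with β hβ
    have h2 := discountedValue_eq hr θ π hβ.1 hβ.2 ξ
    have h3 := metaExp_sub θ ξ (π ξ) (discountedValue r θ π β)
      fun _ => discountedValue r θ π β ξ₀
    rw [metaExp_const] at h3
    rw [h3]
    linear_combination h2
  rw [metaExp_add, metaExp_const]
  linarith

lemma expReward_eq_of_bias {r : ∀ k, S k → ℝ} {θ : Params S} {π : Policy S N} {J : ℝ}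
    {h : Meta S → ℝ} (hb : IsBias r θ π J h) (t : ℕ) (ξ : Meta S) :
    expReward r θ π t ξ = J + ((policyOp θ π)^[t] h ξ - (policyOp θ π)^[t + 1] h ξ) := by
  induction t generalizing ξ with
  | zero =>
    have h1 := hb.2 ξ
    have h2 : (policyOp θ π)^[0 + 1] h ξ = metaExp θ ξ (π ξ) h := rfl
    rw [expReward_zero, h2, Function.iterate_zero, id]
    linarith
  | succ t ih =>
    rw [expReward_succ, funext ih, metaExp_add, metaExp_sub, metaExp_const,
      Function.iterate_succ_apply' (policyOp θ π) (t + 1) h,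
      show (policyOp θ π)^[t + 1] h ξ = metaExp θ ξ (π ξ) ((policyOp θ π)^[t] h) by
        rw [Function.iterate_succ_apply']; rfl]
    rfl

/-- The constant in a Bellman equation with bounded bias is the average reward, from every initial
meta-state. -/
lemma tendsto_meanReward_of_bias {r : ∀ k, S k → ℝ} {θ : Params S} {π : Policy S N} {J : ℝ}
    {h : Meta S → ℝ} (hb : IsBias r θ π J h) {C : ℝ} (hC : ∀ ξ ξ', h ξ - h ξ' ≤ C) (ξ : Meta S) :
    Tendsto (meanReward r θ π ξ) atTop (𝓝 J) := by
  have hbd : ∀ t ξ', (policyOp θ π)^[t] h ξ' ∈ Set.Icc (h ξ - C) (h ξ + C) := by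
    intro t
    induction t with
    | zero => exact fun ξ' => ⟨by have := hC ξ ξ'; simp; linarith,
        by have := hC ξ' ξ; simp; linarith⟩
    | succ t ih =>
      intro ξ'
      rw [Function.iterate_succ_apply']
      exact metaExp_mem_Icc _ _ _ ih
  have hsum : ∀ T : ℕ, ∑ t ∈ Finset.range T, expReward r θ π t ξ =
      T * J + (h ξ - (policyOp θ π)^[T] h ξ) := by
    intro T
    simp_rw [expReward_eq_of_bias hb]
    rw [Finset.sum_add_distrib, Finset.sum_range_sub' (fun t => (policyOp θ π)^[t] h ξ)]
    simp
  rw [tendsto_iff_norm_sub_tendsto_zero]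
  refine squeeze_zero' (Eventually.of_forall fun _ => norm_nonneg _) (g := fun T : ℕ => C / T) ?_
    (tendsto_const_div_atTop_nhds_zero_nat C)
  filter_upwards [eventually_gt_atTop 0] with T hT
  have hT' : (0 : ℝ) < T := by exact_mod_cast hT
  have : meanReward r θ π ξ T - J = (h ξ - (policyOp θ π)^[T] h ξ) / T := by
    rw [meanReward, hsum]; field_simp; ring
  rw [this, norm_div, Real.norm_natCast, Real.norm_eq_abs]
  gcongr
  have := hbd T ξ
  rw [abs_le]
  exact ⟨by linarith [this.2], by linarith [this.1]⟩

end Planning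

/-! ### Countability and measurability -/

section Measurability

variable {K N : ℕ} {S : Fin K → Type*} [∀ k, Fintype (S k)]

instance : Countable (Meta S) :=
  Function.Injective.countable (f := fun ξ : Meta S => (ξ.last, ξ.age)) fun ξ ξ' h => by
    cases ξ; cases ξ'; simp_all

instance : Countable (Round S N) :=
  Function.Injective.countable (f := fun z : Round S N => (z.pre, z.act, z.post)) fun z z' h => by
    cases z; cases z'; simp_all

instance : Countable (World S N) :=
  Function.Injective.countable
    (f := fun w : World S N => (w.arms, w.hist, w.cur, w.start, w.prevLen)) fun w w' h => by
      cases w; cases w'; simp_all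

instance : MeasurableSingletonClass (World S N) := ⟨fun _ => trivial⟩

instance : DiscreteMeasurableSpace (World S N) := ⟨fun _ => trivial⟩

variable [∀ k, DecidableEq (S k)]

lemma measurable_active (k : Fin K) (i j : S k) :
    Measurable fun θ : Params S => Params.active θ k i j := by
  have h1 : Measurable fun θ : Params S => (θ.1 k).1 :=
    measurable_subtype_coe.comp ((measurable_pi_apply k).comp measurable_fst)
  exact (measurable_pi_apply j).comp ((measurable_pi_apply i).comp h1)

lemma measurable_passive (k : Fin K) (i j : S k) :
    Measurable fun θ : Params S => Params.passive θ k i j := by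
  have h1 : Measurable fun θ : Params S => (θ.2 k).1 :=
    measurable_subtype_coe.comp ((measurable_pi_apply k).comp measurable_snd)
  exact (measurable_pi_apply j).comp ((measurable_pi_apply i).comp h1)

lemma measurable_stateProb (k : Fin K) (s : S k) (n : ℕ+) (s' : S k) :
    Measurable fun θ : Params S => stateProb θ k s n s' := by
  have hpow : ∀ (m : ℕ) (i j : S k),
      Measurable fun θ : Params S => (Params.passive θ k ^ m) i j := by
    intro m
    induction m with
    | zero => intro i j; simp only [pow_zero]; exact measurable_const
    | succ m ih =>
      intro i j
      simp only [pow_succ, Matrix.mul_apply]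
      exact Finset.measurable_fun_sum _ fun x _ => (ih i x).mul (measurable_passive k x j)
  simp only [stateProb, Matrix.mul_apply]
  exact Finset.measurable_fun_sum _ fun x _ => (measurable_active k s x).mul (hpow _ x s')

lemma measurable_armsProb (ξ : Meta S) (s : ∀ k, S k) :
    Measurable fun θ : Params S => armsProb θ ξ s :=
  Finset.measurable_fun_prod _ fun k _ => measurable_stateProb k _ _ _

lemma measurable_likelihood (hist : List (Round S N)) :
    Measurable fun θ : Params S => likelihood hist θ := by
  induction hist with
  | nil => simp only [likelihood, List.map_nil, List.prod_nil]; exact measurable_const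
  | cons z l ih =>
    simp only [likelihood, List.map_cons, List.prod_cons] at ih ⊢
    exact (Finset.measurable_fun_prod _ fun k _ => measurable_stateProb k _ _ _).mul ih

lemma likelihood_nonneg (hist : List (Round S N)) (θ : Params S) : 0 ≤ likelihood hist θ := by
  refine List.prod_nonneg fun x hx => ?_
  obtain ⟨z, -, rfl⟩ := List.mem_map.1 hx
  exact Finset.prod_nonneg fun k _ => stateProb_nonneg ..

lemma stateProb_le_one (θ : Params S) (k : Fin K) (s : S k) (n : ℕ+) (s' : S k) :
    stateProb θ k s n s' ≤ 1 := by
  rw [← sum_stateProb θ k s n]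
  exact Finset.single_le_sum (fun x _ => stateProb_nonneg θ k s n x) (Finset.mem_univ s')

lemma likelihood_le_one (hist : List (Round S N)) (θ : Params S) : likelihood hist θ ≤ 1 := by
  induction hist with
  | nil => simp [likelihood]
  | cons z l ih =>
    have h1 : likelihood (z :: l) θ = (∏ k ∈ z.act.1,
      stateProb θ k (z.pre.last k) (z.pre.age k) (z.post.last k)) * likelihood l θ := by
      simp [likelihood]
    rw [h1]
    exact mul_le_one₀ (Finset.prod_le_one (fun k _ => stateProb_nonneg ..)
      fun k _ => stateProb_le_one ..) (likelihood_nonneg l θ) ih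

instance isProbabilityMeasure_posterior (Q : Measure (Params S)) [IsProbabilityMeasure Q]
    (hist : List (Round S N)) : IsProbabilityMeasure (posterior Q hist) := by
  rw [posterior]
  split_ifs with h
  · infer_instance
  · refine ⟨?_⟩
    rw [Measure.smul_apply, smul_eq_mul]
    refine ENNReal.inv_mul_cancel h ?_
    rw [withDensity_apply _ MeasurableSet.univ]
    refine ((lintegral_mono fun θ => ENNReal.ofReal_le_one.2 (likelihood_le_one hist θ)).trans_lt
      ?_).ne
    simp

lemma posterior_absolutelyContinuous (Q : Measure (Params S)) (hist : List (Round S N)) :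
    posterior Q hist ≪ Q := by
  rw [posterior]
  split_ifs with h
  · exact Measure.AbsolutelyContinuous.rfl
  · exact (Measure.smul_absolutelyContinuous).trans (withDensity_absolutelyContinuous _ _)

/-- A function of the action that a measurable policy mapping prescribes in a fixed meta-state. -/
lemma measurable_comp_policy {μ : Params S → Policy S N}
    (hμ : ∀ (ξ : Meta S) (A : Action K N), MeasurableSet {θ | μ θ ξ = A}) {β : Type*}
    [MeasurableSpace β] (ξ : Meta S) (f : Action K N → β) :
    Measurable fun ϑ : Params S => f (μ ϑ ξ) := by
  intro B _
  have : (fun ϑ : Params S => f (μ ϑ ξ)) ⁻¹' B = ⋃ A ∈ {A | f A ∈ B}, {ϑ | μ ϑ ξ = A} := by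
    ext ϑ; simp
  rw [this]
  exact MeasurableSet.biUnion (Set.to_countable _) fun A _ => hμ ξ A

end Measurability

/-! ### The process of observations -/

section Observation

variable {K N : ℕ} {S : Fin K → Type*} [∀ k, Fintype (S k)] [∀ k, DecidableEq (S k)]

/-- Replace the hidden states of the arms. -/
def World.withArms (w : World S N) (s : ∀ k, S k) : World S N := { w with arms := s }

/-- The arms in `A` are pulled while the current states of the arms are `s`; the component `arms` of
the world is ignored and kept. -/
def World.obs (w : World S N) (A : Action K N) (s : ∀ k, S k) : World S N :=
  (w.withArms s).advance A w.arms

/-- One round of the algorithm as seen by the learner: the states of the arms are drawn given the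
meta-state, and the hidden component `arms` plays no role. -/
def obsStep (Q : Measure (Params S)) (μ : Params S → Policy S N) (Tmix : ℝ) (θ : Params S)
    (x : World S N × Params S) : Measure (World S N × Params S) :=
  ∑ s : ∀ k, S k, ENNReal.ofReal (armsProb θ x.1.cur s) •
    resample Q Tmix (x.1.obs (μ x.2 x.1.cur) s) x.2

/-- The law of the observable part of the situation after `t` rounds; the component `arms` has an
arbitrary constant value. -/
def obsLaw (Q : Measure (Params S)) (μ : Params S → Policy S N) (Tmix : ℝ) (ξ₁ : Meta S)
    (θ : Params S) : ℕ → Measure (World S N × Params S)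
  | 0 => Q.map fun ϑ => (⟨ξ₁.last, [], ξ₁, 1, 0⟩, ϑ)
  | t + 1 => (obsLaw Q μ Tmix ξ₁ θ t).bind (obsStep Q μ Tmix θ)

/-- Draw the hidden states of the arms, given the meta-state. -/
def drawArms (θ : Params S) (x : World S N × Params S) : Measure (World S N × Params S) :=
  ∑ s : ∀ k, S k, ENNReal.ofReal (armsProb θ x.1.cur s) •
    Measure.dirac (x.1.withArms s, x.2)

variable {Q : Measure (Params S)} {μ : Params S → Policy S N} {Tmix : ℝ} {ξ₁ : Meta S}

lemma measurable_resample : Measurable fun x : World S N × Params S => resample Q Tmix x.1 x.2 := by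
  refine measurable_from_prod_countable_right fun w => ?_
  by_cases h : w.Terminates Tmix
  · simp only [resample, h, if_true]; exact measurable_const
  · simp only [resample, h, if_false]
    exact Measure.measurable_dirac.comp measurable_prodMk_left

lemma measurable_finset_sum_smul {α β ι : Type*} [MeasurableSpace α] [MeasurableSpace β]
    (s : Finset ι) {c : ι → α → ENNReal} {m : ι → α → Measure β} (hc : ∀ i, Measurable (c i))
    (hm : ∀ i, Measurable (m i)) : Measurable fun a => ∑ i ∈ s, c i a • m i a := by
  refine Measure.measurable_of_measurable_coe _ fun B hB => ?_
  simp only [Measure.finsetSum_apply, Measure.smul_apply, smul_eq_mul]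
  exact Finset.measurable_fun_sum _ fun i _ => (hc i).mul ((Measure.measurable_coe hB).comp (hm i))

lemma measurable_obsStep_prod
    (hμ : ∀ (ξ : Meta S) (A : Action K N), MeasurableSet {θ | μ θ ξ = A}) :
    Measurable fun p : Params S × (World S N × Params S) => obsStep Q μ Tmix p.1 p.2 := by
  have h1 : ∀ s, Measurable fun p : Params S × (World S N × Params S) =>
      ENNReal.ofReal (armsProb p.1 p.2.1.cur s) := by
    intro s
    have h : Measurable fun p : World S N × Params S => armsProb p.2 p.1.cur s :=
      measurable_from_prod_countable_right fun w => measurable_armsProb w.cur s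
    have h' : Measurable fun p : Params S × (World S N × Params S) => (p.2.1, p.1) :=
      (measurable_fst.comp measurable_snd).prodMk measurable_fst
    have h'' := h.comp h'
    exact h''.ennreal_ofReal
  have h2 : ∀ s, Measurable fun p : Params S × (World S N × Params S) =>
      resample Q Tmix (p.2.1.obs (μ p.2.2 p.2.1.cur) s) p.2.2 := by
    intro s
    have h : Measurable fun x : World S N × Params S => (x.1.obs (μ x.2 x.1.cur) s, x.2) :=
      measurable_from_prod_countable_right fun w =>
        (measurable_comp_policy hμ w.cur fun A => w.obs A s).prodMk measurable_id
    have h' := (measurable_resample (Q := Q) (Tmix := Tmix)).comp h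
    exact h'.comp (measurable_snd (α := Params S))
  exact measurable_finset_sum_smul Finset.univ h1 h2

lemma measurable_obsStep
    (hμ : ∀ (ξ : Meta S) (A : Action K N), MeasurableSet {θ | μ θ ξ = A}) (θ : Params S) :
    Measurable (obsStep Q μ Tmix θ) := by
  have h := (measurable_obsStep_prod (Q := Q) (Tmix := Tmix) hμ).comp
    (measurable_prodMk_left (x := θ))
  exact h

lemma measurable_step
    (hμ : ∀ (ξ : Meta S) (A : Action K N), MeasurableSet {θ | μ θ ξ = A}) (θ : Params S) :
    Measurable (step Q μ Tmix θ) := by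
  have h1 : ∀ s, Measurable fun x : World S N × Params S =>
      ENNReal.ofReal (moveProb θ (μ x.2 x.1.cur) x.1.arms s) := fun s =>
    measurable_from_prod_countable_right fun w => measurable_comp_policy hμ w.cur
      fun A => ENNReal.ofReal (moveProb θ A w.arms s)
  have h2 : ∀ s, Measurable fun x : World S N × Params S =>
      resample Q Tmix (x.1.advance (μ x.2 x.1.cur) s) x.2 := by
    intro s
    have h : Measurable fun x : World S N × Params S => (x.1.advance (μ x.2 x.1.cur) s, x.2) :=
      measurable_from_prod_countable_right fun w =>
        (measurable_comp_policy hμ w.cur fun A => w.advance A s).prodMk measurable_id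
    exact (measurable_resample (Q := Q) (Tmix := Tmix)).comp h
  exact measurable_finset_sum_smul Finset.univ h1 h2

lemma measurable_drawArms (θ : Params S) :
    Measurable (drawArms θ : World S N × Params S → Measure (World S N × Params S)) := by
  refine measurable_finset_sum_smul _ (fun s => ?_) fun s => ?_
  · exact (Measurable.of_discrete (f := fun w : World S N =>
      ENNReal.ofReal (armsProb θ w.cur s))).comp measurable_fst
  · exact Measure.measurable_dirac.comp (((Measurable.of_discrete
      (f := fun w : World S N => w.withArms s)).comp measurable_fst).prodMk measurable_snd)

lemma lintegral_resample {f : World S N × Params S → ENNReal} (hf : Measurable f) (w : World S N)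
    (ϑ : Params S) [Decidable (w.Terminates Tmix)] :
    ∫⁻ x, f x ∂(resample Q Tmix w ϑ) =
      if w.Terminates Tmix then ∫⁻ ϑ', f (w.newEpisode, ϑ') ∂(posterior Q w.hist)
      else f (w, ϑ) := by
  rw [resample]
  split_ifs with h
  · exact lintegral_map hf measurable_prodMk_left
  · exact lintegral_dirac' _ hf

lemma lintegral_obsStep {f : World S N × Params S → ENNReal} (θ : Params S)
    (x : World S N × Params S) :
    ∫⁻ y, f y ∂(obsStep Q μ Tmix θ x) = ∑ s, ENNReal.ofReal (armsProb θ x.1.cur s) *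
      ∫⁻ y, f y ∂(resample Q Tmix (x.1.obs (μ x.2 x.1.cur) s) x.2) := by
  simp [obsStep, lintegral_finsetSum_measure]

lemma lintegral_drawArms {f : World S N × Params S → ENNReal} (hf : Measurable f) (θ : Params S)
    (x : World S N × Params S) :
    ∫⁻ y, f y ∂(drawArms θ x) = ∑ s, ENNReal.ofReal (armsProb θ x.1.cur s) *
      f (x.1.withArms s, x.2) := by
  simp [drawArms, lintegral_finsetSum_measure, lintegral_dirac' _ hf]

lemma lintegral_obsLaw_succ
    (hμ : ∀ (ξ : Meta S) (A : Action K N), MeasurableSet {θ | μ θ ξ = A}) (θ : Params S) (t : ℕ)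
    {f : World S N × Params S → ENNReal} (hf : Measurable f) :
    ∫⁻ y, f y ∂(obsLaw Q μ Tmix ξ₁ θ (t + 1)) =
      ∫⁻ x, ∫⁻ y, f y ∂(obsStep Q μ Tmix θ x) ∂(obsLaw Q μ Tmix ξ₁ θ t) :=
  Measure.lintegral_bind (measurable_obsStep hμ θ).aemeasurable hf.aemeasurable

lemma lintegral_obsLaw_zero (θ : Params S)
    {f : World S N × Params S → ENNReal} (hf : Measurable f) :
    ∫⁻ y, f y ∂(obsLaw Q μ Tmix ξ₁ θ 0) = ∫⁻ ϑ, f (⟨ξ₁.last, [], ξ₁, 1, 0⟩, ϑ) ∂Q :=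
  lintegral_map hf measurable_prodMk_left

/-- Drawing the hidden states after resampling amounts to drawing them before. -/
lemma lintegral_resample_drawArms {f : World S N × Params S → ENNReal} (hf : Measurable f)
    (θ : Params S) (w : World S N) (ϑ : Params S) :
    ∫⁻ x, ∫⁻ y, f y ∂(drawArms θ x) ∂(resample Q Tmix w ϑ) =
      ∑ s, ENNReal.ofReal (armsProb θ w.cur s) *
        ∫⁻ y, f y ∂(resample Q Tmix (w.withArms s) ϑ) := by
  classical
  have hm : Measurable fun x => ∫⁻ y, f y ∂(drawArms θ x) :=
    (Measure.measurable_lintegral hf).comp (measurable_drawArms θ)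
  rw [lintegral_resample hm]
  by_cases h : w.Terminates Tmix
  · have h' : ∀ s, (w.withArms s).Terminates Tmix := fun s => h
    simp only [lintegral_resample hf, h, h', if_true, lintegral_drawArms hf]
    have hm' : ∀ w' : World S N, Measurable fun ϑ' => f (w', ϑ') := fun w' =>
      hf.comp measurable_prodMk_left
    rw [lintegral_finsetSum _ fun s _ => (hm' _).const_mul _]
    refine Finset.sum_congr rfl fun s _ => ?_
    rw [lintegral_const_mul _ (hm' _)]
    rfl
  · have h' : ∀ s, ¬ (w.withArms s).Terminates Tmix := fun s => h
    simp only [lintegral_resample hf, h, h', if_false, lintegral_drawArms hf]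

lemma ofReal_armsProb (θ : Params S) (ξ : Meta S) (s : ∀ k, S k) :
    ENNReal.ofReal (armsProb θ ξ s) =
      ∏ k, ENNReal.ofReal (stateProb θ k (ξ.last k) (ξ.age k) (s k)) :=
  ENNReal.ofReal_prod_of_nonneg fun _ _ => stateProb_nonneg ..

lemma passive_nonneg (θ : Params S) (k : Fin K) (i j : S k) : 0 ≤ Params.passive θ k i j :=
  Matrix.nonneg_of_mem_rowStochastic (θ.2 k).2

lemma moveEntry_nonneg (θ : Params S) (A : Action K N) (k : Fin K) (i j : S k) :
    0 ≤ (if k ∈ A.1 then Params.active θ k else Params.passive θ k) i j := by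
  split_ifs
  · exact Matrix.nonneg_of_mem_rowStochastic (θ.1 k).2
  · exact Matrix.nonneg_of_mem_rowStochastic (θ.2 k).2

/-- Given the meta-state and the observations of a round, the hidden states of the arms after the
round are independent, with the distributions given by the next meta-state. -/
lemma bind_drawArms_step
    (hμ : ∀ (ξ : Meta S) (A : Action K N), MeasurableSet {θ | μ θ ξ = A}) (θ : Params S)
    (x : World S N × Params S) :
    (drawArms θ x).bind (step Q μ Tmix θ) = (obsStep Q μ Tmix θ x).bind (drawArms θ) := by
  classical
  obtain ⟨w, ϑ⟩ := x
  refine Measure.ext_of_lintegral _ fun f hf => ?_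
  have hstep : Measurable fun x => ∫⁻ y, f y ∂(step Q μ Tmix θ x) :=
    (Measure.measurable_lintegral hf).comp (measurable_step hμ θ)
  rw [Measure.lintegral_bind (measurable_step hμ θ).aemeasurable hf.aemeasurable,
    Measure.lintegral_bind (measurable_drawArms θ).aemeasurable hf.aemeasurable,
    lintegral_drawArms hstep, lintegral_obsStep]
  simp_rw [lintegral_resample_drawArms hf]
  simp only [step, lintegral_finsetSum_measure, lintegral_smul_measure, smul_eq_mul,
    Finset.mul_sum]
  rw [Finset.sum_comm]
  conv_rhs => rw [Finset.sum_comm]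
  refine Finset.sum_congr rfl fun s' _ => ?_
  set A := μ ϑ w.cur with hA
  have key := sum_prod_mul_congr (R := ENNReal) A.1
    (fun k x => ENNReal.ofReal (stateProb θ k (w.cur.last k) (w.cur.age k) x) *
      ENNReal.ofReal ((if k ∈ A.1 then Params.active θ k else Params.passive θ k) x (s' k)))
    (fun k x => ENNReal.ofReal (stateProb θ k (w.cur.last k) (w.cur.age k) x) *
      ENNReal.ofReal (stateProb θ k (if k ∈ A.1 then x else w.cur.last k)
        (if k ∈ A.1 then 1 else w.cur.age k + 1) (s' k)))
    (fun k hk => by funext x; simp [hk, stateProb_one])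
    (fun k hk => by
      simp only [hk, if_false]
      rw [← Finset.sum_mul, ← ENNReal.ofReal_sum_of_nonneg fun _ _ => stateProb_nonneg ..,
        sum_stateProb, ENNReal.ofReal_one, one_mul, stateProb_succ,
        ENNReal.ofReal_sum_of_nonneg fun x _ => mul_nonneg (stateProb_nonneg ..)
          (passive_nonneg θ k _ _)]
      exact Finset.sum_congr rfl fun x _ => (ENNReal.ofReal_mul (stateProb_nonneg ..)).symm)
    (fun s => ∫⁻ y, f y ∂(resample Q Tmix ((w.withArms s).advance A s') ϑ))
    (fun s₁ s₂ h => by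
      have : (w.withArms s₁).advance A s' = (w.withArms s₂).advance A s' := by
        have hn : w.cur.next A s₁ = w.cur.next A s₂ := by
          simp only [Meta.next, Meta.mk.injEq, and_true]
          funext k
          split_ifs with hk
          · exact h k hk
          · rfl
        simp only [World.advance, World.withArms, hn]
      rw [this])
  simp only [Finset.prod_mul_distrib] at key
  convert key using 2 with s _ s _
  · rw [ofReal_armsProb, ← mul_assoc]
    congr 1
    rw [moveProb, ENNReal.ofReal_prod_of_nonneg fun k _ => moveEntry_nonneg ..]
    rfl
  · rw [ofReal_armsProb, ofReal_armsProb, ← mul_assoc]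
    rfl

/-- Given the observable part of the situation, the hidden states of the arms are independent with
the distributions given by the meta-state. -/
lemma law_eq_bind_drawArms
    (hμ : ∀ (ξ : Meta S) (A : Action K N), MeasurableSet {θ | μ θ ξ = A}) (θ : Params S) (t : ℕ) :
    law Q μ Tmix ξ₁ θ t = (obsLaw Q μ Tmix ξ₁ θ t).bind (drawArms θ) := by
  induction t with
  | zero =>
    refine Measure.ext_of_lintegral _ fun f hf => ?_
    have hm : Measurable fun x => ∫⁻ y, f y ∂(drawArms θ x) :=
      (Measure.measurable_lintegral hf).comp (measurable_drawArms θ)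
    have hm' : ∀ w' : World S N, Measurable fun ϑ' => f (w', ϑ') := fun w' =>
      hf.comp measurable_prodMk_left
    rw [Measure.lintegral_bind (measurable_drawArms θ).aemeasurable hf.aemeasurable,
      lintegral_obsLaw_zero _ hm]
    simp only [lintegral_drawArms hf, law, lintegral_finsetSum_measure, lintegral_smul_measure,
      smul_eq_mul]
    rw [lintegral_finsetSum _ fun s _ => (hm' _).const_mul _]
    refine Finset.sum_congr rfl fun s _ => ?_
    rw [lintegral_const_mul _ (hm' _), lintegral_map hf measurable_prodMk_left]
    rfl
  | succ t ih =>
    rw [law, ih, obsLaw, Measure.bind_bind (measurable_drawArms θ).aemeasurable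
      (measurable_step hμ θ).aemeasurable, Measure.bind_bind
      (measurable_obsStep hμ θ).aemeasurable (measurable_drawArms θ).aemeasurable]
    simp_rw [bind_drawArms_step hμ θ]

/-- The rewards may be computed from the observable part of the situation. -/
lemma lintegral_law_hist
    (hμ : ∀ (ξ : Meta S) (A : Action K N), MeasurableSet {θ | μ θ ξ = A}) (θ : Params S) (t : ℕ)
    (f : List (Round S N) → ENNReal) :
    ∫⁻ x, f x.1.hist ∂(law Q μ Tmix ξ₁ θ t) = ∫⁻ x, f x.1.hist ∂(obsLaw Q μ Tmix ξ₁ θ t) := by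
  have hf : Measurable fun x : World S N × Params S => f x.1.hist :=
    (Measurable.of_discrete (f := fun w : World S N => f w.hist)).comp measurable_fst
  rw [law_eq_bind_drawArms hμ, Measure.lintegral_bind (measurable_drawArms θ).aemeasurable
    hf.aemeasurable]
  refine lintegral_congr fun x => ?_
  rw [lintegral_drawArms hf]
  change ∑ s, ENNReal.ofReal (armsProb θ x.1.cur s) * f x.1.hist = _
  rw [← Finset.sum_mul, ← ENNReal.ofReal_sum_of_nonneg fun _ _ => armsProb_nonneg .., sum_armsProb]
  simp

end Observation

/-! ### Invariants and one-step estimates -/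

section Chain

variable {K N : ℕ} {S : Fin K → Type*} [∀ k, Fintype (S k)] [∀ k, DecidableEq (S k)]
variable {Q : Measure (Params S)} {μ : Params S → Policy S N} {Tmix : ℝ} {ξ₁ : Meta S}

instance isProbabilityMeasure_resample [IsProbabilityMeasure Q] (w : World S N) (ϑ : Params S) :
    IsProbabilityMeasure (resample Q Tmix w ϑ) := by
  rw [resample]
  split_ifs
  · exact Measure.isProbabilityMeasure_map measurable_prodMk_left.aemeasurable
  · infer_instance

instance isProbabilityMeasure_obsStep [IsProbabilityMeasure Q] (θ : Params S)
    (x : World S N × Params S) : IsProbabilityMeasure (obsStep Q μ Tmix θ x) := by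
  refine ⟨?_⟩
  simp only [obsStep, Measure.finsetSum_apply, Measure.smul_apply, measure_univ, smul_eq_mul,
    mul_one]
  rw [← ENNReal.ofReal_sum_of_nonneg fun _ _ => armsProb_nonneg .., sum_armsProb,
    ENNReal.ofReal_one]

lemma isProbabilityMeasure_obsLaw [IsProbabilityMeasure Q]
    (hμ : ∀ (ξ : Meta S) (A : Action K N), MeasurableSet {θ | μ θ ξ = A}) (θ : Params S) (t : ℕ) :
    IsProbabilityMeasure (obsLaw Q μ Tmix ξ₁ θ t) := by
  induction t with
  | zero => exact Measure.isProbabilityMeasure_map measurable_prodMk_left.aemeasurable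
  | succ t ih =>
    refine ⟨?_⟩
    rw [obsLaw, Measure.bind_apply MeasurableSet.univ (measurable_obsStep hμ θ).aemeasurable]
    simp

/-- The facts about the situation at the beginning of round `t + 1`, after a possible change of the
episode. -/
structure World.Valid (Tmix : ℝ) (t : ℕ) (w : World S N) : Prop where
  length_hist : w.hist.length = t
  one_le_start : 1 ≤ w.start
  start_le : w.start ≤ t + 1
  not_terminates : ¬ w.Terminates Tmix
  prevLen_le : w.prevLen ≤ t

/-- The episode starts in the current round. -/
def World.IsNew (w : World S N) : Prop := w.start = w.time

/-- `y` is a possible result of the resampling from `(w, ϑ)`. -/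
def IsSucc (Tmix : ℝ) (w : World S N) (ϑ : Params S) (y : World S N × Params S) : Prop :=
  (w.Terminates Tmix ∧ y.1 = w.newEpisode) ∨ (¬ w.Terminates Tmix ∧ y = (w, ϑ))

lemma World.Valid.zero : World.Valid (N := N) Tmix 0 ⟨ξ₁.last, [], ξ₁, 1, 0⟩ := by
  refine ⟨rfl, le_rfl, le_rfl, ?_, le_rfl⟩
  simp [World.Terminates, World.time, counter]

lemma World.Valid.start_le_of_obs {t : ℕ} {w : World S N} (h : w.Valid Tmix t) (A : Action K N)
    (s : ∀ k, S k) : (w.obs A s).start < (w.obs A s).time := by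
  have h1 := h.length_hist
  have h2 := h.start_le
  simp only [World.obs, World.withArms, World.advance, World.time, List.length_append,
    List.length_singleton]
  omega

lemma World.Valid.succ {t : ℕ} {w : World S N} (h : w.Valid Tmix t) (A : Action K N)
    (s : ∀ k, S k) {ϑ : Params S} {y : World S N × Params S}
    (hy : IsSucc Tmix (w.obs A s) ϑ y) : y.1.Valid Tmix (t + 1) := by
  have h1 := h.length_hist
  have h2 := h.start_le
  have h3 := h.one_le_start
  have hl : (w.obs A s).hist.length = t + 1 := by
    simp [World.obs, World.withArms, World.advance, h1]
  rcases hy with ⟨-, hy⟩ | ⟨hn, rfl⟩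
  · rw [hy]
    refine ⟨hl, ?_, ?_, ?_, ?_⟩
    · simp [World.newEpisode, World.time]
    · simp [World.newEpisode, World.time, hl]
    · rintro (h4 | ⟨k, s', n, h4⟩)
      · simp only [World.newEpisode, World.time] at h4
        omega
      · simp only [World.newEpisode, World.time, Nat.add_sub_cancel, List.take_length] at h4
        omega
    · have : (w.obs A s).start = w.start := rfl
      simp only [World.newEpisode, World.time, hl, this]
      omega
  · exact ⟨hl, h3, by change w.start ≤ _; omega, hn,
      by change w.prevLen ≤ _; have := h.prevLen_le; omega⟩

/-- The situation is consistent with the first `t` rounds, and the parameter of the running episode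
lies in `G`. -/
def ValidIn (Tmix : ℝ) (G : Set (Params S)) (t : ℕ) (x : World S N × Params S) : Prop :=
  x.1.Valid Tmix t ∧ x.2 ∈ G

lemma measurableSet_validIn {G : Set (Params S)} (hG : MeasurableSet G) (t : ℕ) :
    MeasurableSet {x : World S N × Params S | ValidIn Tmix G t x} :=
  ((MeasurableSet.of_discrete (s := {w : World S N | w.Valid Tmix t})).preimage
    measurable_fst).inter (hG.preimage measurable_snd)

lemma ae_resample {G : Set (Params S)} (hG : MeasurableSet G) (hQ : ∀ᵐ ϑ ∂Q, ϑ ∈ G) {t : ℕ}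
    {w : World S N} {ϑ : Params S} (hx : ValidIn Tmix G t (w, ϑ)) (A : Action K N)
    (s : ∀ k, S k) : ∀ᵐ y ∂(resample Q Tmix (w.obs A s) ϑ),
      ValidIn Tmix G (t + 1) y ∧ IsSucc Tmix (w.obs A s) ϑ y := by
  by_cases h : (w.obs A s).Terminates Tmix
  · rw [resample, if_pos h]
    have h1 : ∀ᵐ ϑ' ∂(posterior Q (w.obs A s).hist), ϑ' ∈ G :=
      (posterior_absolutelyContinuous Q _).ae_le hQ
    have h2 : ∀ᵐ y ∂((posterior Q (w.obs A s).hist).map fun ϑ' => ((w.obs A s).newEpisode, ϑ')),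
        y.1 = (w.obs A s).newEpisode ∧ y.2 ∈ G := by
      rw [ae_map_iff measurable_prodMk_left.aemeasurable]
      · filter_upwards [h1] with ϑ' hϑ' using ⟨rfl, hϑ'⟩
      · exact ((MeasurableSet.of_discrete (s := {w' | w' = (w.obs A s).newEpisode})).preimage
          measurable_fst).inter (hG.preimage measurable_snd)
    filter_upwards [h2] with y hy
    have h3 : IsSucc Tmix (w.obs A s) ϑ y := Or.inl ⟨h, hy.1⟩
    exact ⟨⟨hx.1.succ A s h3, hy.2⟩, h3⟩
  · rw [resample, if_neg h]
    have h3 : IsSucc Tmix (w.obs A s) ϑ (w.obs A s, ϑ) := Or.inr ⟨h, rfl⟩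
    have h4 : ValidIn Tmix G (t + 1) (w.obs A s, ϑ) ∧ IsSucc Tmix (w.obs A s) ϑ (w.obs A s, ϑ) :=
      ⟨⟨hx.1.succ A s h3, hx.2⟩, h3⟩
    refine (ae_dirac_iff ?_).2 h4
    refine (measurableSet_validIn hG (t + 1)).inter
      (s₂ := {y | IsSucc Tmix (w.obs A s) ϑ y}) ?_
    have h5 : {y : World S N × Params S | IsSucc Tmix (w.obs A s) ϑ y} = {(w.obs A s, ϑ)} := by
      ext y; simp [IsSucc, h]
    rw [show {y | IsSucc Tmix (w.obs A s) ϑ y} = _ from h5]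
    have h6 : MeasurableSingletonClass (∀ k, StochMat (S k)) := inferInstance
    rw [← Set.singleton_prod_singleton, ← Set.singleton_prod_singleton]
    exact (MeasurableSet.singleton _).prod
      (MeasurableSet.prod (MeasurableSet.singleton ϑ.1) (MeasurableSet.singleton ϑ.2))

lemma ae_obsLaw [IsProbabilityMeasure Q]
    (hμ : ∀ (ξ : Meta S) (A : Action K N), MeasurableSet {θ | μ θ ξ = A})
    {G : Set (Params S)} (hG : MeasurableSet G) (hQ : ∀ᵐ ϑ ∂Q, ϑ ∈ G) (θ : Params S) (t : ℕ) :
    ∀ᵐ x ∂(obsLaw Q μ Tmix ξ₁ θ t), ValidIn Tmix G t x := by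
  induction t with
  | zero =>
    rw [obsLaw, ae_map_iff measurable_prodMk_left.aemeasurable (measurableSet_validIn hG 0)]
    filter_upwards [hQ] with ϑ hϑ using ⟨World.Valid.zero, hϑ⟩
  | succ t ih =>
    have hm := (measurableSet_validIn (N := N) (Tmix := Tmix) hG (t + 1)).compl
    rw [ae_iff]
    change obsLaw Q μ Tmix ξ₁ θ (t + 1) {x | ValidIn Tmix G (t + 1) x}ᶜ = 0
    rw [obsLaw, Measure.bind_apply hm (measurable_obsStep hμ θ).aemeasurable]
    refine (lintegral_congr_ae (g := 0) ?_).trans (by simp)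
    filter_upwards [ih] with x hx
    simp only [obsStep, Measure.finsetSum_apply, Measure.smul_apply, smul_eq_mul, Pi.zero_apply]
    refine Finset.sum_eq_zero fun s _ => ?_
    have h := (ae_resample hG hQ hx (μ x.2 x.1.cur) s).mono fun y hy => hy.1
    have h0 : resample Q Tmix (x.1.obs (μ x.2 x.1.cur) s) x.2 {x | ValidIn Tmix G (t + 1) x}ᶜ = 0 :=
      h
    rw [h0, mul_zero]

lemma integrable_obsLaw [IsProbabilityMeasure Q]
    (hμ : ∀ (ξ : Meta S) (A : Action K N), MeasurableSet {θ | μ θ ξ = A})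
    {G : Set (Params S)} (hG : MeasurableSet G) (hQ : ∀ᵐ ϑ ∂Q, ϑ ∈ G) (θ : Params S) (t : ℕ)
    {F : World S N × Params S → ℝ} (hF : Measurable F) {C : ℝ}
    (hC : ∀ x, ValidIn Tmix G t x → |F x| ≤ C) : Integrable F (obsLaw Q μ Tmix ξ₁ θ t) := by
  have := isProbabilityMeasure_obsLaw (Q := Q) (Tmix := Tmix) (ξ₁ := ξ₁) hμ θ t
  refine Integrable.of_bound hF.aestronglyMeasurable C ?_
  filter_upwards [ae_obsLaw hμ hG hQ θ t] with x hx using hC x hx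

/-- A one-step estimate for the possible successors of each situation gives an estimate of the
expectations. -/
lemma integral_obsLaw_succ_le [IsProbabilityMeasure Q]
    (hμ : ∀ (ξ : Meta S) (A : Action K N), MeasurableSet {θ | μ θ ξ = A})
    {G : Set (Params S)} (hG : MeasurableSet G) (hQ : ∀ᵐ ϑ ∂Q, ϑ ∈ G) (θ : Params S) (t : ℕ)
    {F F₀ : World S N × Params S → ℝ} (hF : Measurable F) {C : ℝ}
    (hC : ∀ x, ValidIn Tmix G (t + 1) x → |F x| ≤ C)
    (hF₀ : Integrable F₀ (obsLaw Q μ Tmix ξ₁ θ t))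
    (F₁ : World S N × Params S → (∀ k, S k) → ℝ)
    (h₁ : ∀ x, ValidIn Tmix G t x → ∀ s y, ValidIn Tmix G (t + 1) y →
      IsSucc Tmix (x.1.obs (μ x.2 x.1.cur) s) x.2 y → F y ≤ F₁ x s)
    (h₀ : ∀ x, ValidIn Tmix G t x → ∑ s, armsProb θ x.1.cur s * F₁ x s ≤ F₀ x) :
    ∫ x, F x ∂(obsLaw Q μ Tmix ξ₁ θ (t + 1)) ≤ ∫ x, F₀ x ∂(obsLaw Q μ Tmix ξ₁ θ t) := by
  have hint := integrable_obsLaw (ξ₁ := ξ₁) hμ hG hQ θ (t + 1) hF hC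
  have := isProbabilityMeasure_obsLaw (Q := Q) (Tmix := Tmix) (ξ₁ := ξ₁) hμ θ t
  let η : ProbabilityTheory.Kernel (World S N × Params S) (World S N × Params S) :=
    ⟨obsStep Q μ Tmix θ, measurable_obsStep hμ θ⟩
  let κ : ProbabilityTheory.Kernel Unit (World S N × Params S) :=
    ProbabilityTheory.Kernel.const Unit (obsLaw Q μ Tmix ξ₁ θ t)
  have hc : (η.comp κ) () = obsLaw Q μ Tmix ξ₁ θ (t + 1) := by
    rw [ProbabilityTheory.Kernel.comp_apply]; rfl
  rw [← hc] at hint ⊢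
  rw [ProbabilityTheory.Kernel.integral_comp hint]
  refine integral_mono_ae hint.integral_comp hF₀ ?_
  have hae : ∀ᵐ x ∂(κ ()), ValidIn Tmix G t x := ae_obsLaw hμ hG hQ θ t
  filter_upwards [hae] with x hx
  refine le_trans ?_ (h₀ x hx)
  change ∫ y, F y ∂(obsStep Q μ Tmix θ x) ≤ _
  have hres : ∀ s, ∀ᵐ y ∂(resample Q Tmix (x.1.obs (μ x.2 x.1.cur) s) x.2),
      ValidIn Tmix G (t + 1) y ∧ IsSucc Tmix (x.1.obs (μ x.2 x.1.cur) s) x.2 y := fun s =>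
    ae_resample hG hQ hx (μ x.2 x.1.cur) s
  have hi : ∀ s, Integrable F (resample Q Tmix (x.1.obs (μ x.2 x.1.cur) s) x.2) := fun s =>
    Integrable.of_bound hF.aestronglyMeasurable C ((hres s).mono fun y hy => hC y hy.1)
  rw [obsStep, integral_finsetSum_measure fun s _ => (hi s).smul_measure ENNReal.ofReal_ne_top]
  refine Finset.sum_le_sum fun s _ => ?_
  rw [integral_smul_measure, ENNReal.toReal_ofReal (armsProb_nonneg ..), smul_eq_mul]
  refine mul_le_mul_of_nonneg_left ?_ (armsProb_nonneg ..)
  have : ∫ y, F y ∂(resample Q Tmix (x.1.obs (μ x.2 x.1.cur) s) x.2) ≤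
      ∫ _, F₁ x s ∂(resample Q Tmix (x.1.obs (μ x.2 x.1.cur) s) x.2) :=
    integral_mono_ae (hi s) (integrable_const _) ((hres s).mono fun y hy => h₁ x hx s y hy.1 hy.2)
  simpa using this

lemma integral_obsLaw_zero (θ : Params S) {F : World S N × Params S → ℝ} (hF : Measurable F) :
    ∫ y, F y ∂(obsLaw Q μ Tmix ξ₁ θ 0) = ∫ ϑ, F (⟨ξ₁.last, [], ξ₁, 1, 0⟩, ϑ) ∂Q :=
  integral_map measurable_prodMk_left.aemeasurable hF.aestronglyMeasurable

lemma measurable_obsLaw [IsProbabilityMeasure Q]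
    (hμ : ∀ (ξ : Meta S) (A : Action K N), MeasurableSet {θ | μ θ ξ = A}) (t : ℕ) :
    Measurable fun θ : Params S => obsLaw Q μ Tmix ξ₁ θ t := by
  induction t with
  | zero => exact measurable_const
  | succ t ih =>
    refine Measure.measurable_of_measurable_coe _ fun B hB => ?_
    let κ : ProbabilityTheory.Kernel (Params S) (World S N × Params S) := ⟨_, ih⟩
    have : ProbabilityTheory.IsMarkovKernel κ := ⟨fun θ => isProbabilityMeasure_obsLaw hμ θ t⟩
    have h1 : Measurable fun p : Params S × (World S N × Params S) => obsStep Q μ Tmix p.1 p.2 B :=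
      (Measure.measurable_coe hB).comp (measurable_obsStep_prod hμ)
    have h2 := h1.lintegral_kernel_prod_right' (κ := κ)
    have h3 : ∀ θ, obsLaw Q μ Tmix ξ₁ θ (t + 1) B =
        ∫⁻ x, obsStep Q μ Tmix θ x B ∂(obsLaw Q μ Tmix ξ₁ θ t) := fun θ =>
      Measure.bind_apply hB (measurable_obsStep hμ θ).aemeasurable
    simp_rw [h3]
    exact h2

/-- The kernel `θ ↦ obsLaw θ t`. -/
def obsKernel [IsProbabilityMeasure Q] (ξ₁ : Meta S) (Tmix : ℝ)
    (hμ : ∀ (ξ : Meta S) (A : Action K N), MeasurableSet {θ | μ θ ξ = A}) (t : ℕ) :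
    ProbabilityTheory.Kernel (Params S) (World S N × Params S) :=
  ⟨fun θ => obsLaw Q μ Tmix ξ₁ θ t, measurable_obsLaw hμ t⟩

instance [IsProbabilityMeasure Q]
    (hμ : ∀ (ξ : Meta S) (A : Action K N), MeasurableSet {θ | μ θ ξ = A}) (t : ℕ) :
    ProbabilityTheory.IsMarkovKernel (obsKernel (Q := Q) ξ₁ Tmix hμ t) :=
  ⟨fun θ => isProbabilityMeasure_obsLaw hμ θ t⟩

lemma measurable_integral_obsLaw [IsProbabilityMeasure Q]
    (hμ : ∀ (ξ : Meta S) (A : Action K N), MeasurableSet {θ | μ θ ξ = A}) (t : ℕ)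
    {F : Params S × (World S N × Params S) → ℝ} (hF : Measurable F) :
    Measurable fun θ => ∫ x, F (θ, x) ∂(obsLaw Q μ Tmix ξ₁ θ t) :=
  (hF.stronglyMeasurable.integral_kernel_prod_right' (κ := obsKernel (Q := Q) ξ₁ Tmix hμ t)).measurable

end Chain

/-! ### Posterior sampling -/

section Bayes

variable {K N : ℕ} {S : Fin K → Type*} [∀ k, Fintype (S k)] [∀ k, DecidableEq (S k)]
variable {Q : Measure (Params S)} {μ : Params S → Policy S N} {Tmix : ℝ} {ξ₁ : Meta S}

lemma measurable_prod_section {α β γ : Type*} [MeasurableSpace α] [MeasurableSpace β]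
    [MeasurableSpace γ] {f : α × β → γ} (hf : Measurable f) (a : α) :
    Measurable fun b => f (a, b) := hf.comp measurable_prodMk_left

lemma measurable_lintegral_resample {f : World S N × Params S → ENNReal} (hf : Measurable f)
    (hμ : ∀ (ξ : Meta S) (A : Action K N), MeasurableSet {θ | μ θ ξ = A}) (s : ∀ k, S k) :
    Measurable fun x : World S N × Params S =>
      ∫⁻ y, f y ∂(resample Q Tmix (x.1.obs (μ x.2 x.1.cur) s) x.2) := by
  have h : Measurable fun x : World S N × Params S => (x.1.obs (μ x.2 x.1.cur) s, x.2) :=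
    measurable_from_prod_countable_right fun w =>
      (measurable_comp_policy hμ w.cur fun A => w.obs A s).prodMk measurable_id
  have h1 := (Measure.measurable_lintegral hf).comp
    ((measurable_resample (Q := Q) (Tmix := Tmix)).comp h)
  exact h1

lemma hist_of_isSucc {w : World S N} {ϑ : Params S} {y : World S N × Params S}
    (hy : IsSucc Tmix w ϑ y) : y.1.hist = w.hist := by
  rcases hy with ⟨-, h⟩ | ⟨-, rfl⟩
  · rw [h]; rfl
  · rfl

lemma lintegral_resample_hist_mul {f : World S N × Params S → ENNReal} (hf : Measurable f)
    (g : List (Round S N) → ENNReal) (w : World S N) (ϑ : Params S) :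
    ∫⁻ y, f y * g y.1.hist ∂(resample Q Tmix w ϑ) =
      (∫⁻ y, f y ∂(resample Q Tmix w ϑ)) * g w.hist := by
  classical
  have hg : Measurable fun x : World S N × Params S => g x.1.hist :=
    (Measurable.of_discrete (f := fun w : World S N => g w.hist)).comp measurable_fst
  have hfg : Measurable fun x : World S N × Params S => f x * g x.1.hist := hf.mul hg
  rw [lintegral_resample hf, lintegral_resample hfg]
  split_ifs
  · rw [← lintegral_mul_const _ (measurable_prod_section hf _)]; rfl
  · rfl

lemma likelihood_append (hist : List (Round S N)) (z : Round S N) (θ : Params S) :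
    likelihood (hist ++ [z]) θ = likelihood hist θ *
      ∏ k ∈ z.act.1, stateProb θ k (z.pre.last k) (z.pre.age k) (z.post.last k) := by
  simp [likelihood]

/-- The likelihood of the observations of one round. -/
def obsLikelihood (θ : Params S) (ξ : Meta S) (A : Action K N) (s : ∀ k, S k) : ℝ :=
  ∏ k ∈ A.1, stateProb θ k (ξ.last k) (ξ.age k) (s k)

lemma likelihood_obs (w : World S N) (A : Action K N) (s : ∀ k, S k) (θ : Params S) :
    likelihood (w.obs A s).hist θ = likelihood w.hist θ * obsLikelihood θ w.cur A s := by
  have h : (w.obs A s).hist = w.hist ++ [⟨w.cur, A, w.cur.next A s⟩] := rfl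
  rw [h, likelihood_append]
  congr 1
  refine Finset.prod_congr rfl fun k hk => ?_
  simp [Meta.next, hk]

lemma obs_congr (w : World S N) (A : Action K N) {s s' : ∀ k, S k} (h : ∀ k ∈ A.1, s k = s' k) :
    w.obs A s = w.obs A s' := by
  have hn : w.cur.next A s = w.cur.next A s' := by
    simp only [Meta.next, Meta.mk.injEq, and_true]
    funext k
    split_ifs with hk
    · exact h k hk
    · rfl
  simp only [World.obs, World.advance, World.withArms, hn]

lemma sum_armsProb_mul_obsLikelihood (θ θ' : Params S) (ξ : Meta S) (A : Action K N)
    (F : (∀ k, S k) → ENNReal) (hF : ∀ s s' : ∀ k, S k, (∀ k ∈ A.1, s k = s' k) → F s = F s') :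
    ∑ s, ENNReal.ofReal (armsProb θ ξ s) * ENNReal.ofReal (obsLikelihood θ' ξ A s) * F s =
      ∑ s, ENNReal.ofReal (armsProb θ' ξ s) * ENNReal.ofReal (obsLikelihood θ ξ A s) * F s := by
  have key := sum_prod_mul_congr (R := ENNReal) A.1
    (fun k x => ENNReal.ofReal (stateProb θ k (ξ.last k) (ξ.age k) x) *
      (if k ∈ A.1 then ENNReal.ofReal (stateProb θ' k (ξ.last k) (ξ.age k) x) else 1))
    (fun k x => ENNReal.ofReal (stateProb θ' k (ξ.last k) (ξ.age k) x) *
      (if k ∈ A.1 then ENNReal.ofReal (stateProb θ k (ξ.last k) (ξ.age k) x) else 1))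
    (fun k hk => by funext x; simp only [hk, if_true, mul_comm])
    (fun k hk => by
      simp only [hk, if_false, mul_one]
      rw [← ENNReal.ofReal_sum_of_nonneg fun _ _ => stateProb_nonneg ..,
        ← ENNReal.ofReal_sum_of_nonneg fun _ _ => stateProb_nonneg .., sum_stateProb,
        sum_stateProb]) F hF
  simp only [Finset.prod_mul_distrib, Finset.prod_ite_mem, Finset.univ_inter] at key
  convert key using 2 with s _ s _
  · rw [ofReal_armsProb, obsLikelihood,
      ENNReal.ofReal_prod_of_nonneg fun _ _ => stateProb_nonneg ..]
  · rw [ofReal_armsProb, obsLikelihood,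
      ENNReal.ofReal_prod_of_nonneg fun _ _ => stateProb_nonneg ..]

/-- Change of measure: the laws of the observations in two systems have densities proportional to
the likelihoods, because the decisions of the learner do not depend on the system. -/
lemma lintegral_obsLaw_mul_likelihood [IsProbabilityMeasure Q]
    (hμ : ∀ (ξ : Meta S) (A : Action K N), MeasurableSet {θ | μ θ ξ = A}) (θ θ' : Params S) (t : ℕ)
    {f : World S N × Params S → ENNReal} (hf : Measurable f) :
    ∫⁻ x, f x * ENNReal.ofReal (likelihood x.1.hist θ') ∂(obsLaw Q μ Tmix ξ₁ θ t) =
      ∫⁻ x, f x * ENNReal.ofReal (likelihood x.1.hist θ) ∂(obsLaw Q μ Tmix ξ₁ θ' t) := by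
  have hl : ∀ (θ : Params S) {f : World S N × Params S → ENNReal}, Measurable f →
      Measurable fun x : World S N × Params S =>
        f x * ENNReal.ofReal (likelihood x.1.hist θ) := fun θ f hf =>
    hf.mul ((Measurable.of_discrete (f := fun w : World S N =>
      ENNReal.ofReal (likelihood w.hist θ))).comp measurable_fst)
  induction t generalizing f with
  | zero =>
    rw [lintegral_obsLaw_zero _ (hl θ' hf), lintegral_obsLaw_zero _ (hl θ hf)]
    simp [likelihood]
  | succ t ih =>
    rw [lintegral_obsLaw_succ hμ _ _ (hl θ' hf), lintegral_obsLaw_succ hμ _ _ (hl θ hf)]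
    simp only [lintegral_obsStep]
    let R : World S N × Params S → (∀ k, S k) → ENNReal := fun x s =>
      ∫⁻ y, f y ∂(resample Q Tmix (x.1.obs (μ x.2 x.1.cur) s) x.2)
    have hR : ∀ s, Measurable fun x => R x s := measurable_lintegral_resample hf hμ
    have e : ∀ (θ θ' : Params S) (x : World S N × Params S),
        ∑ s, ENNReal.ofReal (armsProb θ x.1.cur s) *
          ∫⁻ y, f y * ENNReal.ofReal (likelihood y.1.hist θ')
            ∂(resample Q Tmix (x.1.obs (μ x.2 x.1.cur) s) x.2) =
        (∑ s, ENNReal.ofReal (armsProb θ x.1.cur s) *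
          ENNReal.ofReal (obsLikelihood θ' x.1.cur (μ x.2 x.1.cur) s) * R x s) *
            ENNReal.ofReal (likelihood x.1.hist θ') := by
      intro θ θ' x
      rw [Finset.sum_mul]
      refine Finset.sum_congr rfl fun s _ => ?_
      rw [lintegral_resample_hist_mul hf fun l => ENNReal.ofReal (likelihood l θ'), likelihood_obs,
        ENNReal.ofReal_mul (likelihood_nonneg ..)]
      change _ * (R x s * _) = _
      ring
    simp_rw [e]
    have hm : Measurable fun x : World S N × Params S =>
        ∑ s, ENNReal.ofReal (armsProb θ x.1.cur s) *
          ENNReal.ofReal (obsLikelihood θ' x.1.cur (μ x.2 x.1.cur) s) * R x s := by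
      refine Finset.measurable_fun_sum _ fun s _ => Measurable.mul ?_ (hR s)
      exact measurable_from_prod_countable_right fun w => measurable_comp_policy hμ w.cur
        fun A => ENNReal.ofReal (armsProb θ w.cur s) * ENNReal.ofReal (obsLikelihood θ' w.cur A s)
    rw [ih hm]
    refine lintegral_congr fun x => ?_
    rw [sum_armsProb_mul_obsLikelihood θ θ' x.1.cur (μ x.2 x.1.cur) (R x) fun s s' h => by
      simp only [R, obs_congr x.1 _ h]]

/-- The system in which all transitions are uniformly distributed. -/
def uniformParams (S : Fin K → Type*) [∀ k, Fintype (S k)] [∀ k, DecidableEq (S k)] : Params S :=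
  have h : ∀ k, Matrix.of (fun _ _ : S k => ((Fintype.card (S k) : ℝ))⁻¹) ∈
      Matrix.rowStochastic ℝ (S k) := fun k => by
    rw [Matrix.mem_rowStochastic_iff_sum]
    refine ⟨fun i j => by simp, fun i => ?_⟩
    have : Nonempty (S k) := ⟨i⟩
    simp
  (fun k => ⟨_, h k⟩, fun k => ⟨_, h k⟩)

lemma stateProb_uniformParams_pos (k : Fin K) (s : S k) (n : ℕ+) (s' : S k) :
    0 < stateProb (uniformParams S) k s n s' := by
  have hc : (0 : ℝ) < (Fintype.card (S k) : ℝ)⁻¹ := by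
    have : Nonempty (S k) := ⟨s⟩
    exact inv_pos.2 (by exact_mod_cast Fintype.card_pos)
  have key : ∀ (m : ℕ) (j : S k), 0 < (Params.active (uniformParams S) k *
      Params.passive (uniformParams S) k ^ m) s j := by
    intro m
    induction m with
    | zero => intro j; rw [pow_zero, mul_one]; exact hc
    | succ m ih =>
      intro j
      rw [pow_succ, ← mul_assoc, Matrix.mul_apply]
      exact Finset.sum_pos (fun x _ => mul_pos (ih x) hc) ⟨s, Finset.mem_univ s⟩
  exact key _ _

lemma likelihood_uniformParams_pos (hist : List (Round S N)) :
    0 < likelihood hist (uniformParams S) := by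
  refine List.prod_pos fun x hx => ?_
  obtain ⟨z, -, rfl⟩ := List.mem_map.1 hx
  exact Finset.prod_pos fun k _ => stateProb_uniformParams_pos ..

/-- Bayes' rule. -/
lemma lintegral_mul_likelihood [IsProbabilityMeasure Q] (hist : List (Round S N))
    {g : Params S → ENNReal}
    (hg : Measurable g) :
    ∫⁻ θ, g θ * ENNReal.ofReal (likelihood hist θ) ∂Q =
      (∫⁻ θ, g θ ∂(posterior Q hist)) * ∫⁻ θ, ENNReal.ofReal (likelihood hist θ) ∂Q := by
  have hl : Measurable fun θ => ENNReal.ofReal (likelihood hist θ) :=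
    (measurable_likelihood hist).ennreal_ofReal
  set W := Q.withDensity fun θ => ENNReal.ofReal (likelihood hist θ) with hW
  have h1 : ∫⁻ θ, g θ * ENNReal.ofReal (likelihood hist θ) ∂Q = ∫⁻ θ, g θ ∂W := by
    rw [hW, lintegral_withDensity_eq_lintegral_mul _ hl hg]
    exact lintegral_congr fun θ => mul_comm _ _
  have h2 : ∫⁻ θ, ENNReal.ofReal (likelihood hist θ) ∂Q = W Set.univ := by
    rw [hW, withDensity_apply _ MeasurableSet.univ, Measure.restrict_univ]
  rw [h1, h2, posterior]
  change _ = (∫⁻ θ, g θ ∂(if W Set.univ = 0 then Q else (W Set.univ)⁻¹ • W)) * _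
  split_ifs with h
  · rw [h, mul_zero, Measure.measure_univ_eq_zero.1 h, lintegral_zero_measure]
  · have ht : W Set.univ ≠ ⊤ := by
      rw [← h2]
      refine ((lintegral_mono fun θ => ENNReal.ofReal_le_one.2 (likelihood_le_one hist θ)).trans_lt
        ?_).ne
      simp
    rw [lintegral_smul_measure, smul_eq_mul, mul_comm, ← mul_assoc, ENNReal.mul_inv_cancel h ht,
      one_mul]

/-- Given the observations, the posterior is the conditional law of the parameter: the true
parameter may be replaced by a draw from the posterior. -/
lemma lintegral_posterior [IsProbabilityMeasure Q]
    (hμ : ∀ (ξ : Meta S) (A : Action K N), MeasurableSet {θ | μ θ ξ = A}) (t : ℕ)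
    {g : World S N × Params S → ENNReal} (hg : Measurable g) :
    ∫⁻ θ, ∫⁻ x, g (x.1, θ) ∂(obsLaw Q μ Tmix ξ₁ θ t) ∂Q =
      ∫⁻ θ, ∫⁻ x, ∫⁻ ϑ, g (x.1, ϑ) ∂(posterior Q x.1.hist) ∂(obsLaw Q μ Tmix ξ₁ θ t) ∂Q := by
  set u := uniformParams S
  have hu := isProbabilityMeasure_obsLaw (Q := Q) (Tmix := Tmix) (ξ₁ := ξ₁) hμ u t
  have hlik : Measurable fun p : World S N × Params S => ENNReal.ofReal (likelihood p.1.hist p.2) :=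
    measurable_from_prod_countable_right fun w => (measurable_likelihood w.hist).ennreal_ofReal
  have key : ∀ {g : World S N × Params S → ENNReal}, Measurable g →
      ∫⁻ θ, ∫⁻ x, g (x.1, θ) ∂(obsLaw Q μ Tmix ξ₁ θ t) ∂Q =
      ∫⁻ x, (∫⁻ θ, g (x.1, θ) * ENNReal.ofReal (likelihood x.1.hist θ) ∂Q) *
        (ENNReal.ofReal (likelihood x.1.hist u))⁻¹ ∂(obsLaw Q μ Tmix ξ₁ u t) := by
    intro g hg
    have hc : Measurable fun x : World S N × Params S =>
        (ENNReal.ofReal (likelihood x.1.hist u))⁻¹ :=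
      (Measurable.of_discrete (f := fun w : World S N =>
        (ENNReal.ofReal (likelihood w.hist u))⁻¹)).comp measurable_fst
    have h1 : ∀ θ, ∫⁻ x, g (x.1, θ) ∂(obsLaw Q μ Tmix ξ₁ θ t) =
        ∫⁻ x, g (x.1, θ) * (ENNReal.ofReal (likelihood x.1.hist u))⁻¹ *
          ENNReal.ofReal (likelihood x.1.hist θ) ∂(obsLaw Q μ Tmix ξ₁ u t) := by
      intro θ
      have hgθ : Measurable fun x : World S N × Params S => g (x.1, θ) :=
        hg.comp (measurable_fst.prodMk measurable_const)
      have hgc : Measurable fun x : World S N × Params S =>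
        g (x.1, θ) * (ENNReal.ofReal (likelihood x.1.hist u))⁻¹ := hgθ.mul hc
      rw [← lintegral_obsLaw_mul_likelihood hμ θ u t hgc]
      refine lintegral_congr fun x => ?_
      rw [mul_assoc, ENNReal.inv_mul_cancel, mul_one]
      · exact (ENNReal.ofReal_pos.2 (likelihood_uniformParams_pos _)).ne'
      · exact ENNReal.ofReal_ne_top
    simp_rw [h1]
    rw [lintegral_lintegral_swap]
    · refine lintegral_congr fun x => ?_
      rw [← lintegral_mul_const]
      · exact lintegral_congr fun θ => by ring
      · have e1 : Measurable fun θ => g (x.1, θ) := hg.comp measurable_prodMk_left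
        exact e1.mul (measurable_likelihood x.1.hist).ennreal_ofReal
    · refine Measurable.aemeasurable ?_
      have hs : Measurable fun p : Params S × (World S N × Params S) => (p.2.1, p.1) :=
        (measurable_fst.comp measurable_snd).prodMk measurable_fst
      have e1 := hg.comp hs
      have e2 := hlik.comp hs
      have e3 : Measurable fun p : Params S × (World S N × Params S) =>
          (ENNReal.ofReal (likelihood p.2.1.hist u))⁻¹ := hc.comp measurable_snd
      exact (e1.mul e3).mul e2
  have hg' : Measurable fun x : World S N × Params S =>
      ∫⁻ ϑ, g (x.1, ϑ) ∂(posterior Q x.1.hist) :=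
    (Measurable.of_discrete (f := fun w : World S N =>
      ∫⁻ ϑ, g (w, ϑ) ∂(posterior Q w.hist))).comp measurable_fst
  rw [key hg, key (g := fun x => ∫⁻ ϑ, g (x.1, ϑ) ∂(posterior Q x.1.hist)) hg']
  refine lintegral_congr fun x => ?_
  dsimp only
  rw [lintegral_mul_likelihood x.1.hist (measurable_prod_section hg _),
    lintegral_const_mul _ (measurable_likelihood _).ennreal_ofReal]

lemma posterior_nil [IsProbabilityMeasure Q] : posterior Q ([] : List (Round S N)) = Q := by
  simp [posterior, likelihood]

open Classical in
/-- The parameter of a new episode is distributed according to the posterior. -/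
lemma lintegral_isNew [IsProbabilityMeasure Q]
    (hμ : ∀ (ξ : Meta S) (A : Action K N), MeasurableSet {θ | μ θ ξ = A}) (θ : Params S) (t : ℕ)
    {g : World S N × Params S → ENNReal} (hg : Measurable g) :
    ∫⁻ x, (if x.1.IsNew then g x else 0) ∂(obsLaw Q μ Tmix ξ₁ θ t) =
      ∫⁻ x, (if x.1.IsNew then ∫⁻ ϑ, g (x.1, ϑ) ∂(posterior Q x.1.hist) else 0)
        ∂(obsLaw Q μ Tmix ξ₁ θ t) := by
  have hn : MeasurableSet {x : World S N × Params S | x.1.IsNew} :=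
    (MeasurableSet.of_discrete (s := {w : World S N | w.IsNew})).preimage measurable_fst
  have h1 : Measurable fun x : World S N × Params S => if x.1.IsNew then g x else 0 :=
    Measurable.ite hn hg measurable_const
  have hg' : Measurable fun x : World S N × Params S =>
      ∫⁻ ϑ, g (x.1, ϑ) ∂(posterior Q x.1.hist) :=
    (Measurable.of_discrete (f := fun w : World S N =>
      ∫⁻ ϑ, g (w, ϑ) ∂(posterior Q w.hist))).comp measurable_fst
  have h2 : Measurable fun x : World S N × Params S =>
      if x.1.IsNew then ∫⁻ ϑ, g (x.1, ϑ) ∂(posterior Q x.1.hist) else 0 :=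
    Measurable.ite hn hg' measurable_const
  cases t with
  | zero =>
    rw [lintegral_obsLaw_zero _ h1, lintegral_obsLaw_zero _ h2]
    have h3 : World.IsNew (⟨ξ₁.last, [], ξ₁, 1, 0⟩ : World S N) := rfl
    simp only [h3, if_true, posterior_nil]
    simp
  | succ t =>
    rw [lintegral_obsLaw_succ hμ _ _ h1, lintegral_obsLaw_succ hμ _ _ h2]
    refine lintegral_congr_ae ?_
    filter_upwards [ae_obsLaw hμ MeasurableSet.univ (by simp) θ t] with x hx
    simp only [lintegral_obsStep]
    refine Finset.sum_congr rfl fun s _ => ?_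
    congr 1
    rw [lintegral_resample h1, lintegral_resample h2]
    have h4 : ∀ w : World S N, w.newEpisode.IsNew := fun w => rfl
    have h5 : ¬ (x.1.obs (μ x.2 x.1.cur) s).IsNew :=
      (hx.1.start_le_of_obs (μ x.2 x.1.cur) s).ne
    have h6 : ∀ w : World S N, w.newEpisode.hist = w.hist := fun w => rfl
    simp only [h4, h5, h6, if_true, if_false]
    simp

open Classical in
/-- Posterior sampling: at the start of an episode, the true parameter and the parameter of the
episode have the same joint law with the observations. -/
lemma lintegral_isNew_posterior [IsProbabilityMeasure Q]
    (hμ : ∀ (ξ : Meta S) (A : Action K N), MeasurableSet {θ | μ θ ξ = A}) (t : ℕ)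
    {g : World S N × Params S → ENNReal} (hg : Measurable g) :
    ∫⁻ θ, ∫⁻ x, (if x.1.IsNew then g x else 0) ∂(obsLaw Q μ Tmix ξ₁ θ t) ∂Q =
      ∫⁻ θ, ∫⁻ x, (if x.1.IsNew then g (x.1, θ) else 0) ∂(obsLaw Q μ Tmix ξ₁ θ t) ∂Q := by
  have hn : MeasurableSet {x : World S N × Params S | x.1.IsNew} :=
    (MeasurableSet.of_discrete (s := {w : World S N | w.IsNew})).preimage measurable_fst
  have h1 : Measurable fun x : World S N × Params S => if x.1.IsNew then g x else 0 :=
    Measurable.ite hn hg measurable_const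
  simp_rw [lintegral_isNew hμ _ t hg]
  rw [lintegral_posterior (Tmix := Tmix) (ξ₁ := ξ₁) hμ t h1]
  refine lintegral_congr fun θ => lintegral_congr fun x => ?_
  dsimp only
  split_ifs <;> simp

open Classical in
lemma integral_isNew_posterior [IsProbabilityMeasure Q]
    (hμ : ∀ (ξ : Meta S) (A : Action K N), MeasurableSet {θ | μ θ ξ = A})
    {G : Set (Params S)} (hG : MeasurableSet G) (hQ : ∀ᵐ ϑ ∂Q, ϑ ∈ G) (t : ℕ)
    {g : World S N × Params S → ℝ} (hg : Measurable g) (h0 : ∀ x, 0 ≤ g x) {C : ℝ}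
    (hC : ∀ x, ValidIn Tmix G t x → g x ≤ C) :
    ∫ θ, ∫ x, (if x.1.IsNew then g x else 0) ∂(obsLaw Q μ Tmix ξ₁ θ t) ∂Q =
      ∫ θ, ∫ x, (if x.1.IsNew then g (x.1, θ) else 0) ∂(obsLaw Q μ Tmix ξ₁ θ t) ∂Q := by
  have hn : MeasurableSet {p : Params S × (World S N × Params S) | p.2.1.IsNew} :=
    (MeasurableSet.of_discrete (s := {w : World S N | w.IsNew})).preimage
      (measurable_fst.comp measurable_snd)
  have key : ∀ {f : Params S × (World S N × Params S) → ℝ}, Measurable f → (∀ p, 0 ≤ f p) →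
      (∀ θ ∈ G, ∀ x, ValidIn Tmix G t x → f (θ, x) ≤ C) →
      ∫ θ, ∫ x, f (θ, x) ∂(obsLaw Q μ Tmix ξ₁ θ t) ∂Q =
        (∫⁻ θ, ∫⁻ x, ENNReal.ofReal (f (θ, x)) ∂(obsLaw Q μ Tmix ξ₁ θ t) ∂Q).toReal := by
    intro f hf hf0 hfC
    rw [integral_eq_lintegral_of_nonneg_ae
      (Eventually.of_forall fun θ => integral_nonneg fun x => hf0 _)
      (measurable_integral_obsLaw (Q := Q) (Tmix := Tmix) (ξ₁ := ξ₁) hμ t hf).aestronglyMeasurable]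
    congr 1
    refine lintegral_congr_ae ?_
    filter_upwards [hQ] with θ hθ
    refine ofReal_integral_eq_lintegral_ofReal ?_ (Eventually.of_forall fun x => hf0 _)
    refine integrable_obsLaw hμ hG hQ θ t (hf.comp measurable_prodMk_left) (C := C) fun x hx => ?_
    rw [abs_of_nonneg (hf0 _)]
    exact hfC θ hθ x hx
  have hC0 : ∀ x, ValidIn Tmix G t x → 0 ≤ C := fun x hx => (h0 x).trans (hC x hx)
  have h1 : Measurable fun p : Params S × (World S N × Params S) =>
      if p.2.1.IsNew then g p.2 else 0 := Measurable.ite hn (hg.comp measurable_snd) measurable_const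
  have h2 : Measurable fun p : Params S × (World S N × Params S) =>
      if p.2.1.IsNew then g (p.2.1, p.1) else 0 := by
    have hs : Measurable fun p : Params S × (World S N × Params S) => (p.2.1, p.1) :=
      (measurable_fst.comp measurable_snd).prodMk measurable_fst
    exact Measurable.ite hn (hg.comp hs) measurable_const
  rw [key h1, key h2]
  · have e := lintegral_isNew_posterior (Q := Q) (Tmix := Tmix) (ξ₁ := ξ₁) hμ t hg.ennreal_ofReal
    congr 1
    convert e using 5 with θ x
    · split_ifs <;> simp
    · rename_i x
      split_ifs <;> simp
  · intro p; split_ifs <;> simp [h0]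
  · intro θ hθ x hx
    split_ifs
    · exact hC (x.1, θ) ⟨hx.1, hθ⟩
    · exact hC0 x hx
  · intro p; split_ifs <;> simp [h0]
  · intro θ hθ x hx
    split_ifs
    · exact hC x hx
    · exact hC0 x hx

end Bayes

/-! ### Telescoping over the episodes -/

section Telescoping

variable {K N : ℕ} {S : Fin K → Type*} [∀ k, Fintype (S k)] [∀ k, DecidableEq (S k)]
variable {Q : Measure (Params S)} {μ : Params S → Policy S N} {Tmix : ℝ} {ξ₁ : Meta S}

/-- Measurability in the parameter survives the insertion of the action `μ ϑ ξ`, since there are only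
finitely many actions and each is chosen on a measurable set. -/
lemma measurable_policy_apply
    (hμ : ∀ (ξ : Meta S) (A : Action K N), MeasurableSet {θ | μ θ ξ = A}) {β : Type*}
    [MeasurableSpace β] (ξ : Meta S) {F : Action K N → Params S → β}
    (hF : ∀ A, Measurable (F A)) : Measurable fun ϑ : Params S => F (μ ϑ ξ) ϑ := by
  intro B hB
  have : (fun ϑ : Params S => F (μ ϑ ξ) ϑ) ⁻¹' B = ⋃ A, {ϑ | μ ϑ ξ = A} ∩ F A ⁻¹' B := by
    ext ϑ; simp
  rw [this]
  exact MeasurableSet.iUnion fun A => (hμ ξ A).inter (hF A hB)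

open Classical in
/-- The indicator of the start of an episode in the current round. -/
def World.newInd (w : World S N) : ℝ := if w.IsNew then 1 else 0

lemma World.newInd_nonneg (w : World S N) : 0 ≤ w.newInd := by
  rw [World.newInd]; split_ifs <;> simp

lemma World.newInd_le_one (w : World S N) : w.newInd ≤ 1 := by
  rw [World.newInd]; split_ifs <;> simp

lemma World.newInd_newEpisode (w : World S N) : w.newEpisode.newInd = 1 := if_pos rfl

lemma World.Valid.newInd_obs {t : ℕ} {w : World S N} (h : w.Valid Tmix t) (A : Action K N)
    (s : ∀ k, S k) : (w.obs A s).newInd = 0 := if_neg (h.start_le_of_obs A s).ne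

/-- The number of rounds, including the current one, until the planned end of the episode. -/
def World.remaining (w : World S N) : ℝ := w.prevLen + 1 - ((w.time : ℝ) - w.start)

lemma measurable_world {f : World S N → ℝ} :
    Measurable fun x : World S N × Params S => f x.1 :=
  (Measurable.of_discrete (f := f)).comp measurable_fst

lemma World.Valid.time_eq {t : ℕ} {w : World S N} (h : w.Valid Tmix t) : w.time = t + 1 := by
  rw [World.time, h.length_hist]

lemma World.Valid.time_le {t : ℕ} {w : World S N} (h : w.Valid Tmix t) :
    w.time ≤ w.start + w.prevLen := by
  by_contra hc
  exact h.not_terminates (Or.inl (not_le.1 hc))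

lemma World.Valid.remaining_mem {t : ℕ} {w : World S N} (h : w.Valid Tmix t) :
    w.remaining ∈ Set.Icc (1 : ℝ) (t + 1) := by
  have h1 : (w.time : ℝ) ≤ w.start + w.prevLen := by exact_mod_cast h.time_le
  have h2 : (w.prevLen : ℝ) ≤ t := by exact_mod_cast h.prevLen_le
  have h3 : (w.start : ℝ) ≤ w.time := by
    have := h.start_le
    rw [← h.time_eq] at this
    exact_mod_cast this
  rw [World.remaining]
  constructor <;> linarith

lemma World.remaining_obs (w : World S N) (A : Action K N) (s : ∀ k, S k) :
    (w.obs A s).remaining = w.remaining - 1 := by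
  have : ((w.obs A s).time : ℝ) = w.time + 1 := by
    simp [World.time, World.obs, World.withArms, World.advance]
  rw [World.remaining, this, World.remaining]
  change (w.prevLen : ℝ) + 1 - (w.time + 1 - w.start) = _
  ring

/-- The gain of the true average reward over those of the episode parameters is carried by the
starts of the episodes, weighted by the planned lengths, up to the numbers of missing rounds. -/
lemma sum_integral_gain_le [IsProbabilityMeasure Q]
    (hμ : ∀ (ξ : Meta S) (A : Action K N), MeasurableSet {θ | μ θ ξ = A})
    {J : Params S → ℝ} (hJ : Measurable J) {B : ℝ} (hJB : ∀ θ, J θ ∈ Set.Icc 0 B) (θ : Params S)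
    (n : ℕ) :
    ∑ t ∈ Finset.range (n + 1), ∫ x, (J θ - J x.2) ∂(obsLaw Q μ Tmix ξ₁ θ t) ≤
      ∑ t ∈ Finset.range (n + 1), ∫ x, x.1.newInd * (x.1.remaining * (J θ - J x.2))
        ∂(obsLaw Q μ Tmix ξ₁ θ t) +
      B * ∑ t ∈ Finset.range n, ∫ x, x.1.newInd ∂(obsLaw Q μ Tmix ξ₁ θ (t + 1)) := by
  have hJ2 : Measurable fun x : World S N × Params S => J θ - J x.2 :=
    measurable_const.sub (hJ.comp measurable_snd)
  have hd : ∀ ϑ, |J θ - J ϑ| ≤ B := fun ϑ => abs_le.2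
    ⟨by linarith [(hJB θ).1, (hJB ϑ).2], by linarith [(hJB θ).2, (hJB ϑ).1]⟩
  have hB : 0 ≤ B := (hJB θ).1.trans (hJB θ).2
  have hG : MeasurableSet (Set.univ : Set (Params S)) := MeasurableSet.univ
  have hQ : ∀ᵐ ϑ ∂Q, ϑ ∈ (Set.univ : Set (Params S)) := by simp
  have hrem : ∀ (t : ℕ) (x : World S N × Params S), ValidIn Tmix Set.univ t x →
      |x.1.remaining * (J θ - J x.2)| ≤ (t + 1) * B := by
    intro t x hx
    have h1 := hx.1.remaining_mem
    rw [abs_mul, abs_of_nonneg (by linarith [h1.1])]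
    exact mul_le_mul h1.2 (hd _) (abs_nonneg _) (by positivity)
  have hprev : ∀ (t : ℕ) (x : World S N × Params S), ValidIn Tmix Set.univ t x →
      |B * (x.1.prevLen : ℝ)| ≤ B * t := by
    intro t x hx
    rw [abs_of_nonneg (by positivity)]
    have : (x.1.prevLen : ℝ) ≤ t := by exact_mod_cast hx.1.prevLen_le
    gcongr
  have hi_j : ∀ t, Integrable (fun x => J θ - J x.2) (obsLaw Q μ Tmix ξ₁ θ t) := fun t =>
    integrable_obsLaw hμ hG hQ θ t hJ2 fun x _ => hd x.2
  have hmr : Measurable fun x : World S N × Params S => x.1.remaining * (J θ - J x.2) :=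
    measurable_world.mul hJ2
  have hi_r : ∀ t, Integrable (fun x => x.1.remaining * (J θ - J x.2))
      (obsLaw Q μ Tmix ξ₁ θ t) := fun t => integrable_obsLaw hμ hG hQ θ t hmr (hrem t)
  have hi_p : ∀ t, Integrable (fun x => B * (x.1.prevLen : ℝ)) (obsLaw Q μ Tmix ξ₁ θ t) := fun t =>
    integrable_obsLaw hμ hG hQ θ t (measurable_world (f := fun w => B * (w.prevLen : ℝ)))
      (hprev t)
  have hi_n : ∀ t, Integrable (fun x => x.1.newInd) (obsLaw Q μ Tmix ξ₁ θ t) := fun t =>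
    integrable_obsLaw hμ hG hQ θ t measurable_world (C := 1) fun x _ => by
      rw [abs_of_nonneg x.1.newInd_nonneg]; exact x.1.newInd_le_one
  have hmz : Measurable fun x : World S N × Params S =>
      x.1.newInd * (x.1.remaining * (J θ - J x.2)) := measurable_world.mul hmr
  have hi_z : ∀ t, Integrable (fun x => x.1.newInd * (x.1.remaining * (J θ - J x.2)))
      (obsLaw Q μ Tmix ξ₁ θ t) := fun t => by
    refine integrable_obsLaw hμ hG hQ θ t hmz (C := (t + 1) * B) fun x hx => ?_
    rw [abs_mul, abs_of_nonneg x.1.newInd_nonneg]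
    exact (mul_le_of_le_one_left (abs_nonneg _) x.1.newInd_le_one).trans (hrem t x hx)
  have hi_a : ∀ t, Integrable (fun x => x.1.remaining * (J θ - J x.2) + B * x.1.prevLen)
      (obsLaw Q μ Tmix ξ₁ θ t) := fun t => (hi_r t).add (hi_p t)
  have hi_az : ∀ t, Integrable (fun x => x.1.remaining * (J θ - J x.2) + B * x.1.prevLen -
      x.1.newInd * (x.1.remaining * (J θ - J x.2))) (obsLaw Q μ Tmix ξ₁ θ t) := fun t =>
    (hi_a t).sub (hi_z t)
  -- the potential is the gain planned for the rest of the episode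
  set a : ℕ → ℝ := fun t => ∫ x, (x.1.remaining * (J θ - J x.2) + B * x.1.prevLen)
    ∂(obsLaw Q μ Tmix ξ₁ θ t) with ha
  set z : ℕ → ℝ := fun t => ∫ x, x.1.newInd * (x.1.remaining * (J θ - J x.2))
    ∂(obsLaw Q μ Tmix ξ₁ θ t) with hz
  set c : ℕ → ℝ := fun t => ∫ x, x.1.newInd ∂(obsLaw Q μ Tmix ξ₁ θ t) with hc
  set j : ℕ → ℝ := fun t => ∫ x, (J θ - J x.2) ∂(obsLaw Q μ Tmix ξ₁ θ t) with hj
  have hstep : ∀ t, j t + (a (t + 1) - z (t + 1)) ≤ a t + B * c (t + 1) := by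
    intro t
    have h := integral_obsLaw_succ_le (ξ₁ := ξ₁) hμ hG hQ θ t
      (F := fun x => (x.1.remaining * (J θ - J x.2) + B * x.1.prevLen) -
        x.1.newInd * (x.1.remaining * (J θ - J x.2)) - B * x.1.newInd)
      (F₀ := fun x => (x.1.remaining * (J θ - J x.2) + B * x.1.prevLen) - (J θ - J x.2))
      (C := ((t + 1 : ℕ) + 1) * B + B * (t + 1 : ℕ) + ((t + 1 : ℕ) + 1) * B + B)
      (((hmr.add (measurable_world (f := fun w => B * (w.prevLen : ℝ)))).sub hmz).sub
        (measurable_world (f := fun w => B * w.newInd)))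
      (by
        intro x hx
        have h1 := hrem _ x hx
        have h2 := hprev _ x hx
        have h3 := x.1.newInd_nonneg
        have h4 := x.1.newInd_le_one
        have h5 : |x.1.newInd * (x.1.remaining * (J θ - J x.2))| ≤ ((t + 1 : ℕ) + 1) * B := by
          rw [abs_mul, abs_of_nonneg h3]
          exact (mul_le_of_le_one_left (abs_nonneg _) h4).trans h1
        have h6 : |B * x.1.newInd| ≤ B := by
          rw [abs_of_nonneg (by positivity)]
          exact mul_le_of_le_one_right hB h4
        refine (abs_sub _ _).trans (add_le_add ((abs_sub _ _).trans (add_le_add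
          ((abs_add_le _ _).trans (add_le_add h1 h2)) h5)) h6))
      (((hi_r t).add (hi_p t)).sub (hi_j t))
      (fun x _ => (x.1.remaining * (J θ - J x.2) + B * x.1.prevLen) - (J θ - J x.2))
      (by
        intro x hx s y hy hs
        have hr := hx.1.remaining_mem
        have hd1 := abs_le.1 (hd x.2)
        rcases hs with ⟨-, hs⟩ | ⟨-, rfl⟩
        · rw [hs, World.newInd_newEpisode]
          have hp : ((x.1.obs (μ x.2 x.1.cur) s).newEpisode.prevLen : ℝ) =
              x.1.prevLen + 1 - (x.1.remaining - 1) := by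
            rw [← World.remaining_obs x.1 (μ x.2 x.1.cur) s, World.remaining]
            change (((x.1.obs (μ x.2 x.1.cur) s).time - (x.1.obs (μ x.2 x.1.cur) s).start : ℕ) : ℝ)
              = x.1.prevLen + 1 - (x.1.prevLen + 1 - _)
            rw [Nat.cast_sub (hx.1.start_le_of_obs _ _).le]
            ring
          rw [hp]
          nlinarith [hr.1, hd1.1, mul_le_mul_of_nonneg_left hd1.1 (sub_nonneg.2 hr.1)]
        · rw [hx.1.newInd_obs, World.remaining_obs]
          change (x.1.remaining - 1) * (J θ - J x.2) + B * x.1.prevLen - _ - _ ≤ _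
          linarith)
      (by
        intro x hx
        rw [← Finset.sum_mul, sum_armsProb, one_mul])
    rw [integral_sub (hi_az _) ((hi_n _).const_mul B), integral_sub (hi_a _) (hi_z _),
      integral_const_mul, integral_sub (hi_a _) (hi_j _)] at h
    simp only [ha, hz, hc, hj]
    linarith
  have hzero : a 0 = z 0 := by
    have hm1 : Measurable fun x : World S N × Params S =>
      x.1.remaining * (J θ - J x.2) + B * x.1.prevLen :=
      hmr.add (measurable_world (f := fun w => B * (w.prevLen : ℝ)))
    simp only [ha, hz]
    rw [integral_obsLaw_zero _ hm1, integral_obsLaw_zero _ hmz]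
    have : World.newInd (⟨ξ₁.last, [], ξ₁, 1, 0⟩ : World S N) = 1 := if_pos rfl
    simp [this]
  have hlast : ∀ t, j t ≤ a t := by
    intro t
    refine integral_mono_ae (hi_j t) ((hi_r t).add (hi_p t)) ?_
    filter_upwards [ae_obsLaw hμ hG hQ θ t] with x hx
    have hr := hx.1.remaining_mem
    have hd1 := abs_le.1 (hd x.2)
    have h3 : x.1.remaining - 1 ≤ x.1.prevLen := by
      have h3 : (x.1.start : ℝ) ≤ x.1.time := by
        have := hx.1.start_le
        rw [← hx.1.time_eq] at this
        exact_mod_cast this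
      rw [World.remaining]; linarith
    change J θ - J x.2 ≤ x.1.remaining * (J θ - J x.2) + B * x.1.prevLen
    nlinarith [mul_le_mul_of_nonneg_left hd1.1 (sub_nonneg.2 hr.1),
      mul_le_mul_of_nonneg_left h3 hB]
  have main : ∀ n, ∑ t ∈ Finset.range n, j t + a n ≤
      ∑ t ∈ Finset.range (n + 1), z t + B * ∑ t ∈ Finset.range n, c (t + 1) := by
    intro n
    induction n with
    | zero => simp [hzero]
    | succ n ih =>
      rw [Finset.sum_range_succ, Finset.sum_range_succ _ (n + 1), Finset.sum_range_succ (fun t => c (t + 1))]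
      have := hstep n
      linarith
  rw [Finset.sum_range_succ]
  have h1 := main n
  have h2 := hlast n
  linarith

/-- The telescoping sum of the bias functions costs at most `H` for each episode. -/
lemma sum_integral_bias_le [IsProbabilityMeasure Q]
    (hμ : ∀ (ξ : Meta S) (A : Action K N), MeasurableSet {θ | μ θ ξ = A})
    {g : Params S → Meta S → ℝ} (hg : ∀ ξ, Measurable fun θ => g θ ξ) {H : ℝ}
    (hgH : ∀ θ ξ, g θ ξ ∈ Set.Icc 0 H) (θ : Params S) (n : ℕ) :
    ∑ t ∈ Finset.range (n + 1), ∫ x, (metaExp θ x.1.cur (μ x.2 x.1.cur) (g x.2) - g x.2 x.1.cur)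
        ∂(obsLaw Q μ Tmix ξ₁ θ t) ≤
      H * (1 + ∑ t ∈ Finset.range n, ∫ x, x.1.newInd ∂(obsLaw Q μ Tmix ξ₁ θ (t + 1))) := by
  have hG : MeasurableSet (Set.univ : Set (Params S)) := MeasurableSet.univ
  have hQ : ∀ᵐ ϑ ∂Q, ϑ ∈ (Set.univ : Set (Params S)) := by simp
  have hH : 0 ≤ H := (hgH θ ξ₁).1.trans (hgH θ ξ₁).2
  have hm1 : Measurable fun x : World S N × Params S => g x.2 x.1.cur :=
    measurable_from_prod_countable_right fun w => hg w.cur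
  have hm2 : Measurable fun x : World S N × Params S =>
      metaExp θ x.1.cur (μ x.2 x.1.cur) (g x.2) := by
    refine measurable_from_prod_countable_right fun w => ?_
    exact measurable_policy_apply hμ w.cur (F := fun A ϑ => metaExp θ w.cur A (g ϑ)) fun A =>
      Finset.measurable_fun_sum _ fun s _ => measurable_const.mul (hg _)
  have hi_g : ∀ t, Integrable (fun x => g x.2 x.1.cur) (obsLaw Q μ Tmix ξ₁ θ t) := fun t =>
    integrable_obsLaw hμ hG hQ θ t hm1 (C := H) fun x _ => by
      rw [abs_of_nonneg (hgH _ _).1]; exact (hgH _ _).2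
  have hexp : ∀ x : World S N × Params S, metaExp θ x.1.cur (μ x.2 x.1.cur) (g x.2) ∈
      Set.Icc 0 H := fun x => metaExp_mem_Icc _ _ _ (hgH x.2)
  have hi_e : ∀ t, Integrable (fun x => metaExp θ x.1.cur (μ x.2 x.1.cur) (g x.2))
      (obsLaw Q μ Tmix ξ₁ θ t) := fun t =>
    integrable_obsLaw hμ hG hQ θ t hm2 (C := H) fun x _ => by
      rw [abs_of_nonneg (hexp x).1]; exact (hexp x).2
  have hi_n : ∀ t, Integrable (fun x => x.1.newInd) (obsLaw Q μ Tmix ξ₁ θ t) := fun t =>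
    integrable_obsLaw hμ hG hQ θ t measurable_world (C := 1) fun x _ => by
      rw [abs_of_nonneg x.1.newInd_nonneg]; exact x.1.newInd_le_one
  set a : ℕ → ℝ := fun t => ∫ x, g x.2 x.1.cur ∂(obsLaw Q μ Tmix ξ₁ θ t) with ha
  set b : ℕ → ℝ := fun t => ∫ x, metaExp θ x.1.cur (μ x.2 x.1.cur) (g x.2)
    ∂(obsLaw Q μ Tmix ξ₁ θ t) with hb
  set c : ℕ → ℝ := fun t => ∫ x, x.1.newInd ∂(obsLaw Q μ Tmix ξ₁ θ t) with hc
  have hstep : ∀ t, b t ≤ a (t + 1) + H * c (t + 1) := by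
    intro t
    have h := integral_obsLaw_succ_le (ξ₁ := ξ₁) hμ hG hQ θ t
      (F := fun x => -(g x.2 x.1.cur + H * x.1.newInd))
      (F₀ := fun x => -metaExp θ x.1.cur (μ x.2 x.1.cur) (g x.2))
      (C := H + H)
      (hm1.add (measurable_world (f := fun w => H * w.newInd))).neg
      (by
        intro x _
        rw [abs_neg]
        refine (abs_add_le _ _).trans (add_le_add ?_ ?_)
        · rw [abs_of_nonneg (hgH _ _).1]; exact (hgH _ _).2
        · rw [abs_of_nonneg (mul_nonneg hH x.1.newInd_nonneg)]
          exact mul_le_of_le_one_right hH x.1.newInd_le_one)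
      (hi_e t).neg
      (fun x s => -g x.2 (x.1.cur.next (μ x.2 x.1.cur) s))
      (by
        intro x hx s y hy hs
        rcases hs with ⟨-, hs⟩ | ⟨-, rfl⟩
        · rw [hs, World.newInd_newEpisode]
          have h1 := (hgH y.2 (x.1.obs (μ x.2 x.1.cur) s).newEpisode.cur).1
          have h2 := (hgH x.2 (x.1.cur.next (μ x.2 x.1.cur) s)).2
          linarith
        · rw [hx.1.newInd_obs, mul_zero, add_zero]
          exact le_rfl)
      (by
        intro x hx
        simp only [mul_neg, Finset.sum_neg_distrib]
        exact le_rfl)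
    rw [integral_neg, integral_neg, integral_add (hi_g _) ((hi_n _).const_mul H),
      integral_const_mul] at h
    simp only [ha, hb, hc]
    linarith
  have hsub : ∀ t, ∫ x, (metaExp θ x.1.cur (μ x.2 x.1.cur) (g x.2) - g x.2 x.1.cur)
      ∂(obsLaw Q μ Tmix ξ₁ θ t) = b t - a t := fun t => integral_sub (hi_e t) (hi_g t)
  simp_rw [hsub]
  have hp := fun t => isProbabilityMeasure_obsLaw (Q := Q) (Tmix := Tmix) (ξ₁ := ξ₁) hμ θ t
  have ha0 : ∀ t, 0 ≤ a t := fun t => integral_nonneg fun x => (hgH _ _).1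
  have hbH : ∀ t, b t ≤ H := by
    intro t
    have := integral_mono (hi_e t) (integrable_const H) fun x => (hexp x).2
    simpa using this
  have main : ∀ n, ∑ t ∈ Finset.range n, (b t - a t) ≤
      a n - a 0 + H * ∑ t ∈ Finset.range n, c (t + 1) := by
    intro n
    induction n with
    | zero => simp
    | succ n ih =>
      rw [Finset.sum_range_succ, Finset.sum_range_succ (fun t => c (t + 1))]
      have := hstep n
      linarith
  rw [Finset.sum_range_succ]
  have h1 := main n
  have h2 := hbH n
  have h3 := ha0 0
  linarith

end Telescoping

/-! ### Counters -/

section Cells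

variable {K N : ℕ} {S : Fin K → Type*} [∀ k, Fintype (S k)] [∀ k, DecidableEq (S k)]

/-- The indices of the counters: an arm with a state, and an age, where the ages above `m` are
identified; the age `n` has the index `min (n - 1) m`. -/
abbrev Cell (S : Fin K → Type*) (m : ℕ) : Type _ := (Σ k, S k) × Fin (m + 1)

/-- The index of the counter that is incremented when arm `k` is pulled in the meta-state `ξ`. -/
def cellOf (m : ℕ) (ξ : Meta S) (k : Fin K) : Cell S m :=
  (⟨k, ξ.last k⟩, ⟨min ((ξ.age k : ℕ) - 1) m, by omega⟩)

lemma cellOf_injective (m : ℕ) (ξ : Meta S) : Function.Injective (cellOf m ξ) := by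
  intro k k' h
  exact congrArg (fun ζ : Cell S m => ζ.1.1) h

/-- The counters that are incremented in a round. -/
def Round.cells (m : ℕ) (z : Round S N) : Finset (Cell S m) :=
  z.act.1.map ⟨cellOf m z.pre, cellOf_injective m z.pre⟩

/-- The number of recorded rounds in which the counter `ζ` has been incremented. -/
def visits {m : ℕ} (hist : List (Round S N)) (ζ : Cell S m) : ℕ :=
  hist.countP fun z => ζ ∈ z.cells m

lemma card_cell (m : ℕ) :
    (Fintype.card (Cell S m) : ℝ) = (∑ k, (Fintype.card (S k) : ℝ)) * (m + 1) := by
  simp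

lemma mem_cells {m : ℕ} {z : Round S N} {ζ : Cell S m} :
    ζ ∈ z.cells m ↔ ζ.1.1 ∈ z.act.1 ∧ cellOf m z.pre ζ.1.1 = ζ := by
  simp only [Round.cells, Finset.mem_map, Function.Embedding.coeFn_mk]
  constructor
  · rintro ⟨k, hk, rfl⟩; exact ⟨hk, rfl⟩
  · rintro ⟨h1, h2⟩; exact ⟨_, h1, h2⟩

lemma sum_cells {m : ℕ} {M : Type*} [AddCommMonoid M] (z : Round S N) (f : Cell S m → M) :
    ∑ ζ ∈ z.cells m, f ζ = ∑ k ∈ z.act.1, f (cellOf m z.pre k) := by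
  simp [Round.cells]

lemma visits_append {m : ℕ} (hist : List (Round S N)) (z : Round S N) (ζ : Cell S m) :
    visits (hist ++ [z]) ζ = visits hist ζ + if ζ ∈ z.cells m then 1 else 0 := by
  simp [visits, List.countP_append, List.countP_singleton]

lemma visits_le_length {m : ℕ} (hist : List (Round S N)) (ζ : Cell S m) :
    visits hist ζ ≤ hist.length := List.countP_le_length

lemma visits_take_le {m : ℕ} (hist : List (Round S N)) (n : ℕ) (ζ : Cell S m) :
    visits (hist.take n) ζ ≤ visits hist ζ := (List.take_sublist n hist).countP_le

lemma sum_visits {m : ℕ} (hist : List (Round S N)) :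
    ∑ ζ : Cell S m, visits hist ζ = N * hist.length := by
  induction hist using List.reverseRecOn with
  | nil => simp [visits]
  | append_singleton l z ih =>
    simp only [visits_append, Finset.sum_add_distrib, ih, Finset.sum_ite_mem, Finset.univ_inter,
      Finset.sum_const, List.length_append, List.length_singleton, mul_add]
    simp [Round.cells, z.act.2]

/-- The counters of the algorithm, for the threshold `⌈Tmix⌉ = m + 1`. -/
lemma counter_eq_visits {Tmix : ℝ} {m : ℕ} (hm : ⌈Tmix⌉₊ = m + 1) (hist : List (Round S N))
    (k : Fin K) (s : S k) (n : ℕ+) :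
    counter Tmix hist k s n =
      visits hist ((⟨k, s⟩, ⟨min ((n : ℕ) - 1) m, by omega⟩) : Cell S m) := by
  have hlt : ∀ n : ℕ, (n : ℝ) < Tmix ↔ n < m + 1 := fun n => by rw [← hm, Nat.lt_ceil]
  have hcell : ∀ (z : Round S N), (((⟨k, s⟩, ⟨min ((n : ℕ) - 1) m, by omega⟩) : Cell S m) ∈
      z.cells m) ↔ k ∈ z.act.1 ∧ z.pre.last k = s ∧
        min ((z.pre.age k : ℕ) - 1) m = min ((n : ℕ) - 1) m := by
    intro z
    rw [mem_cells]
    simp [cellOf]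
  rw [visits]
  simp only [hcell, counter]
  have hn := n.pos
  split_ifs with h
  · rw [hlt] at h
    congr 1
    funext z
    have hz := (z.pre.age k).pos
    have : (min ((z.pre.age k : ℕ) - 1) m = min ((n : ℕ) - 1) m) ↔ z.pre.age k = n := by
      rw [← PNat.coe_inj]; omega
    simp [this]
  · rw [hlt] at h
    congr 1
    funext z
    have hz := (z.pre.age k).pos
    have : (min ((z.pre.age k : ℕ) - 1) m = min ((n : ℕ) - 1) m) ↔
        Tmix ≤ ((z.pre.age k : ℕ) : ℝ) := by
      rw [← not_lt, hlt]; omega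
    simp [this]

lemma exists_counter_eq_visits {Tmix : ℝ} {m : ℕ} (hm : ⌈Tmix⌉₊ = m + 1) (ζ : Cell S m) :
    ∃ n : ℕ+, ∀ hist : List (Round S N), counter Tmix hist ζ.1.1 ζ.1.2 n = visits hist ζ := by
  refine ⟨Nat.succPNat ζ.2, fun hist => ?_⟩
  rw [counter_eq_visits hm]
  congr 1
  refine Prod.ext rfl (Fin.ext ?_)
  have := ζ.2.2
  simp
  omega

lemma terminates_iff {Tmix : ℝ} {m : ℕ} (hm : ⌈Tmix⌉₊ = m + 1) (w : World S N) :
    w.Terminates Tmix ↔ w.time > w.start + w.prevLen ∨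
      ∃ ζ : Cell S m, visits w.hist ζ > 2 * visits (w.hist.take (w.start - 1)) ζ := by
  refine or_congr Iff.rfl ⟨?_, ?_⟩
  · rintro ⟨k, s, n, h⟩
    rw [counter_eq_visits hm, counter_eq_visits hm] at h
    exact ⟨_, h⟩
  · rintro ⟨ζ, h⟩
    obtain ⟨n, hn⟩ := exists_counter_eq_visits (N := N) hm ζ
    exact ⟨ζ.1.1, ζ.1.2, n, by rwa [hn, hn]⟩

end Cells

/-! ### The number of episodes -/

section Episodes

variable {K N : ℕ} {S : Fin K → Type*} [∀ k, Fintype (S k)] [∀ k, DecidableEq (S k)]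
variable {Q : Measure (Params S)} {μ : Params S → Policy S N} {Tmix : ℝ} {ξ₁ : Meta S}

/-- A concave function with `p / a + (rampGain a p - rampGain a (p - 1)) ≥ 1` and values in
`[0, a / 2]`: it pays for the short episodes at the beginning of a run of episodes of increasing
lengths. -/
def rampGain (a p : ℝ) : ℝ := a / 2 - (max (a - p) 0) ^ 2 / (2 * a)

lemma rampGain_zero {a : ℝ} (ha : 0 < a) : rampGain a 0 = 0 := by
  rw [rampGain, sub_zero, max_eq_left ha.le]; field_simp; ring

lemma rampGain_le {a : ℝ} (ha : 0 < a) (p : ℝ) : rampGain a p ≤ a / 2 := by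
  rw [rampGain]; have : 0 ≤ (max (a - p) 0) ^ 2 / (2 * a) := by positivity
  linarith

lemma rampGain_mono {a : ℝ} (ha : 0 < a) {p q : ℝ} (h : p ≤ q) : rampGain a p ≤ rampGain a q := by
  have h1 : max (a - q) 0 ≤ max (a - p) 0 := max_le_max (by linarith) le_rfl
  have h2 : (0 : ℝ) ≤ max (a - q) 0 := le_max_right _ _
  rw [rampGain, rampGain]
  gcongr

lemma one_le_rampGain {a : ℝ} (ha : 0 < a) (p : ℝ) :
    1 ≤ (p + 1) / a + (rampGain a (p + 1) - rampGain a p) := by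
  rcases le_total a (p + 1) with h | h
  · have h1 := rampGain_mono ha (show p ≤ p + 1 by linarith)
    have h2 : 1 ≤ (p + 1) / a := by rwa [le_div_iff₀ ha, one_mul]
    linarith
  · rw [rampGain, rampGain, max_eq_left (by linarith), max_eq_left (by linarith)]
    have : (p + 1) / a + (a / 2 - (a - (p + 1)) ^ 2 / (2 * a) - (a / 2 - (a - p) ^ 2 / (2 * a))) =
        1 + 1 / (2 * a) := by field_simp; ring
    rw [this]
    have : 0 < 1 / (2 * a) := by positivity
    linarith

/-- The total number of doublings of the counters. -/
def doublings (m : ℕ) (hist : List (Round S N)) : ℝ :=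
  ∑ ζ : Cell S m, Real.logb 2 (visits hist ζ + 1)

lemma logb_two_mono {x y : ℕ} (h : x ≤ y) : Real.logb 2 (x + 1) ≤ Real.logb 2 (y + 1) :=
  Real.logb_le_logb_of_le one_lt_two (by positivity) (by gcongr)

lemma doublings_take_le (m : ℕ) (hist : List (Round S N)) (n : ℕ) :
    doublings m (hist.take n) ≤ doublings m hist :=
  Finset.sum_le_sum fun ζ _ => logb_two_mono (visits_take_le hist n ζ)

lemma doublings_take_add_one_le {m : ℕ} {hist : List (Round S N)} {n : ℕ} {ζ : Cell S m}
    (h : visits hist ζ > 2 * visits (hist.take n) ζ) :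
    doublings m (hist.take n) + 1 ≤ doublings m hist := by
  have h1 : Real.logb 2 (visits (hist.take n) ζ + 1) + 1 ≤ Real.logb 2 (visits hist ζ + 1) := by
    have h2 : Real.logb 2 (visits (hist.take n) ζ + 1) + 1 =
        Real.logb 2 ((visits (hist.take n) ζ + 1) * 2) := by
      rw [Real.logb_mul (by positivity) two_ne_zero, Real.logb_self_eq_one one_lt_two]
    rw [h2]
    refine Real.logb_le_logb_of_le one_lt_two (by positivity) ?_
    have : (visits (hist.take n) ζ + 1) * 2 ≤ visits hist ζ + 1 := by omega
    exact_mod_cast this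
  rw [doublings, doublings, ← Finset.add_sum_erase _ _ (Finset.mem_univ ζ),
    ← Finset.add_sum_erase (a := ζ) _ (fun ζ => Real.logb 2 (visits hist ζ + 1)) (Finset.mem_univ ζ)]
  have h3 : ∑ ζ' ∈ Finset.univ.erase ζ, Real.logb 2 (visits (hist.take n) ζ' + 1) ≤
      ∑ ζ' ∈ Finset.univ.erase ζ, Real.logb 2 (visits hist ζ' + 1) :=
    Finset.sum_le_sum fun ζ' _ => logb_two_mono (visits_take_le hist n ζ')
  linarith

lemma doublings_mem_Icc (m : ℕ) {hist : List (Round S N)} {n : ℕ} (hn : hist.length ≤ n) :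
    doublings m hist ∈ Set.Icc 0 ((Fintype.card (Cell S m) : ℝ) * Real.logb 2 (n + 1)) := by
  constructor
  · exact Finset.sum_nonneg fun ζ _ => Real.logb_nonneg one_lt_two (by
      have : (0 : ℝ) ≤ visits hist ζ := by positivity
      linarith)
  · rw [← nsmul_eq_mul, ← Finset.card_univ]
    exact Finset.sum_le_card_nsmul _ _ _ fun ζ _ =>
      logb_two_mono ((visits_le_length hist ζ).trans hn)

/-- The potential that increases by at least one whenever a new episode starts. -/
def episodePotential (m : ℕ) (a : ℝ) (w : World S N) : ℝ :=
  ((w.start : ℝ) - 1) / a + rampGain a w.prevLen + a / 2 * doublings m (w.hist.take (w.start - 1))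

/-- An episode that ends by its length is one round longer than the one before, so that its length and
the step of `rampGain` pay for it (`one_le_rampGain`). An episode that ends by a doubled counter gains
`a / 2` in the last term; this replaces the old value of `rampGain`, and the new value, at a length of
at least one, pays for the episode. -/
lemma episodePotential_succ {m : ℕ} (hm : ⌈Tmix⌉₊ = m + 1) {a : ℝ} (ha : 0 < a) {t : ℕ}
    {w : World S N} (hw : w.Valid Tmix t) (A : Action K N) (s : ∀ k, S k) {ϑ : Params S}
    {y : World S N × Params S} (hy : IsSucc Tmix (w.obs A s) ϑ y) :
    episodePotential m a w + y.1.newInd ≤ episodePotential m a y.1 := by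
  have hlen := hw.length_hist
  have hst := hw.start_le
  have hst1 := hw.one_le_start
  have htake : (w.obs A s).hist.take (w.start - 1) = w.hist.take (w.start - 1) := by
    have : (w.obs A s).hist = w.hist ++ [⟨w.cur, A, w.cur.next A s⟩] := rfl
    rw [this, List.take_append_of_le_length (by omega)]
  rcases hy with ⟨ht, hy⟩ | ⟨-, rfl⟩
  · rw [hy, World.newInd_newEpisode]
    set w' := w.obs A s with hw'
    have hlen' : w'.hist.length = t + 1 := by
      simp [hw', World.obs, World.withArms, World.advance, hlen]
    have e1 : w'.newEpisode.hist.take (w'.newEpisode.start - 1) = w'.hist := by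
      change w'.hist.take (w'.hist.length + 1 - 1) = w'.hist
      rw [Nat.add_sub_cancel, List.take_length]
    have e2 : ((w'.newEpisode.start : ℕ) : ℝ) = t + 2 := by
      change ((w'.hist.length + 1 : ℕ) : ℝ) = _
      rw [hlen']; push_cast; ring
    have e3 : w'.newEpisode.prevLen = t + 2 - w.start := by
      change w'.hist.length + 1 - w.start = _
      rw [hlen']
    have e3' : ((t + 2 - w.start : ℕ) : ℝ) = t + 2 - w.start := by
      rw [Nat.cast_sub (by omega)]; push_cast; ring
    rw [episodePotential, episodePotential, e1, e2, e3, e3', ← htake]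
    have hsplit : ((t : ℝ) + 2 - 1) / a = ((w.start : ℝ) - 1) / a + ((t : ℝ) + 2 - w.start) / a := by
      field_simp; ring
    rw [hsplit]
    rw [terminates_iff hm] at ht
    have hmono := doublings_take_le m w'.hist (w.start - 1)
    rcases ht with ht | ⟨ζ, hζ⟩
    · have h1 : w'.time = t + 2 := by rw [World.time, hlen']
      have h2 := hw.time_le
      rw [hw.time_eq] at h2
      rw [h1] at ht
      change t + 2 > w.start + w.prevLen at ht
      have h3 : (t : ℝ) + 2 - w.start = w.prevLen + 1 := by
        have : t + 2 = w.start + w.prevLen + 1 := by omega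
        have : ((t + 2 : ℕ) : ℝ) = ((w.start + w.prevLen + 1 : ℕ) : ℝ) := by rw [this]
        push_cast at this
        linarith
      rw [h3]
      have h4 := one_le_rampGain ha (w.prevLen : ℝ)
      have h5 := mul_le_mul_of_nonneg_left hmono (show 0 ≤ a / 2 by positivity)
      linarith
    · have h1 := doublings_take_add_one_le hζ
      change doublings m (w'.hist.take (w.start - 1)) + 1 ≤ _ at h1
      have h2 : (1 : ℝ) ≤ t + 2 - w.start := by
        have : ((w.start : ℕ) : ℝ) ≤ ((t + 1 : ℕ) : ℝ) := by exact_mod_cast hst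
        push_cast at this
        linarith
      have h3 := one_le_rampGain ha 0
      rw [rampGain_zero ha, zero_add, sub_zero] at h3
      have h4 := rampGain_mono ha h2
      have h5 : 1 / a ≤ ((t : ℝ) + 2 - w.start) / a := by gcongr
      have h6 := rampGain_le ha (w.prevLen : ℝ)
      have h7 := mul_le_mul_of_nonneg_left h1 (show 0 ≤ a / 2 by positivity)
      linarith
  · rw [hw.newInd_obs, add_zero, episodePotential, episodePotential]
    change _ ≤ ((w.start : ℝ) - 1) / a + rampGain a w.prevLen +
      a / 2 * doublings m ((w.obs A s).hist.take (w.start - 1))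
    rw [htake]

lemma episodePotential_mem_Icc {m : ℕ} {a : ℝ} (ha : 0 < a) {t : ℕ} {w : World S N}
    (hw : w.Valid Tmix t) : episodePotential m a w ∈ Set.Icc 0
      (t / a + a / 2 * (1 + Fintype.card (Cell S m) * Real.logb 2 (t + 1))) := by
  have h1 : (1 : ℝ) ≤ w.start := by exact_mod_cast hw.one_le_start
  have h2 : (w.start : ℝ) ≤ t + 1 := by exact_mod_cast hw.start_le
  have h3 : (0 : ℝ) ≤ rampGain a w.prevLen := by
    rw [← rampGain_zero ha]
    exact rampGain_mono ha (Nat.cast_nonneg _)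
  have h4 := rampGain_le ha (w.prevLen : ℝ)
  have h5 := doublings_mem_Icc m (hist := w.hist.take (w.start - 1)) (n := t) (by
    rw [List.length_take, hw.length_hist]; exact min_le_right _ _)
  have h6 : ((w.start : ℝ) - 1) / a ≤ t / a := by gcongr; linarith
  have h7 := mul_le_mul_of_nonneg_left h5.2 (show 0 ≤ a / 2 by positivity)
  have h8 := mul_nonneg (show 0 ≤ a / 2 by positivity) h5.1
  have h9 : 0 ≤ ((w.start : ℝ) - 1) / a := div_nonneg (by linarith) ha.le
  rw [episodePotential]
  constructor
  · linarith
  · linarith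

/-- The expected number of episodes that start in the rounds `2, …, n + 1`. -/
lemma sum_integral_newInd_le [IsProbabilityMeasure Q]
    (hμ : ∀ (ξ : Meta S) (A : Action K N), MeasurableSet {θ | μ θ ξ = A}) {m : ℕ}
    (hm : ⌈Tmix⌉₊ = m + 1) {a : ℝ} (ha : 0 < a) (θ : Params S) (n : ℕ) :
    ∑ t ∈ Finset.range n, ∫ x, x.1.newInd ∂(obsLaw Q μ Tmix ξ₁ θ (t + 1)) ≤
      n / a + a / 2 * (1 + Fintype.card (Cell S m) * Real.logb 2 (n + 1)) := by
  have hG : MeasurableSet (Set.univ : Set (Params S)) := MeasurableSet.univ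
  have hQ : ∀ᵐ ϑ ∂Q, ϑ ∈ (Set.univ : Set (Params S)) := by simp
  have hb : ∀ (t : ℕ) (x : World S N × Params S), ValidIn Tmix Set.univ t x →
      |episodePotential m a x.1| ≤
        (t / a + a / 2 * (1 + Fintype.card (Cell S m) * Real.logb 2 (t + 1))) := by
    intro t x hx
    have := episodePotential_mem_Icc (m := m) ha hx.1
    rw [abs_of_nonneg this.1]
    exact this.2
  have hi : ∀ t, Integrable (fun x => episodePotential m a x.1) (obsLaw Q μ Tmix ξ₁ θ t) :=
    fun t => integrable_obsLaw hμ hG hQ θ t measurable_world (hb t)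
  have hn1 : ∀ x : World S N × Params S, |x.1.newInd| ≤ 1 := fun x => by
    rw [abs_of_nonneg x.1.newInd_nonneg]; exact x.1.newInd_le_one
  have hi_n : ∀ t, Integrable (fun x => x.1.newInd) (obsLaw Q μ Tmix ξ₁ θ t) := fun t =>
    integrable_obsLaw hμ hG hQ θ t measurable_world fun x _ => hn1 x
  have hstep : ∀ t, ∫ x, episodePotential m a x.1 ∂(obsLaw Q μ Tmix ξ₁ θ t) +
      ∫ x, x.1.newInd ∂(obsLaw Q μ Tmix ξ₁ θ (t + 1)) ≤
        ∫ x, episodePotential m a x.1 ∂(obsLaw Q μ Tmix ξ₁ θ (t + 1)) := by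
    intro t
    have h := integral_obsLaw_succ_le (ξ₁ := ξ₁) hμ hG hQ θ t
      (F := fun x => x.1.newInd - episodePotential m a x.1)
      (F₀ := fun x => -episodePotential m a x.1)
      (measurable_world (f := fun w => w.newInd - episodePotential m a w))
      (fun x hx => (abs_sub _ _).trans (add_le_add (hn1 x) (hb _ x hx)))
      (hi t).neg (fun x _ => -episodePotential m a x.1)
      (by
        intro x hx s y hy hs
        have := episodePotential_succ hm ha hx.1 _ s hs
        linarith)
      (by
        intro x hx
        rw [← Finset.sum_mul, sum_armsProb, one_mul])
    rw [integral_sub (hi_n _) (hi _), integral_neg] at h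
    linarith
  have main : ∀ n, ∫ x, episodePotential m a x.1 ∂(obsLaw Q μ Tmix ξ₁ θ 0) +
      ∑ t ∈ Finset.range n, ∫ x, x.1.newInd ∂(obsLaw Q μ Tmix ξ₁ θ (t + 1)) ≤
        ∫ x, episodePotential m a x.1 ∂(obsLaw Q μ Tmix ξ₁ θ n) := by
    intro n
    induction n with
    | zero => simp
    | succ n ih => rw [Finset.sum_range_succ]; linarith [hstep n]
  have h0 : 0 ≤ ∫ x, episodePotential m a x.1 ∂(obsLaw Q μ Tmix ξ₁ θ 0) := by
    refine integral_nonneg_of_ae ?_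
    filter_upwards [ae_obsLaw hμ hG hQ θ 0] with x hx
    exact (episodePotential_mem_Icc ha hx.1).1
  have h1 : ∫ x, episodePotential m a x.1 ∂(obsLaw Q μ Tmix ξ₁ θ n) ≤
      n / a + a / 2 * (1 + Fintype.card (Cell S m) * Real.logb 2 (n + 1)) := by
    have := isProbabilityMeasure_obsLaw (Q := Q) (Tmix := Tmix) (ξ₁ := ξ₁) hμ θ n
    have h2 := integral_mono_ae (hi n) (integrable_const (n / a + a / 2 * (1 +
      Fintype.card (Cell S m) * Real.logb 2 (n + 1)))) ((ae_obsLaw hμ hG hQ θ n).mono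
        fun x hx => (episodePotential_mem_Icc (m := m) ha hx.1).2)
    simpa using h2
  linarith [main n]

end Episodes

/-! ### Concentration of the observations -/

section Hoeffding

/-- Hoeffding's lemma for a distribution on a finite set. -/
lemma sum_mul_exp_le {α : Type*} [Fintype α] {p f : α → ℝ} (hp : ∀ i, 0 ≤ p i)
    (hp1 : ∑ i, p i = 1) (hf : ∀ i, f i ∈ Set.Icc (-1 : ℝ) 1) (l : ℝ) :
    ∑ i, p i * Real.exp (l * (f i - ∑ j, p j * f j)) ≤ Real.exp (l ^ 2 / 2) := by
  let _ : MeasurableSpace α := ⊤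
  let ν : Measure α := ∑ i, ENNReal.ofReal (p i) • Measure.dirac i
  have hint : ∀ g : α → ℝ, ∫ x, g x ∂ν = ∑ i, p i * g i := by
    intro g
    rw [integral_finsetSum_measure fun i _ => by
      refine Integrable.smul_measure ?_ ENNReal.ofReal_ne_top
      exact integrable_dirac (by simp)]
    refine Finset.sum_congr rfl fun i _ => ?_
    rw [integral_smul_measure, integral_dirac, ENNReal.toReal_ofReal (hp i), smul_eq_mul]
  have hν : IsProbabilityMeasure ν := by
    refine ⟨?_⟩
    simp only [ν, Measure.finsetSum_apply, Measure.smul_apply, measure_univ, smul_eq_mul, mul_one]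
    rw [← ENNReal.ofReal_sum_of_nonneg fun i _ => hp i, hp1, ENNReal.ofReal_one]
  have h := (ProbabilityTheory.hasSubgaussianMGF_of_mem_Icc (μ := ν) (X := f) (a := -1) (b := 1)
    (measurable_from_top.aemeasurable) (Eventually.of_forall hf)).mgf_le l
  rw [ProbabilityTheory.mgf, hint, hint] at h
  refine h.trans (le_of_eq ?_)
  congr 1
  have : ((‖(1 : ℝ) - (-1)‖₊ / 2 : NNReal) : ℝ) = 1 := by
    norm_num
  rw [NNReal.coe_pow, this]; ring

end Hoeffding

section Concentration

variable {K N : ℕ} {S : Fin K → Type*} [∀ k, Fintype (S k)] [∀ k, DecidableEq (S k)]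
variable {Q : Measure (Params S)} {μ : Params S → Policy S N} {Tmix : ℝ} {ξ₁ : Meta S}

/-- The sum of `f(s') - E_θ[f(s')]` over the recorded rounds in which the counter `ζ` has been
incremented, where `s'` is the observed state of the arm of `ζ`. -/
def centeredSum {m : ℕ} (θ : Params S) (ζ : Cell S m) (f : S ζ.1.1 → ℝ)
    (hist : List (Round S N)) : ℝ :=
  (hist.map fun z => if ζ ∈ z.cells m then f (z.post.last ζ.1.1) -
    ∑ x, stateProb θ ζ.1.1 (z.pre.last ζ.1.1) (z.pre.age ζ.1.1) x * f x else 0).sum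

/-- The `ℓ¹`-distance between the numbers of observations of the states in the rounds that belong to
the counter `ζ` and the sums of their conditional probabilities under `θ`. -/
def deviation {m : ℕ} (θ : Params S) (ζ : Cell S m) (hist : List (Round S N)) : ℝ :=
  ∑ x, |centeredSum θ ζ (fun y => if y = x then 1 else 0) hist|

lemma centeredSum_append {m : ℕ} (θ : Params S) (ζ : Cell S m) (f : S ζ.1.1 → ℝ)
    (hist : List (Round S N)) (z : Round S N) :
    centeredSum θ ζ f (hist ++ [z]) = centeredSum θ ζ f hist +
      if ζ ∈ z.cells m then f (z.post.last ζ.1.1) -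
        ∑ x, stateProb θ ζ.1.1 (z.pre.last ζ.1.1) (z.pre.age ζ.1.1) x * f x else 0 := by
  simp [centeredSum]

lemma abs_sub_stateProb_le {θ : Params S} {k : Fin K} {f : S k → ℝ}
    (hf : ∀ x, f x ∈ Set.Icc (-1 : ℝ) 1) (s x : S k) (n : ℕ+) :
    |f x - ∑ y, stateProb θ k s n y * f y| ≤ 2 := by
  have h1 : ∑ y, stateProb θ k s n y * f y ≤ ∑ y, stateProb θ k s n y * 1 :=
    Finset.sum_le_sum fun y _ => mul_le_mul_of_nonneg_left (hf y).2 (stateProb_nonneg ..)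
  have h2 : ∑ y, stateProb θ k s n y * (-1) ≤ ∑ y, stateProb θ k s n y * f y :=
    Finset.sum_le_sum fun y _ => mul_le_mul_of_nonneg_left (hf y).1 (stateProb_nonneg ..)
  rw [← Finset.sum_mul, sum_stateProb] at h1 h2
  rw [abs_le]
  constructor <;> linarith [(hf x).1, (hf x).2]

lemma abs_centeredSum_le {m : ℕ} {θ : Params S} {ζ : Cell S m} {f : S ζ.1.1 → ℝ}
    (hf : ∀ x, f x ∈ Set.Icc (-1 : ℝ) 1) (hist : List (Round S N)) :
    |centeredSum θ ζ f hist| ≤ 2 * hist.length := by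
  induction hist using List.reverseRecOn with
  | nil => simp [centeredSum]
  | append_singleton l z ih =>
    rw [centeredSum_append]
    refine (abs_add_le _ _).trans ?_
    have : |if ζ ∈ z.cells m then f (z.post.last ζ.1.1) -
        ∑ x, stateProb θ ζ.1.1 (z.pre.last ζ.1.1) (z.pre.age ζ.1.1) x * f x else 0| ≤ 2 := by
      split_ifs
      · exact abs_sub_stateProb_le hf _ _ _
      · simp
    simp only [List.length_append, List.length_singleton]
    push_cast
    linarith

/-- The exponential supermartingale of Hoeffding's inequality. -/
def expDev {m : ℕ} (θ : Params S) (ζ : Cell S m) (f : S ζ.1.1 → ℝ) (l : ℝ)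
    (hist : List (Round S N)) : ℝ :=
  Real.exp (l * centeredSum θ ζ f hist - l ^ 2 / 2 * visits hist ζ)

lemma abs_expDev_le {m : ℕ} {θ : Params S} {ζ : Cell S m} {f : S ζ.1.1 → ℝ}
    (hf : ∀ x, f x ∈ Set.Icc (-1 : ℝ) 1) (l : ℝ) (hist : List (Round S N)) :
    |expDev θ ζ f l hist| ≤ Real.exp (|l| * (2 * hist.length)) := by
  rw [expDev, Real.abs_exp, Real.exp_le_exp]
  have h1 : l * centeredSum θ ζ f hist ≤ |l| * (2 * hist.length) := by
    refine (le_abs_self _).trans ?_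
    rw [abs_mul]
    exact mul_le_mul_of_nonneg_left (abs_centeredSum_le hf hist) (abs_nonneg _)
  have h2 : 0 ≤ l ^ 2 / 2 * (visits hist ζ : ℝ) := by positivity
  linarith

lemma sum_armsProb_mul_expDev_le {m : ℕ} (θ : Params S) (ζ : Cell S m) {f : S ζ.1.1 → ℝ}
    (hf : ∀ x, f x ∈ Set.Icc (-1 : ℝ) 1) (l : ℝ) (w : World S N) (A : Action K N) :
    ∑ s, armsProb θ w.cur s * expDev θ ζ f l (w.obs A s).hist ≤ expDev θ ζ f l w.hist := by
  have hh : ∀ s, (w.obs A s).hist = w.hist ++ [⟨w.cur, A, w.cur.next A s⟩] := fun s => rfl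
  have hc : ∀ s, ζ ∈ (⟨w.cur, A, w.cur.next A s⟩ : Round S N).cells m ↔
      ζ.1.1 ∈ A.1 ∧ cellOf m w.cur ζ.1.1 = ζ := fun s => mem_cells
  simp only [hh, expDev, centeredSum_append, visits_append, hc]
  by_cases h : ζ.1.1 ∈ A.1 ∧ cellOf m w.cur ζ.1.1 = ζ
  · simp only [h, and_self, if_true, Meta.next]
    set c := centeredSum θ ζ f w.hist
    set e := ∑ x, stateProb θ ζ.1.1 (w.cur.last ζ.1.1) (w.cur.age ζ.1.1) x * f x with he
    have h1 : ∀ s : ∀ k, S k, armsProb θ w.cur s * Real.exp (l * (c + (f (s ζ.1.1) - e)) -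
        l ^ 2 / 2 * ((visits w.hist ζ + 1 : ℕ) : ℝ)) =
        armsProb θ w.cur s * Real.exp (l * (f (s ζ.1.1) - e)) *
          (Real.exp (-(l ^ 2 / 2)) * Real.exp (l * c - l ^ 2 / 2 * visits w.hist ζ)) := by
      intro s
      rw [mul_assoc, ← Real.exp_add, ← Real.exp_add]
      congr 2
      push_cast
      ring
    simp_rw [h1]
    rw [← Finset.sum_mul, sum_armsProb_mul θ w.cur ζ.1.1 fun x => Real.exp (l * (f x - e)),
      ← mul_assoc]
    refine mul_le_of_le_one_left (Real.exp_pos _).le ?_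
    rw [Real.exp_neg, ← div_eq_mul_inv, div_le_one (Real.exp_pos _)]
    exact sum_mul_exp_le (fun x => stateProb_nonneg ..) (sum_stateProb ..) hf l
  · simp only [h, if_false, add_zero]
    rw [← Finset.sum_mul, sum_armsProb, one_mul]

lemma measurable_hist {f : List (Round S N) → ℝ} :
    Measurable fun x : World S N × Params S => f x.1.hist :=
  measurable_world (f := fun w => f w.hist)

lemma integrable_expDev [IsProbabilityMeasure Q]
    (hμ : ∀ (ξ : Meta S) (A : Action K N), MeasurableSet {θ | μ θ ξ = A}) {m : ℕ}
    (θ : Params S) (ζ : Cell S m) {f : S ζ.1.1 → ℝ} (hf : ∀ x, f x ∈ Set.Icc (-1 : ℝ) 1) (l : ℝ)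
    (t : ℕ) : Integrable (fun x => expDev θ ζ f l x.1.hist) (obsLaw Q μ Tmix ξ₁ θ t) :=
  integrable_obsLaw hμ MeasurableSet.univ (by simp) θ t (measurable_hist (f := expDev θ ζ f l))
    (C := Real.exp (|l| * (2 * t))) fun x hx => by
      have := abs_expDev_le (θ := θ) hf l x.1.hist
      rwa [hx.1.length_hist] at this

lemma integral_expDev_le_one [IsProbabilityMeasure Q]
    (hμ : ∀ (ξ : Meta S) (A : Action K N), MeasurableSet {θ | μ θ ξ = A}) {m : ℕ}
    (θ : Params S) (ζ : Cell S m) {f : S ζ.1.1 → ℝ} (hf : ∀ x, f x ∈ Set.Icc (-1 : ℝ) 1) (l : ℝ)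
    (t : ℕ) : ∫ x, expDev θ ζ f l x.1.hist ∂(obsLaw Q μ Tmix ξ₁ θ t) ≤ 1 := by
  induction t with
  | zero =>
    rw [integral_obsLaw_zero _ (measurable_hist (f := expDev θ ζ f l))]
    simp [expDev, centeredSum, visits]
  | succ t ih =>
    refine le_trans ?_ ih
    refine integral_obsLaw_succ_le hμ MeasurableSet.univ (by simp) θ t
      (measurable_hist (f := expDev θ ζ f l)) (C := Real.exp (|l| * (2 * (t + 1 : ℕ))))
      (fun x hx => ?_) (integrable_expDev hμ θ ζ hf l t)
      (fun x s => expDev θ ζ f l (x.1.obs (μ x.2 x.1.cur) s).hist) (fun x hx s y hy hs => ?_)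
      (fun x hx => sum_armsProb_mul_expDev_le θ ζ hf l x.1 _)
    · have := abs_expDev_le (θ := θ) hf l x.1.hist
      rwa [hx.1.length_hist] at this
    · rw [hist_of_isSucc hs]

/-- The observations of some counter deviate from their expectations under `θ`; the radius `ρ k`
refers to a single observation of arm `k`. -/
def IsBad (m : ℕ) (ρ : Fin K → ℝ) (hist : List (Round S N)) (θ : Params S) : Prop :=
  ∃ ζ : Cell S m, ρ ζ.1.1 * √(visits hist ζ : ℝ) < deviation θ ζ hist

open Classical in
/-- The indicator of `IsBad`. -/
def badInd (m : ℕ) (ρ : Fin K → ℝ) (hist : List (Round S N)) (θ : Params S) : ℝ :=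
  if IsBad m ρ hist θ then 1 else 0

lemma badInd_nonneg (m : ℕ) (ρ : Fin K → ℝ) (hist : List (Round S N)) (θ : Params S) :
    0 ≤ badInd m ρ hist θ := by rw [badInd]; split_ifs <;> simp

lemma badInd_le_one (m : ℕ) (ρ : Fin K → ℝ) (hist : List (Round S N)) (θ : Params S) :
    badInd m ρ hist θ ≤ 1 := by rw [badInd]; split_ifs <;> simp

lemma measurable_centeredSum {m : ℕ} (ζ : Cell S m) (f : S ζ.1.1 → ℝ) (hist : List (Round S N)) :
    Measurable fun θ : Params S => centeredSum θ ζ f hist := by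
  induction hist using List.reverseRecOn with
  | nil => simp only [centeredSum, List.map_nil, List.sum_nil]; exact measurable_const
  | append_singleton l z ih =>
    simp only [centeredSum_append]
    refine ih.add ?_
    split_ifs
    · exact measurable_const.sub (Finset.measurable_fun_sum _ fun x _ =>
        (measurable_stateProb _ _ _ _).mul_const _)
    · exact measurable_const

lemma measurable_badInd (m : ℕ) (ρ : Fin K → ℝ) (hist : List (Round S N)) :
    Measurable fun θ : Params S => badInd m ρ hist θ := by
  classical
  refine Measurable.ite ?_ measurable_const measurable_const
  have : {θ : Params S | IsBad m ρ hist θ} =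
      ⋃ ζ : Cell S m, {θ | ρ ζ.1.1 * √(visits hist ζ : ℝ) < deviation θ ζ hist} := by
    ext θ; simp [IsBad]
  rw [this]
  refine MeasurableSet.iUnion fun ζ => measurableSet_lt measurable_const ?_
  exact Finset.measurable_fun_sum _ fun x _ => (measurable_centeredSum ζ _ hist).abs

/-- A vector of signs. -/
def signVec {α : Type*} (b : α → Bool) (x : α) : ℝ := if b x then 1 else -1

lemma signVec_mem {α : Type*} (b : α → Bool) (x : α) : signVec b x ∈ Set.Icc (-1 : ℝ) 1 := by
  rw [signVec]; split_ifs <;> norm_num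

lemma centeredSum_sum {m : ℕ} (θ : Params S) (ζ : Cell S m) (c : S ζ.1.1 → ℝ)
    (hist : List (Round S N)) :
    ∑ x, c x * centeredSum θ ζ (fun y => if y = x then 1 else 0) hist = centeredSum θ ζ c hist := by
  induction hist using List.reverseRecOn with
  | nil => simp [centeredSum]
  | append_singleton l z ih =>
    simp only [centeredSum_append, mul_add, Finset.sum_add_distrib, ih]
    congr 1
    split_ifs
    · simp [mul_sub, Finset.sum_sub_distrib, mul_comm]
    · simp

/-- The `ℓ¹`-norm is attained at a vector of signs. -/
lemma exists_deviation_eq {m : ℕ} (θ : Params S) (ζ : Cell S m) (hist : List (Round S N)) :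
    ∃ b : S ζ.1.1 → Bool, deviation θ ζ hist = centeredSum θ ζ (signVec b) hist := by
  refine ⟨fun x => decide (0 ≤ centeredSum θ ζ (fun y => if y = x then 1 else 0) hist), ?_⟩
  rw [← centeredSum_sum, deviation]
  refine Finset.sum_congr rfl fun x _ => ?_
  by_cases h : 0 ≤ centeredSum θ ζ (fun y => if y = x then 1 else 0) hist
  · simp [signVec, h, abs_of_nonneg]
  · simp [signVec, h, abs_of_neg (not_le.1 h)]

lemma badInd_le {m : ℕ} {ρ : Fin K → ℝ} (hρ : ∀ k, 0 ≤ ρ k) (hist : List (Round S N))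
    (θ : Params S) :
    badInd m ρ hist θ ≤ ∑ ζ : Cell S m, ∑ n ∈ Finset.range hist.length, ∑ b : S ζ.1.1 → Bool,
      Real.exp (-((ρ ζ.1.1) ^ 2 / 2)) *
        expDev θ ζ (signVec b) (ρ ζ.1.1 / √((n + 1 : ℕ) : ℝ)) hist := by
  have hpos : ∀ (ζ : Cell S m) (n : ℕ) (b : S ζ.1.1 → Bool),
      0 ≤ Real.exp (-((ρ ζ.1.1) ^ 2 / 2)) *
        expDev θ ζ (signVec b) (ρ ζ.1.1 / √((n + 1 : ℕ) : ℝ)) hist := fun ζ n b =>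
    mul_nonneg (Real.exp_pos _).le (Real.exp_pos _).le
  rw [badInd]
  split_ifs with h
  · obtain ⟨ζ, hζ⟩ := h
    obtain ⟨b, hb⟩ := exists_deviation_eq θ ζ hist
    have hv : visits hist ζ ≠ 0 := by
      intro hv
      have hz : ∀ f : S ζ.1.1 → ℝ, centeredSum θ ζ f hist = 0 := by
        intro f
        rw [visits, List.countP_eq_zero] at hv
        refine List.sum_eq_zero fun a ha => ?_
        obtain ⟨z, hz, rfl⟩ := List.mem_map.1 ha
        have := hv z hz
        simp only [decide_eq_true_eq] at this
        simp [this]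
      rw [hb, hz, hv] at hζ
      simp at hζ
    obtain ⟨n, hn⟩ := Nat.exists_eq_succ_of_ne_zero hv
    have hnl : n ∈ Finset.range hist.length := by
      have := visits_le_length hist ζ
      rw [Finset.mem_range]; omega
    refine le_trans ?_ (Finset.single_le_sum (fun ζ _ => Finset.sum_nonneg fun n _ =>
      Finset.sum_nonneg fun b _ => hpos ζ n b) (Finset.mem_univ ζ))
    refine le_trans ?_ (Finset.single_le_sum (fun n _ =>
      Finset.sum_nonneg fun b _ => hpos ζ n b) hnl)
    refine le_trans ?_ (Finset.single_le_sum (fun b _ => hpos ζ n b) (Finset.mem_univ b))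
    rw [expDev, ← Real.exp_add, hn, Nat.succ_eq_add_one, ← hb]
    refine Real.one_le_exp ?_
    rw [hn] at hζ
    set q := √((n + 1 : ℕ) : ℝ) with hq
    have hq0 : 0 < q := Real.sqrt_pos.2 (by positivity)
    have hq2 : ((n + 1 : ℕ) : ℝ) = q ^ 2 := (Real.sq_sqrt (by positivity)).symm
    rw [hq2]
    have h1 : ρ ζ.1.1 / q * (ρ ζ.1.1 * q) ≤ ρ ζ.1.1 / q * deviation θ ζ hist :=
      mul_le_mul_of_nonneg_left hζ.le (div_nonneg (hρ _) hq0.le)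
    have h2 : ρ ζ.1.1 / q * (ρ ζ.1.1 * q) = ρ ζ.1.1 ^ 2 := by field_simp
    have h3 : (ρ ζ.1.1 / q) ^ 2 / 2 * q ^ 2 = ρ ζ.1.1 ^ 2 / 2 := by field_simp
    rw [h3]
    linarith
  · exact Finset.sum_nonneg fun ζ _ => Finset.sum_nonneg fun n _ =>
      Finset.sum_nonneg fun b _ => hpos ζ n b

/-- The probability of a deviation, by a union bound over the counters, their values, and the
vectors of signs. -/
lemma integral_badInd_le [IsProbabilityMeasure Q]
    (hμ : ∀ (ξ : Meta S) (A : Action K N), MeasurableSet {θ | μ θ ξ = A}) {m : ℕ} {ρ : Fin K → ℝ}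
    (hρ : ∀ k, 0 ≤ ρ k) (θ : Params S) (t : ℕ) :
    ∫ x, badInd m ρ x.1.hist θ ∂(obsLaw Q μ Tmix ξ₁ θ t) ≤
      ∑ ζ : Cell S m, t * 2 ^ Fintype.card (S ζ.1.1) * Real.exp (-((ρ ζ.1.1) ^ 2 / 2)) := by
  have hi : Integrable (fun x => badInd m ρ x.1.hist θ) (obsLaw Q μ Tmix ξ₁ θ t) :=
    integrable_obsLaw hμ MeasurableSet.univ (by simp) θ t
      (measurable_hist (f := fun l => badInd m ρ l θ)) (C := 1) fun x _ => by
        rw [abs_of_nonneg (badInd_nonneg ..)]; exact badInd_le_one ..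
  have hi' : ∀ (ζ : Cell S m) (n : ℕ) (b : S ζ.1.1 → Bool), Integrable (fun x =>
      Real.exp (-((ρ ζ.1.1) ^ 2 / 2)) *
        expDev θ ζ (signVec b) (ρ ζ.1.1 / √((n + 1 : ℕ) : ℝ)) x.1.hist)
      (obsLaw Q μ Tmix ξ₁ θ t) := fun ζ n b =>
    (integrable_expDev hμ θ ζ (signVec_mem b) _ t).const_mul _
  have h1 : ∫ x, badInd m ρ x.1.hist θ ∂(obsLaw Q μ Tmix ξ₁ θ t) ≤
      ∫ x, (∑ ζ : Cell S m, ∑ n ∈ Finset.range t, ∑ b : S ζ.1.1 → Bool,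
      Real.exp (-((ρ ζ.1.1) ^ 2 / 2)) *
        expDev θ ζ (signVec b) (ρ ζ.1.1 / √((n + 1 : ℕ) : ℝ)) x.1.hist)
        ∂(obsLaw Q μ Tmix ξ₁ θ t) := by
    refine integral_mono_ae hi (integrable_finsetSum _ fun ζ _ => integrable_finsetSum _ fun n _ =>
      integrable_finsetSum _ fun b _ => hi' ζ n b) ?_
    filter_upwards [ae_obsLaw hμ MeasurableSet.univ (by simp) θ t] with x hx
    have := badInd_le (m := m) hρ x.1.hist θ
    rwa [hx.1.length_hist] at this
  refine h1.trans ?_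
  rw [integral_finsetSum _ fun ζ _ => integrable_finsetSum _ fun n _ =>
      integrable_finsetSum _ fun b _ => hi' ζ n b]
  refine Finset.sum_le_sum fun ζ _ => ?_
  rw [integral_finsetSum _ fun n _ => integrable_finsetSum _ fun b _ => hi' ζ n b]
  have h2 : ∀ n ∈ Finset.range t, ∫ x, (∑ b : S ζ.1.1 → Bool, Real.exp (-((ρ ζ.1.1) ^ 2 / 2)) *
        expDev θ ζ (signVec b) (ρ ζ.1.1 / √((n + 1 : ℕ) : ℝ)) x.1.hist)
        ∂(obsLaw Q μ Tmix ξ₁ θ t) ≤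
      2 ^ Fintype.card (S ζ.1.1) * Real.exp (-((ρ ζ.1.1) ^ 2 / 2)) := by
    intro n _
    rw [integral_finsetSum _ fun b _ => hi' ζ n b]
    have h3 : ∀ b ∈ (Finset.univ : Finset (S ζ.1.1 → Bool)),
        ∫ x, Real.exp (-((ρ ζ.1.1) ^ 2 / 2)) *
        expDev θ ζ (signVec b) (ρ ζ.1.1 / √((n + 1 : ℕ) : ℝ)) x.1.hist
          ∂(obsLaw Q μ Tmix ξ₁ θ t) ≤ Real.exp (-((ρ ζ.1.1) ^ 2 / 2)) := by
      intro b _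
      rw [integral_const_mul]
      exact mul_le_of_le_one_right (Real.exp_pos _).le
        (integral_expDev_le_one hμ θ ζ (signVec_mem b) _ t)
    refine (Finset.sum_le_card_nsmul _ _ _ h3).trans (le_of_eq ?_)
    simp [nsmul_eq_mul]
  refine (Finset.sum_le_card_nsmul _ _ _ h2).trans (le_of_eq ?_)
  rw [Finset.card_range, nsmul_eq_mul]; ring

/-- The expectation of a quantity that is fixed at the starts of the episodes. -/
lemma integral_le_sum_newInd [IsProbabilityMeasure Q]
    (hμ : ∀ (ξ : Meta S) (A : Action K N), MeasurableSet {θ | μ θ ξ = A}) (θ : Params S)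
    {F : World S N × Params S → ℝ} (hF : Measurable F) (hF01 : ∀ x, F x ∈ Set.Icc (0 : ℝ) 1)
    (hobs : ∀ t (w : World S N) ϑ, w.Valid Tmix t → ∀ A s, F (w.obs A s, ϑ) = F (w, ϑ)) (t : ℕ) :
    ∫ x, F x ∂(obsLaw Q μ Tmix ξ₁ θ t) ≤
      ∑ i ∈ Finset.range (t + 1), ∫ x, x.1.newInd * F x ∂(obsLaw Q μ Tmix ξ₁ θ i) := by
  have hG : MeasurableSet (Set.univ : Set (Params S)) := MeasurableSet.univ
  have hQ : ∀ᵐ ϑ ∂Q, ϑ ∈ (Set.univ : Set (Params S)) := by simp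
  have hmn : Measurable fun x : World S N × Params S => x.1.newInd * F x := measurable_world.mul hF
  have hb : ∀ x : World S N × Params S, |F x| ≤ 1 := fun x => by
    rw [abs_of_nonneg (hF01 x).1]; exact (hF01 x).2
  have hbn : ∀ x : World S N × Params S, |x.1.newInd * F x| ≤ 1 := fun x => by
    rw [abs_mul, abs_of_nonneg x.1.newInd_nonneg]
    exact mul_le_one₀ x.1.newInd_le_one (abs_nonneg _) (hb x)
  have hi : ∀ t, Integrable F (obsLaw Q μ Tmix ξ₁ θ t) := fun t =>
    integrable_obsLaw hμ hG hQ θ t hF fun x _ => hb x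
  have hin : ∀ t, Integrable (fun x => x.1.newInd * F x) (obsLaw Q μ Tmix ξ₁ θ t) := fun t =>
    integrable_obsLaw hμ hG hQ θ t hmn fun x _ => hbn x
  induction t with
  | zero =>
    rw [Finset.sum_range_one, integral_obsLaw_zero _ hF, integral_obsLaw_zero _ hmn]
    have : World.newInd (⟨ξ₁.last, [], ξ₁, 1, 0⟩ : World S N) = 1 := if_pos rfl
    simp [this]
  | succ t ih =>
    rw [Finset.sum_range_succ]
    have h := integral_obsLaw_succ_le (ξ₁ := ξ₁) hμ hG hQ θ t
      (F := fun x => F x - x.1.newInd * F x) (F₀ := F) (hF.sub hmn)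
      (fun x _ => (abs_sub _ _).trans (add_le_add (hb x) (hbn x))) (hi t)
      (fun x _ => F x)
      (by
        intro x hx s y hy hs
        rcases hs with ⟨-, hs⟩ | ⟨-, rfl⟩
        · rw [hs, World.newInd_newEpisode, one_mul, sub_self]
          exact (hF01 x).1
        · rw [hx.1.newInd_obs, zero_mul, sub_zero, hobs t x.1 x.2 hx.1])
      (by
        intro x hx
        rw [← Finset.sum_mul, sum_armsProb, one_mul])
    rw [integral_sub (hi _) (hin _)] at h
    linarith

end Concentration

/-! ### The distance between the observation laws of two parameters -/

section Coupling

variable {ι : Type*} [Fintype ι] [DecidableEq ι] {S : ι → Type*} [∀ i, Fintype (S i)]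

lemma sum_prod_eq_prod_sum (f : ∀ i, S i → ℝ) :
    ∑ s : ∀ i, S i, ∏ i, f i (s i) = ∏ i, ∑ x, f i x := by
  have := (Finset.prod_univ_sum (fun k : ι => (Finset.univ : Finset (S k))) f).symm
  rwa [Fintype.piFinset_univ] at this

/-- The `ℓ¹`-distance between two product distributions that differ in the coordinates in `B`. -/
lemma sum_abs_prod_sub_le {a b : ∀ i, S i → ℝ} (ha : ∀ i x, 0 ≤ a i x) (hb : ∀ i x, 0 ≤ b i x)
    (ha1 : ∀ i, ∑ x, a i x = 1) (hb1 : ∀ i, ∑ x, b i x = 1) (B : Finset ι) :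
    ∑ s : ∀ i, S i, |∏ i, (if i ∈ B then a i (s i) else b i (s i)) - ∏ i, b i (s i)| ≤
      ∑ i ∈ B, ∑ x, |a i x - b i x| := by
  induction B using Finset.induction_on with
  | empty => simp
  | insert j B hj ih =>
    rw [Finset.sum_insert hj]
    set c : ∀ i, S i → ℝ := fun i x => if i ∈ B then a i x else b i x with hc
    have h1 : ∀ s : ∀ i, S i, |∏ i, (if i ∈ insert j B then a i (s i) else b i (s i)) -
        ∏ i, c i (s i)| = ∏ i, (if i = j then |a i (s i) - b i (s i)| else c i (s i)) := by
      intro s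
      rw [← Finset.mul_prod_erase Finset.univ _ (Finset.mem_univ j),
        ← Finset.mul_prod_erase Finset.univ (fun i => c i (s i)) (Finset.mem_univ j),
        ← Finset.mul_prod_erase Finset.univ
          (fun i => if i = j then |a i (s i) - b i (s i)| else c i (s i)) (Finset.mem_univ j)]
      have e1 : ∏ i ∈ Finset.univ.erase j, (if i ∈ insert j B then a i (s i) else b i (s i)) =
          ∏ i ∈ Finset.univ.erase j, c i (s i) := by
        refine Finset.prod_congr rfl fun i hi => ?_
        have := Finset.ne_of_mem_erase hi
        simp [hc, this]
      have e2 : ∏ i ∈ Finset.univ.erase j,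
          (if i = j then |a i (s i) - b i (s i)| else c i (s i)) =
          ∏ i ∈ Finset.univ.erase j, c i (s i) := by
        refine Finset.prod_congr rfl fun i hi => ?_
        have := Finset.ne_of_mem_erase hi
        simp [this]
      have hpos : 0 ≤ ∏ i ∈ Finset.univ.erase j, c i (s i) :=
        Finset.prod_nonneg fun i _ => by simp only [hc]; split_ifs; exacts [ha .., hb ..]
      rw [e1, e2, ← sub_mul, abs_mul, abs_of_nonneg hpos]
      simp [hc, hj]
    have h2 : ∑ s : ∀ i, S i, |∏ i, (if i ∈ insert j B then a i (s i) else b i (s i)) -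
        ∏ i, c i (s i)| = ∑ x, |a j x - b j x| := by
      simp_rw [h1]
      rw [sum_prod_eq_prod_sum fun i x => if i = j then |a i x - b i x| else c i x,
        Finset.prod_eq_single j]
      · simp
      · intro i _ hi
        simp only [hi, if_false, hc]
        split_ifs
        exacts [ha1 i, hb1 i]
      · simp
    calc ∑ s : ∀ i, S i, |∏ i, (if i ∈ insert j B then a i (s i) else b i (s i)) - ∏ i, b i (s i)|
        ≤ ∑ s : ∀ i, S i, (|∏ i, (if i ∈ insert j B then a i (s i) else b i (s i)) -
          ∏ i, c i (s i)| + |∏ i, c i (s i) - ∏ i, b i (s i)|) :=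
          Finset.sum_le_sum fun s _ => abs_sub_le _ _ _
      _ ≤ _ := by rw [Finset.sum_add_distrib, h2]; exact add_le_add le_rfl ih

/-- The expectations of a function of the coordinates in `A` under two product distributions. -/
lemma sum_prod_mul_sub_le {a b : ∀ i, S i → ℝ} (ha : ∀ i x, 0 ≤ a i x) (hb : ∀ i x, 0 ≤ b i x)
    (ha1 : ∀ i, ∑ x, a i x = 1) (hb1 : ∀ i, ∑ x, b i x = 1) (A : Finset ι) {F : (∀ i, S i) → ℝ}
    {c : ℝ} (hF : ∀ s, F s ∈ Set.Icc 0 c)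
    (hFA : ∀ s s' : ∀ i, S i, (∀ i ∈ A, s i = s' i) → F s = F s') :
    ∑ s, (∏ i, a i (s i)) * F s - ∑ s, (∏ i, b i (s i)) * F s ≤
      c / 2 * ∑ i ∈ A, ∑ x, |a i x - b i x| := by
  set d : ∀ i, S i → ℝ := fun i x => if i ∈ A then a i x else b i x with hd
  have h1 : ∑ s, (∏ i, a i (s i)) * F s = ∑ s, (∏ i, d i (s i)) * F s :=
    sum_prod_mul_congr A a d (fun i hi => by funext x; simp [hd, hi])
      (fun i hi => by simp [hd, hi, ha1, hb1]) F hFA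
  have hd1 : ∑ s : ∀ i, S i, ∏ i, d i (s i) = 1 := by
    rw [sum_prod_eq_prod_sum]
    exact Finset.prod_eq_one fun i _ => by simp only [hd]; split_ifs; exacts [ha1 i, hb1 i]
  have hb1' : ∑ s : ∀ i, S i, ∏ i, b i (s i) = 1 := by
    rw [sum_prod_eq_prod_sum]
    exact Finset.prod_eq_one fun i _ => hb1 i
  have h2 : ∑ s, (∏ i, a i (s i)) * F s - ∑ s, (∏ i, b i (s i)) * F s =
      ∑ s, (∏ i, d i (s i) - ∏ i, b i (s i)) * (F s - c / 2) := by
    rw [h1]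
    simp only [sub_mul, mul_sub, Finset.sum_sub_distrib, ← Finset.sum_mul, hd1, hb1']
    ring
  rw [h2]
  calc ∑ s, (∏ i, d i (s i) - ∏ i, b i (s i)) * (F s - c / 2)
      ≤ ∑ s : ∀ i, S i, |∏ i, d i (s i) - ∏ i, b i (s i)| * (c / 2) := by
        refine Finset.sum_le_sum fun s _ => (le_abs_self _).trans ?_
        rw [abs_mul]
        refine mul_le_mul_of_nonneg_left ?_ (abs_nonneg _)
        rw [abs_le]
        constructor <;> linarith [(hF s).1, (hF s).2]
    _ ≤ _ := by
        rw [← Finset.sum_mul, mul_comm]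
        rcases isEmpty_or_nonempty (∀ i, S i) with he | ⟨⟨s⟩⟩
        · simp at hd1
        · exact mul_le_mul_of_nonneg_left (sum_abs_prod_sub_le ha hb ha1 hb1 A)
            (by linarith [(hF s).1, (hF s).2])

end Coupling

section Discrepancy

variable {K N : ℕ} {S : Fin K → Type*} [∀ k, Fintype (S k)] [∀ k, DecidableEq (S k)]

/-- The `ℓ¹`-distance between the laws of the current state of arm `k` under two parameters. -/
def stateDist (θ ϑ : Params S) (k : Fin K) (s : S k) (n : ℕ+) : ℝ :=
  ∑ x, |stateProb θ k s n x - stateProb ϑ k s n x|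

/-- The sum of the distances of the laws of the observed states when the arms in `A` are pulled. -/
def discrepancy (θ ϑ : Params S) (ξ : Meta S) (A : Action K N) : ℝ :=
  ∑ k ∈ A.1, stateDist θ ϑ k (ξ.last k) (ξ.age k)

lemma stateDist_comm (θ ϑ : Params S) (k : Fin K) (s : S k) (n : ℕ+) :
    stateDist θ ϑ k s n = stateDist ϑ θ k s n := by simp only [stateDist, abs_sub_comm]

lemma stateDist_le_two (θ ϑ : Params S) (k : Fin K) (s : S k) (n : ℕ+) :
    stateDist θ ϑ k s n ≤ 2 := by
  have : stateDist θ ϑ k s n ≤ ∑ x, (stateProb θ k s n x + stateProb ϑ k s n x) := by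
    refine Finset.sum_le_sum fun x _ => (abs_sub _ _).trans (le_of_eq ?_)
    rw [abs_of_nonneg (stateProb_nonneg ..), abs_of_nonneg (stateProb_nonneg ..)]
  rw [Finset.sum_add_distrib, sum_stateProb, sum_stateProb] at this
  linarith

lemma discrepancy_le (θ ϑ : Params S) (ξ : Meta S) (A : Action K N) :
    discrepancy θ ϑ ξ A ≤ 2 * N := by
  have := Finset.sum_le_card_nsmul A.1 (fun k => stateDist θ ϑ k (ξ.last k) (ξ.age k)) 2
    fun k _ => stateDist_le_two ..
  rw [A.2, nsmul_eq_mul] at this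
  rw [discrepancy]; linarith

lemma Meta.next_congr (ξ : Meta S) (A : Action K N) {s s' : ∀ k, S k}
    (h : ∀ k ∈ A.1, s k = s' k) : ξ.next A s = ξ.next A s' := by
  simp only [Meta.next, Meta.mk.injEq, and_true]
  funext k
  split_ifs with hk
  exacts [h k hk, rfl]

lemma metaExp_sub_le_discrepancy (θ ϑ : Params S) (ξ : Meta S) (A : Action K N) {g : Meta S → ℝ}
    {H : ℝ} (hg : ∀ ξ, g ξ ∈ Set.Icc 0 H) :
    metaExp ϑ ξ A g - metaExp θ ξ A g ≤ H / 2 * discrepancy θ ϑ ξ A := by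
  have := sum_prod_mul_sub_le (a := fun k x => stateProb ϑ k (ξ.last k) (ξ.age k) x)
    (b := fun k x => stateProb θ k (ξ.last k) (ξ.age k) x) (fun _ _ => stateProb_nonneg ..)
    (fun _ _ => stateProb_nonneg ..) (fun _ => sum_stateProb ..) (fun _ => sum_stateProb ..) A.1
    (F := fun s => g (ξ.next A s)) (fun s => hg _)
    (fun s s' h => congrArg g (ξ.next_congr A h))
  refine this.trans (le_of_eq ?_)
  rw [discrepancy]
  simp only [stateDist_comm θ ϑ]
  rfl

lemma metaReward_sub_le_discrepancy {r : ∀ k, S k → ℝ} (hr : ∀ k s, r k s ∈ Set.Icc (0 : ℝ) 1)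
    (θ ϑ : Params S) (ξ : Meta S) (A : Action K N) :
    metaReward r ϑ ξ A - metaReward r θ ξ A ≤ 1 / 2 * discrepancy θ ϑ ξ A := by
  rw [metaReward, metaReward, ← Finset.sum_sub_distrib, discrepancy, Finset.mul_sum]
  refine Finset.sum_le_sum fun k _ => ?_
  have h : ∑ s, stateProb ϑ k (ξ.last k) (ξ.age k) s * r k s -
      ∑ s, stateProb θ k (ξ.last k) (ξ.age k) s * r k s =
      ∑ s, (stateProb ϑ k (ξ.last k) (ξ.age k) s - stateProb θ k (ξ.last k) (ξ.age k) s) *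
        (r k s - 1 / 2) := by
    simp only [sub_mul, mul_sub, Finset.sum_sub_distrib, ← Finset.sum_mul, sum_stateProb]
    ring
  rw [h, stateDist, Finset.mul_sum]
  refine Finset.sum_le_sum fun x _ => (le_abs_self _).trans ?_
  rw [abs_mul, mul_comm, abs_sub_comm (stateProb θ ..)]
  refine mul_le_mul_of_nonneg_right ?_ (abs_nonneg _)
  rw [abs_le]
  constructor <;> linarith [(hr k x).1, (hr k x).2]

/-- One round in the system `θ` under the policy for `ϑ`: a subsolution `g` of the Bellman equation
for `ϑ` is almost one for `θ`. -/
lemma gain_le_of_subsolution {r : ∀ k, S k → ℝ} (hr : ∀ k s, r k s ∈ Set.Icc (0 : ℝ) 1)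
    (θ ϑ : Params S) (ξ : Meta S) (A : Action K N) {J H : ℝ} {g : Meta S → ℝ}
    (hg : ∀ ξ, g ξ ∈ Set.Icc 0 H) (hsub : J + g ξ ≤ metaReward r ϑ ξ A + metaExp ϑ ξ A g) :
    J ≤ metaReward r θ ξ A + (metaExp θ ξ A g - g ξ) + (H + 1) / 2 * discrepancy θ ϑ ξ A := by
  have h1 := metaExp_sub_le_discrepancy θ ϑ ξ A hg
  have h2 := metaReward_sub_le_discrepancy hr θ ϑ ξ A
  linarith

end Discrepancy

/-! ### Mixing of the passive chains -/

section Mixing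

variable {α : Type*} [Fintype α] [DecidableEq α]

lemma sum_abs_vecMul_le {P : Matrix α α ℝ} (hP : P ∈ Matrix.rowStochastic ℝ α) (x : α → ℝ) :
    ∑ s', |∑ s, x s * P s s'| ≤ ∑ s, |x s| := by
  calc ∑ s', |∑ s, x s * P s s'| ≤ ∑ s', ∑ s, |x s| * P s s' := by
        refine Finset.sum_le_sum fun s' _ => (Finset.abs_sum_le_sum_abs _ _).trans (le_of_eq ?_)
        refine Finset.sum_congr rfl fun s _ => ?_
        rw [abs_mul, abs_of_nonneg (Matrix.nonneg_of_mem_rowStochastic hP)]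
    _ = ∑ s, |x s| := by
        rw [Finset.sum_comm]
        refine Finset.sum_congr rfl fun s _ => ?_
        rw [← Finset.mul_sum, Matrix.sum_row_of_mem_rowStochastic hP, mul_one]

lemma sum_abs_vecMul_le_of_mixing {P : Matrix α α ℝ} {p : α → ℝ} {ε : ℝ}
    (h : ∀ s, ∑ s', |P s s' - p s'| ≤ ε) {x : α → ℝ} (hx : ∑ s, x s = 0) :
    ∑ s', |∑ s, x s * P s s'| ≤ ε * ∑ s, |x s| := by
  calc ∑ s', |∑ s, x s * P s s'| ≤ ∑ s', ∑ s, |x s| * |P s s' - p s'| := by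
        refine Finset.sum_le_sum fun s' _ => ?_
        have : ∑ s, x s * P s s' = ∑ s, x s * (P s s' - p s') := by
          simp only [mul_sub, Finset.sum_sub_distrib, ← Finset.sum_mul, hx, zero_mul, sub_zero]
        rw [this]
        refine (Finset.abs_sum_le_sum_abs _ _).trans (le_of_eq ?_)
        simp only [abs_mul]
    _ ≤ ∑ s, |x s| * ε := by
        rw [Finset.sum_comm]
        refine Finset.sum_le_sum fun s _ => ?_
        rw [← Finset.mul_sum]
        exact mul_le_mul_of_nonneg_left (h s) (abs_nonneg _)
    _ = _ := by rw [← Finset.sum_mul, mul_comm]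

lemma IsStationary.pow {P : Matrix α α ℝ} {p : α → ℝ} (hp : IsStationary P p) (n : ℕ) (s' : α) :
    ∑ s, p s * (P ^ n) s s' = p s' := by
  induction n generalizing s' with
  | zero => simp [Matrix.one_apply]
  | succ n ih =>
    simp only [pow_succ, Matrix.mul_apply, Finset.mul_sum, ← mul_assoc]
    rw [Finset.sum_comm]
    simp only [← Finset.sum_mul, ih]
    exact hp.2.2 s'

/-- Geometric ergodicity from the mixing time. -/
lemma sum_abs_pow_sub_le {P : Matrix α α ℝ} (hP : P ∈ Matrix.rowStochastic ℝ α) {p : α → ℝ}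
    (hp : IsStationary P p) {t : ℕ} {ε : ℝ} (hε : 0 ≤ ε)
    (hmix : ∀ s, ∑ s', |(P ^ t) s s' - p s'| ≤ ε)
    {x : α → ℝ} (hx : ∀ s, 0 ≤ x s) (hx1 : ∑ s, x s = 1) (j i : ℕ) :
    ∑ s', |∑ s, x s * (P ^ (t * j + i)) s s' - p s'| ≤ 2 * ε ^ j := by
  have hy : ∑ s, (x s - p s) = 0 := by rw [Finset.sum_sub_distrib, hx1, hp.2.1, sub_self]
  have h2 : ∑ s, |x s - p s| ≤ 2 := by
    have : ∑ s, |x s - p s| ≤ ∑ s, (x s + p s) := by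
      refine Finset.sum_le_sum fun s _ => (abs_sub _ _).trans (le_of_eq ?_)
      rw [abs_of_nonneg (hx s), abs_of_nonneg (hp.1 s)]
    rw [Finset.sum_add_distrib, hx1, hp.2.1] at this
    linarith
  have hmul : ∀ (z : α → ℝ) (A B : Matrix α α ℝ) s', ∑ s, z s * (A * B) s s' =
      ∑ s, (∑ u, z u * A u s) * B s s' := by
    intro z A B s'
    simp only [Matrix.mul_apply, Finset.mul_sum, Finset.sum_mul, ← mul_assoc]
    exact Finset.sum_comm
  have h0 : ∀ j, ∑ s', ∑ s, (x s - p s) * (P ^ (t * j)) s s' = 0 := by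
    intro j
    rw [Finset.sum_comm]
    simp only [← Finset.mul_sum, Matrix.sum_row_of_mem_rowStochastic (pow_mem hP _), mul_one, hy]
  have hj : ∀ j, ∑ s', |∑ s, (x s - p s) * (P ^ (t * j)) s s'| ≤ 2 * ε ^ j := by
    intro j
    induction j with
    | zero => simpa [Matrix.one_apply] using h2
    | succ j ih =>
      have h := sum_abs_vecMul_le_of_mixing hmix (h0 j)
      rw [show t * (j + 1) = t * j + t by ring, pow_add]
      simp only [hmul]
      refine h.trans ?_
      rw [pow_succ]
      nlinarith
  have : ∀ s', ∑ s, x s * (P ^ (t * j + i)) s s' - p s' =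
      ∑ s, (∑ u, (x u - p u) * (P ^ (t * j)) u s) * (P ^ i) s s' := by
    intro s'
    rw [← hmul, ← pow_add]
    simp only [sub_mul, Finset.sum_sub_distrib, hp.pow]
  simp only [this]
  exact (sum_abs_vecMul_le (pow_mem hP i) _).trans (hj j)

end Mixing

section MixingArms

variable {K N : ℕ} {S : Fin K → Type*} [∀ k, Fintype (S k)] [∀ k, DecidableEq (S k)]

/-- The passive chains have mixed up to `1 / 4` in at most `τ` steps. -/
def MixesWithin (τ : ℕ) (θ : Params S) : Prop :=
  ∀ k, ∃ t p, 1 ≤ t ∧ t ≤ τ ∧ IsStationary (Params.passive θ k) p ∧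
    ∀ s, ∑ s', |(Params.passive θ k ^ t) s s' - p s'| ≤ 1 / 4

lemma mixesWithin_of_mixingTime_le {τ : ℕ} {θ : Params S}
    (h : ∀ k, mixingTime (Params.passive θ k) (1 / 4) ≤ τ) : MixesWithin τ θ := by
  intro k
  have hk := h k
  rw [mixingTime] at hk
  set A : Set ℕ∞ := {m : ℕ∞ | ∃ t : ℕ, m = t ∧ 1 ≤ t ∧
    ∃ p, IsStationary (Params.passive θ k) p ∧
      ∀ s, ∑ s', |(Params.passive θ k ^ t) s s' - p s'| ≤ 1 / 4} with hA
  have hne : A.Nonempty := by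
    by_contra hne
    rw [Set.not_nonempty_iff_eq_empty] at hne
    rw [hne, sInf_empty, top_le_iff] at hk
    exact ENat.natCast_ne_top _ hk
  obtain ⟨t, ht, h1, p, hp, hm⟩ := csInf_mem hne
  refine ⟨t, p, h1, ?_, hp, hm⟩
  rw [ht] at hk
  exact_mod_cast hk

lemma active_mem (θ : Params S) (k : Fin K) : Params.active θ k ∈ Matrix.rowStochastic ℝ (S k) :=
  (θ.1 k).2

lemma passive_mem (θ : Params S) (k : Fin K) : Params.passive θ k ∈ Matrix.rowStochastic ℝ (S k) :=
  (θ.2 k).2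

/-- All the ages above the mixing time `τ log₂ T` give almost the same law. -/
lemma sum_abs_stateProb_sub_le {τ : ℕ} {θ : Params S} (h : MixesWithin τ θ) {T : ℕ} (hT : 2 ≤ T)
    (k : Fin K) (s : S k) {n n' : ℕ+} (hn : horizonMix τ T ≤ (n : ℕ))
    (hn' : horizonMix τ T ≤ (n' : ℕ)) :
    ∑ x, |stateProb θ k s n x - stateProb θ k s n' x| ≤ 16 / (T : ℝ) ^ 2 := by
  obtain ⟨t, p, ht, htτ, hp, hm⟩ := h k
  have hT0 : (0 : ℝ) < T := by positivity
  have key : ∀ n : ℕ+, horizonMix τ T ≤ (n : ℕ) →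
      ∑ x, |stateProb θ k s n x - p x| ≤ 8 / (T : ℝ) ^ 2 := by
    intro n hn
    have hlog : 0 ≤ Real.logb 2 T := Real.logb_nonneg (by norm_num) (by exact_mod_cast (by omega))
    have hdm := Nat.div_add_mod ((n : ℕ) - 1) t
    have hlt := Nat.mod_lt ((n : ℕ) - 1) ht
    set j := ((n : ℕ) - 1) / t with hj
    have hpos := n.pos
    have h1 : (n : ℕ) ≤ t * (j + 1) := by rw [mul_add, mul_one]; omega
    have h2 : Real.logb 2 T ≤ (j + 1 : ℕ) := by
      have h3 : Real.logb 2 T * t ≤ (t : ℝ) * (j + 1 : ℕ) := by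
        calc Real.logb 2 T * t ≤ Real.logb 2 T * τ := by gcongr
          _ ≤ (n : ℕ) := hn
          _ ≤ _ := by exact_mod_cast h1
      have ht0 : (0 : ℝ) < t := by exact_mod_cast ht
      nlinarith
    have h3 : (T : ℝ) ^ 2 ≤ 4 ^ (j + 1) := by
      rw [Real.logb_le_iff_le_rpow (by norm_num) hT0, Real.rpow_natCast] at h2
      calc (T : ℝ) ^ 2 ≤ (2 ^ (j + 1)) ^ 2 := by gcongr
        _ = 4 ^ (j + 1) := by rw [← pow_mul, mul_comm, pow_mul]; norm_num
    have h4 := sum_abs_pow_sub_le (passive_mem θ k) hp (by norm_num) hm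
      (x := fun u => Params.active θ k s u)
      (fun u => Matrix.nonneg_of_mem_rowStochastic (active_mem θ k))
      (Matrix.sum_row_of_mem_rowStochastic (active_mem θ k) s) j (((n : ℕ) - 1) % t)
    rw [hdm] at h4
    calc ∑ x, |stateProb θ k s n x - p x| ≤ 2 * (1 / 4) ^ j := h4
      _ = 8 / 4 ^ (j + 1) := by rw [pow_succ, one_div, inv_pow]; field_simp; norm_num
      _ ≤ _ := by gcongr
  calc ∑ x, |stateProb θ k s n x - stateProb θ k s n' x|
      ≤ ∑ x, (|stateProb θ k s n x - p x| + |stateProb θ k s n' x - p x|) :=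
        Finset.sum_le_sum fun x _ => by
          rw [abs_sub_comm (stateProb θ k s n' x)]; exact abs_sub_le _ _ _
    _ ≤ 8 / (T : ℝ) ^ 2 + 8 / (T : ℝ) ^ 2 := by
        rw [Finset.sum_add_distrib]; exact add_le_add (key n hn) (key n' hn')
    _ = _ := by ring

/-- The laws of the observations that belong to the same counter are almost equal. -/
lemma sum_abs_stateProb_sub_le_of_cell {τ : ℕ} {θ : Params S} (h : MixesWithin τ θ) {T : ℕ}
    (hT : 2 ≤ T) {m : ℕ} (hm : ⌈horizonMix τ T⌉₊ = m + 1) (k : Fin K) (s : S k) {n n' : ℕ+}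
    (hnn : min ((n : ℕ) - 1) m = min ((n' : ℕ) - 1) m) :
    ∑ x, |stateProb θ k s n x - stateProb θ k s n' x| ≤ 16 / (T : ℝ) ^ 2 := by
  have hp := n.pos
  have hp' := n'.pos
  by_cases hn : (n : ℕ) = n'
  · rw [PNat.coe_inj.1 hn]
    simp only [sub_self, abs_zero, Finset.sum_const_zero]
    positivity
  · refine sum_abs_stateProb_sub_le h hT k s ?_ ?_ <;>
    · refine (Nat.le_ceil _).trans ?_
      rw [hm]
      exact_mod_cast (by omega)

lemma centeredSum_sub {m : ℕ} (θ ϑ : Params S) (ζ : Cell S m) (f : S ζ.1.1 → ℝ)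
    (hist : List (Round S N)) :
    centeredSum ϑ ζ f hist - centeredSum θ ζ f hist =
      (hist.map fun z => if ζ ∈ z.cells m then
        ∑ x, (stateProb θ ζ.1.1 (z.pre.last ζ.1.1) (z.pre.age ζ.1.1) x -
          stateProb ϑ ζ.1.1 (z.pre.last ζ.1.1) (z.pre.age ζ.1.1) x) * f x else 0).sum := by
  induction hist using List.reverseRecOn with
  | nil => simp [centeredSum]
  | append_singleton l z ih =>
    simp only [centeredSum_append, List.map_append, List.sum_append, ← ih, List.map_singleton,
      List.sum_singleton]
    split_ifs
    · simp only [sub_mul, Finset.sum_sub_distrib]; ring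
    · ring

/-- If the observations deviate little from their expectations under both parameters, then the two
laws are close. -/
lemma visits_mul_stateDist_le {m : ℕ} {θ ϑ : Params S} {ζ : Cell S m} {n : ℕ+} {ε : ℝ}
    (hθ : ∀ n' : ℕ+, min ((n' : ℕ) - 1) m = ζ.2 →
      ∑ x, |stateProb θ ζ.1.1 ζ.1.2 n x - stateProb θ ζ.1.1 ζ.1.2 n' x| ≤ ε)
    (hϑ : ∀ n' : ℕ+, min ((n' : ℕ) - 1) m = ζ.2 →
      ∑ x, |stateProb ϑ ζ.1.1 ζ.1.2 n x - stateProb ϑ ζ.1.1 ζ.1.2 n' x| ≤ ε)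
    (hist : List (Round S N)) :
    visits hist ζ * stateDist θ ϑ ζ.1.1 ζ.1.2 n ≤
      deviation θ ζ hist + deviation ϑ ζ hist + visits hist ζ * (2 * ε) := by
  set d : S ζ.1.1 → ℝ := fun x => stateProb θ ζ.1.1 ζ.1.2 n x - stateProb ϑ ζ.1.1 ζ.1.2 n x
  have key : ∑ x, |visits hist ζ * d x -
      (centeredSum ϑ ζ (fun y => if y = x then 1 else 0) hist -
        centeredSum θ ζ (fun y => if y = x then 1 else 0) hist)| ≤ visits hist ζ * (2 * ε) := by
    simp only [centeredSum_sub]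
    induction hist using List.reverseRecOn with
    | nil => simp [visits]
    | append_singleton l z ih =>
      simp only [visits_append, List.map_append, List.sum_append, List.map_singleton,
        List.sum_singleton]
      by_cases hz : ζ ∈ z.cells m
      · simp only [hz, if_true]
        obtain ⟨h1, h2⟩ := mem_cells.1 hz
        have hl : z.pre.last ζ.1.1 = ζ.1.2 := by
          have := congrArg (fun c : Cell S m => c.1) h2
          simp only [cellOf] at this
          exact eq_of_heq (Sigma.ext_iff.1 this).2
        have ha : min ((z.pre.age ζ.1.1 : ℕ) - 1) m = ζ.2 :=
          congrArg (fun c : Cell S m => (c.2 : ℕ)) h2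
        rw [hl]
        push_cast
        rw [add_mul, one_mul]
        have h3 : ∑ x, |d x - (stateProb θ ζ.1.1 ζ.1.2 (z.pre.age ζ.1.1) x -
            stateProb ϑ ζ.1.1 ζ.1.2 (z.pre.age ζ.1.1) x)| ≤ 2 * ε := by
          calc _ ≤ ∑ x, (|stateProb θ ζ.1.1 ζ.1.2 n x -
                stateProb θ ζ.1.1 ζ.1.2 (z.pre.age ζ.1.1) x| +
              |stateProb ϑ ζ.1.1 ζ.1.2 n x - stateProb ϑ ζ.1.1 ζ.1.2 (z.pre.age ζ.1.1) x|) := by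
                refine Finset.sum_le_sum fun x _ => ?_
                refine le_trans (le_of_eq (congrArg _ ?_)) (abs_sub _ _)
                simp only [d]; ring
            _ ≤ ε + ε := by rw [Finset.sum_add_distrib]; exact add_le_add (hθ _ ha) (hϑ _ ha)
            _ = _ := by ring
        refine le_trans ?_ (add_le_add ih h3)
        rw [← Finset.sum_add_distrib]
        refine Finset.sum_le_sum fun x _ => le_trans (le_of_eq (congrArg _ ?_)) (abs_add_le _ _)
        simp only [mul_ite, mul_one, mul_zero, Finset.sum_ite_eq', Finset.mem_univ, if_true]
        ring
      · simpa only [hz, if_false, add_zero] using ih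
  calc visits hist ζ * stateDist θ ϑ ζ.1.1 ζ.1.2 n
      = ∑ x, |visits hist ζ * d x| := by
        rw [stateDist, Finset.mul_sum]
        refine Finset.sum_congr rfl fun x _ => ?_
        rw [abs_mul, Nat.abs_cast]
    _ ≤ ∑ x, ((|centeredSum θ ζ (fun y => if y = x then 1 else 0) hist| +
        |centeredSum ϑ ζ (fun y => if y = x then 1 else 0) hist|) + |visits hist ζ * d x -
      (centeredSum ϑ ζ (fun y => if y = x then 1 else 0) hist -
        centeredSum θ ζ (fun y => if y = x then 1 else 0) hist)|) := by
        refine Finset.sum_le_sum fun x _ => ?_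
        have h1 := abs_sub (centeredSum ϑ ζ (fun y => if y = x then 1 else 0) hist)
          (centeredSum θ ζ (fun y => if y = x then 1 else 0) hist)
        have h2 := abs_sub_abs_le_abs_sub (visits hist ζ * d x)
          (centeredSum ϑ ζ (fun y => if y = x then 1 else 0) hist -
            centeredSum θ ζ (fun y => if y = x then 1 else 0) hist)
        linarith
    _ ≤ _ := by
        rw [Finset.sum_add_distrib, Finset.sum_add_distrib]
        exact add_le_add le_rfl key

end MixingArms

/-! ### The cumulative discrepancy -/

section Potential

variable {K N : ℕ} {S : Fin K → Type*} [∀ k, Fintype (S k)] [∀ k, DecidableEq (S k)]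
variable {Q : Measure (Params S)} {μ : Params S → Policy S N} {Tmix : ℝ} {ξ₁ : Meta S}

lemma measurable_of_policy (hμ : ∀ (ξ : Meta S) (A : Action K N), MeasurableSet {θ | μ θ ξ = A})
    {F : World S N → Action K N → Params S → ℝ} (hF : ∀ w A, Measurable (F w A)) :
    Measurable fun x : World S N × Params S => F x.1 (μ x.2 x.1.cur) x.2 :=
  measurable_from_prod_countable_right fun w => measurable_policy_apply hμ w.cur (hF w)

/-- A function of the recorded rounds grows by its expected increments. -/
lemma sum_integral_increment_le [IsProbabilityMeasure Q]
    (hμ : ∀ (ξ : Meta S) (A : Action K N), MeasurableSet {θ | μ θ ξ = A}) (θ : Params S)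
    {Ψ : List (Round S N) → ℝ} {C : ℕ → ℝ} (hΨ : ∀ hist, |Ψ hist| ≤ C hist.length) (hΨ0 : Ψ [] = 0)
    {W : World S N → Action K N → ℝ} {B : ℝ} (hWB : ∀ w A, |W w A| ≤ B)
    (hW : ∀ w A, Ψ w.hist + W w A ≤ ∑ s, armsProb θ w.cur s * Ψ (w.obs A s).hist) (T : ℕ) :
    ∑ t ∈ Finset.range T, ∫ x, W x.1 (μ x.2 x.1.cur) ∂(obsLaw Q μ Tmix ξ₁ θ t) ≤
      ∫ x, Ψ x.1.hist ∂(obsLaw Q μ Tmix ξ₁ θ T) := by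
  have hG : MeasurableSet (Set.univ : Set (Params S)) := MeasurableSet.univ
  have hQ : ∀ᵐ ϑ ∂Q, ϑ ∈ (Set.univ : Set (Params S)) := by simp
  have hmW : Measurable fun x : World S N × Params S => W x.1 (μ x.2 x.1.cur) :=
    measurable_of_policy hμ (F := fun w A _ => W w A) fun w A => measurable_const
  have hiW : ∀ t, Integrable (fun x => W x.1 (μ x.2 x.1.cur)) (obsLaw Q μ Tmix ξ₁ θ t) := fun t =>
    integrable_obsLaw hμ hG hQ θ t hmW (C := B) fun x _ => hWB _ _
  have hiΨ : ∀ t, Integrable (fun x => Ψ x.1.hist) (obsLaw Q μ Tmix ξ₁ θ t) := fun t =>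
    integrable_obsLaw hμ hG hQ θ t (measurable_hist (f := Ψ)) (C := C t) fun x hx => by
      have := hΨ x.1.hist
      rwa [hx.1.length_hist] at this
  induction T with
  | zero =>
    rw [integral_obsLaw_zero _ (measurable_hist (f := Ψ))]
    simp [hΨ0]
  | succ T ih =>
    rw [Finset.sum_range_succ]
    have hi : Integrable (fun x => -Ψ x.1.hist - W x.1 (μ x.2 x.1.cur))
        (obsLaw Q μ Tmix ξ₁ θ T) := (hiΨ T).neg.sub (hiW T)
    have h := integral_obsLaw_succ_le (ξ₁ := ξ₁) (Tmix := Tmix) hμ hG hQ θ T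
      (F := fun x => -Ψ x.1.hist) (F₀ := fun x => -Ψ x.1.hist - W x.1 (μ x.2 x.1.cur))
      (measurable_hist (f := fun l => -Ψ l)) (C := C (T + 1))
      (fun x hx => by
        have := hΨ x.1.hist
        rwa [hx.1.length_hist, ← abs_neg] at this)
      hi (fun x s => -Ψ (x.1.obs (μ x.2 x.1.cur) s).hist)
      (fun x _ s y _ hs => by rw [hist_of_isSucc hs])
      (fun x _ => by
        have := hW x.1 (μ x.2 x.1.cur)
        simp only [mul_neg, Finset.sum_neg_distrib]
        linarith)
    have hn : Integrable (fun x => -Ψ x.1.hist) (obsLaw Q μ Tmix ξ₁ θ T) := (hiΨ T).neg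
    rw [integral_sub hn (hiW T), integral_neg, integral_neg] at h
    linarith

lemma totalReward_mem_Icc {r : ∀ k, S k → ℝ} (hr : ∀ k s, r k s ∈ Set.Icc (0 : ℝ) 1)
    (hist : List (Round S N)) : totalReward r hist ∈ Set.Icc (0 : ℝ) (N * hist.length) := by
  induction hist using List.reverseRecOn with
  | nil => simp [totalReward]
  | append_singleton l z ih =>
    have h0 : 0 ≤ ∑ k ∈ z.act.1, r k (z.post.last k) := Finset.sum_nonneg fun k _ => (hr k _).1
    have h1 : ∑ k ∈ z.act.1, r k (z.post.last k) ≤ N := by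
      have := Finset.sum_le_card_nsmul z.act.1 (fun k => r k (z.post.last k)) 1
        fun k _ => (hr k _).2
      simpa [z.act.2] using this
    have : totalReward r (l ++ [z]) = totalReward r l + ∑ k ∈ z.act.1, r k (z.post.last k) := by
      simp [totalReward]
    rw [this]
    constructor
    · linarith [ih.1]
    · simp only [List.length_append, List.length_singleton]
      push_cast
      linarith [ih.2]

lemma integral_totalReward_eq [IsProbabilityMeasure Q] {r : ∀ k, S k → ℝ}
    (hr : ∀ k s, r k s ∈ Set.Icc (0 : ℝ) 1)
    (hμ : ∀ (ξ : Meta S) (A : Action K N), MeasurableSet {θ | μ θ ξ = A}) (θ : Params S) (T : ℕ) :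
    ∫ x, totalReward r x.1.hist ∂(law Q μ Tmix ξ₁ θ T) =
      ∫ x, totalReward r x.1.hist ∂(obsLaw Q μ Tmix ξ₁ θ T) := by
  rw [integral_eq_lintegral_of_nonneg_ae (ae_of_all _ fun x => (totalReward_mem_Icc hr _).1)
      (measurable_hist (f := totalReward r)).aestronglyMeasurable,
    integral_eq_lintegral_of_nonneg_ae (ae_of_all _ fun x => (totalReward_mem_Icc hr _).1)
      (measurable_hist (f := totalReward r)).aestronglyMeasurable,
    lintegral_law_hist hμ θ T fun l => ENNReal.ofReal (totalReward r l)]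

/-- The expected rewards, given the meta-states. -/
lemma sum_integral_metaReward_le [IsProbabilityMeasure Q] {r : ∀ k, S k → ℝ}
    (hr : ∀ k s, r k s ∈ Set.Icc (0 : ℝ) 1)
    (hμ : ∀ (ξ : Meta S) (A : Action K N), MeasurableSet {θ | μ θ ξ = A}) (θ : Params S) (T : ℕ) :
    ∑ t ∈ Finset.range T, ∫ x, metaReward r θ x.1.cur (μ x.2 x.1.cur)
      ∂(obsLaw Q μ Tmix ξ₁ θ t) ≤ ∫ x, totalReward r x.1.hist ∂(law Q μ Tmix ξ₁ θ T) := by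
  rw [integral_totalReward_eq hr hμ]
  refine sum_integral_increment_le hμ θ (Ψ := totalReward r) (C := fun n => N * n) (B := N)
    (W := fun w A => metaReward r θ w.cur A) (fun hist => ?_) rfl (fun w A => ?_)
    (fun w A => le_of_eq ?_) T
  · rw [abs_of_nonneg (totalReward_mem_Icc hr _).1]; exact (totalReward_mem_Icc hr _).2
  · rw [abs_of_nonneg (metaReward_mem_Icc hr ..).1]; exact (metaReward_mem_Icc hr ..).2
  · have hh : ∀ s, totalReward r (w.obs A s).hist =
        totalReward r w.hist + ∑ k ∈ A.1, r k (s k) := by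
      intro s
      have : (w.obs A s).hist = w.hist ++ [⟨w.cur, A, w.cur.next A s⟩] := rfl
      rw [this]
      simp only [totalReward, List.map_append, List.sum_append, List.map_singleton,
        List.sum_singleton]
      congr 1
      refine Finset.sum_congr rfl fun k hk => ?_
      simp [Meta.next, hk]
    simp only [hh, mul_add, Finset.sum_add_distrib, ← Finset.sum_mul, sum_armsProb, one_mul]
    rw [metaReward_eq_sum_armsProb]

/-- The sum of the confidence widths of the arms in `A`, up to a constant. -/
def visitWidth (m : ℕ) (c : Fin K → ℝ) (hist : List (Round S N)) (ξ : Meta S) (A : Action K N) :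
    ℝ :=
  ∑ k ∈ A.1, c k / √(max 1 (visits hist (cellOf m ξ k) : ℝ))

lemma visitWidth_nonneg {m : ℕ} {c : Fin K → ℝ} (hc : ∀ k, 0 ≤ c k) (hist : List (Round S N))
    (ξ : Meta S) (A : Action K N) : 0 ≤ visitWidth m c hist ξ A :=
  Finset.sum_nonneg fun k _ => div_nonneg (hc k) (Real.sqrt_nonneg _)

lemma visitWidth_le {m : ℕ} {c : Fin K → ℝ} (hc : ∀ k, 0 ≤ c k) (hist : List (Round S N))
    (ξ : Meta S) (A : Action K N) : visitWidth m c hist ξ A ≤ ∑ k, c k := by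
  refine (Finset.sum_le_sum fun k _ => ?_).trans
    (Finset.sum_le_univ_sum_of_nonneg fun k => hc k)
  exact div_le_self (hc k) (Real.one_le_sqrt.2 (le_max_left _ _))

lemma sqrt_succ_sub_ge (v : ℕ) : 2 / 5 / √(max 1 (v : ℝ)) ≤ √((v + 1 : ℕ) : ℝ) - √(v : ℝ) := by
  rcases Nat.eq_zero_or_pos v with rfl | hv
  · norm_num
  · have hv1 : (1 : ℝ) ≤ v := by exact_mod_cast hv
    rw [max_eq_right hv1]
    push_cast
    have h0 : 0 < √(v : ℝ) := Real.sqrt_pos.2 (by linarith)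
    have h1 : √((v : ℝ) + 1) ≤ 3 / 2 * √(v : ℝ) := by
      rw [Real.sqrt_le_left (by positivity), mul_pow, Real.sq_sqrt (by linarith)]
      linarith
    have h2 : (√((v : ℝ) + 1) - √(v : ℝ)) * (√((v : ℝ) + 1) + √(v : ℝ)) = 1 := by
      rw [mul_comm, ← sq_sub_sq, Real.sq_sqrt (by linarith), Real.sq_sqrt (by linarith)]; ring
    have h3 : 0 ≤ √((v : ℝ) + 1) - √(v : ℝ) := by
      have := Real.sqrt_le_sqrt (show (v : ℝ) ≤ v + 1 by linarith)
      linarith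
    rw [div_le_iff₀ h0]
    nlinarith

/-- A potential that grows by at least the confidence widths. -/
def visitPotential (m : ℕ) (c : Fin K → ℝ) (hist : List (Round S N)) : ℝ :=
  ∑ ζ : Cell S m, c ζ.1.1 * √(visits hist ζ : ℝ)

lemma visitPotential_append {m : ℕ} {c : Fin K → ℝ} (hc : ∀ k, 0 ≤ c k) (hist : List (Round S N))
    (z : Round S N) :
    visitPotential m c hist + 2 / 5 * visitWidth m c hist z.pre z.act ≤
      visitPotential m c (hist ++ [z]) := by
  have h : visitWidth m c hist z.pre z.act =
      ∑ ζ : Cell S m, if ζ ∈ z.cells m then c ζ.1.1 / √(max 1 (visits hist ζ : ℝ)) else 0 := by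
    rw [Finset.sum_ite_mem, Finset.univ_inter,
      sum_cells z fun ζ : Cell S m => c ζ.1.1 / √(max 1 (visits hist ζ : ℝ))]
    rfl
  rw [visitPotential, visitPotential, h, Finset.mul_sum, ← Finset.sum_add_distrib]
  refine Finset.sum_le_sum fun ζ _ => ?_
  rw [visits_append]
  split_ifs
  · have := mul_le_mul_of_nonneg_left (sqrt_succ_sub_ge (visits hist ζ)) (hc ζ.1.1)
    have e : c ζ.1.1 * (2 / 5 / √(max 1 (visits hist ζ : ℝ))) =
      2 / 5 * (c ζ.1.1 / √(max 1 (visits hist ζ : ℝ))) := by ring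
    rw [e] at this
    linarith
  · simp

lemma visitPotential_mem {m : ℕ} {c : Fin K → ℝ} (hc : ∀ k, 0 ≤ c k) (hist : List (Round S N)) :
    visitPotential m c hist ∈
      Set.Icc 0 (√(∑ ζ : Cell S m, c ζ.1.1 ^ 2) * √(N * hist.length : ℝ)) := by
  constructor
  · exact Finset.sum_nonneg fun ζ _ => mul_nonneg (hc _) (Real.sqrt_nonneg _)
  · have h := Real.sum_mul_le_sqrt_mul_sqrt (Finset.univ : Finset (Cell S m)) (fun ζ => c ζ.1.1)
      (fun ζ => √(visits hist ζ : ℝ))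
    simp only [Real.sq_sqrt (Nat.cast_nonneg _)] at h
    rw [← Nat.cast_sum, sum_visits, Nat.cast_mul] at h
    exact h

lemma sum_integral_visitWidth_le [IsProbabilityMeasure Q]
    (hμ : ∀ (ξ : Meta S) (A : Action K N), MeasurableSet {θ | μ θ ξ = A}) {m : ℕ} {c : Fin K → ℝ}
    (hc : ∀ k, 0 ≤ c k) (θ : Params S) (T : ℕ) :
    ∑ t ∈ Finset.range T, ∫ x, visitWidth m c x.1.hist x.1.cur (μ x.2 x.1.cur)
      ∂(obsLaw Q μ Tmix ξ₁ θ t) ≤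
      5 / 2 * (√(∑ ζ : Cell S m, c ζ.1.1 ^ 2) * √(N * T : ℝ)) := by
  have h := sum_integral_increment_le (Q := Q) (Tmix := Tmix) (ξ₁ := ξ₁) hμ θ
    (Ψ := visitPotential m c)
    (C := fun n => √(∑ ζ : Cell S m, c ζ.1.1 ^ 2) * √(N * n : ℝ)) (B := 2 / 5 * ∑ k, c k)
    (W := fun w A => 2 / 5 * visitWidth m c w.hist w.cur A)
    (fun hist => by
      rw [abs_of_nonneg (visitPotential_mem hc hist).1]; exact (visitPotential_mem hc hist).2)
    (by simp [visitPotential, visits])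
    (fun w A => by
      rw [abs_of_nonneg (mul_nonneg (by norm_num) (visitWidth_nonneg hc ..))]
      exact mul_le_mul_of_nonneg_left (visitWidth_le hc ..) (by norm_num))
    (fun w A => by
      calc visitPotential m c w.hist + 2 / 5 * visitWidth m c w.hist w.cur A
          = ∑ s, armsProb θ w.cur s *
            (visitPotential m c w.hist + 2 / 5 * visitWidth m c w.hist w.cur A) := by
            rw [← Finset.sum_mul, sum_armsProb, one_mul]
        _ ≤ _ := Finset.sum_le_sum fun s _ => mul_le_mul_of_nonneg_left
            (visitPotential_append hc w.hist ⟨w.cur, A, w.cur.next A s⟩)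
            (armsProb_nonneg θ w.cur s)) T
  have hp := isProbabilityMeasure_obsLaw (Q := Q) (Tmix := Tmix) (ξ₁ := ξ₁) hμ θ T
  have h2 : ∫ x, visitPotential m c x.1.hist ∂(obsLaw Q μ Tmix ξ₁ θ T) ≤
      √(∑ ζ : Cell S m, c ζ.1.1 ^ 2) * √(N * T : ℝ) := by
    have h3 := integral_mono_of_nonneg (μ := obsLaw Q μ Tmix ξ₁ θ T)
      (f := fun x => visitPotential m c x.1.hist)
      (g := fun _ => √(∑ ζ : Cell S m, c ζ.1.1 ^ 2) * √(N * T : ℝ))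
      (ae_of_all _ fun x => (visitPotential_mem hc _).1) (integrable_const _)
      (by
        filter_upwards [ae_obsLaw (Q := Q) (ξ₁ := ξ₁) (Tmix := Tmix) hμ MeasurableSet.univ
          (by simp) θ T] with x hx
        have := (visitPotential_mem (m := m) hc x.1.hist).2
        rwa [hx.1.length_hist] at this)
    simpa using h3
  simp only [integral_const_mul, ← Finset.mul_sum] at h
  linarith

end Potential

section Discrepancy

variable {K N : ℕ} {S : Fin K → Type*} [∀ k, Fintype (S k)] [∀ k, DecidableEq (S k)]
variable {Q : Measure (Params S)} {μ : Params S → Policy S N} {ξ₁ : Meta S}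

/-- Two parameters that both explain the observations at the start of an episode are close at the
current counter. -/
lemma stateDist_le_of_not_isBad {τ : ℕ} {θ ϑ : Params S} (hθ : MixesWithin τ θ)
    (hϑ : MixesWithin τ ϑ) {T : ℕ} (hT : 2 ≤ T) {m : ℕ} (hm : ⌈horizonMix τ T⌉₊ = m + 1)
    {ρ : Fin K → ℝ} (hρ : ∀ k, 1 ≤ ρ k) {hist₀ hist : List (Round S N)}
    (hbθ : ¬ IsBad m ρ hist₀ θ) (hbϑ : ¬ IsBad m ρ hist₀ ϑ) (ξ : Meta S) (k : Fin K)
    (hv : visits hist (cellOf m ξ k) ≤ 2 * visits hist₀ (cellOf m ξ k)) :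
    stateDist θ ϑ k (ξ.last k) (ξ.age k) ≤
      2 * √2 * (ρ k / √(max 1 (visits hist (cellOf m ξ k) : ℝ))) + 32 / (T : ℝ) ^ 2 := by
  set ζ := cellOf m ξ k with hζ
  have hs2 : (1 : ℝ) ≤ √2 := Real.one_le_sqrt.2 (by norm_num)
  have hρ0 := hρ k
  have hT2 : 0 ≤ 32 / (T : ℝ) ^ 2 := by positivity
  rcases Nat.eq_zero_or_pos (visits hist₀ ζ) with h0 | h0
  · have h1 : visits hist ζ = 0 := by omega
    have h2 := stateDist_le_two θ ϑ k (ξ.last k) (ξ.age k)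
    rw [h1]
    simp only [Nat.cast_zero, zero_le_one, max_eq_left, Real.sqrt_one, div_one]
    nlinarith
  · have h1 := visits_mul_stateDist_le (θ := θ) (ϑ := ϑ) (ζ := ζ) (n := ξ.age k)
      (ε := 16 / (T : ℝ) ^ 2)
      (fun n' hn' => sum_abs_stateProb_sub_le_of_cell hθ hT hm _ _ (by rw [hn']; rfl))
      (fun n' hn' => sum_abs_stateProb_sub_le_of_cell hϑ hT hm _ _ (by rw [hn']; rfl)) hist₀
    have hb1 : deviation θ ζ hist₀ ≤ ρ k * √(visits hist₀ ζ : ℝ) := by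
      by_contra h; exact hbθ ⟨ζ, not_le.1 h⟩
    have hb2 : deviation ϑ ζ hist₀ ≤ ρ k * √(visits hist₀ ζ : ℝ) := by
      by_contra h; exact hbϑ ⟨ζ, not_le.1 h⟩
    change visits hist₀ ζ * stateDist θ ϑ k (ξ.last k) (ξ.age k) ≤ _ at h1
    set v₀ : ℝ := (visits hist₀ ζ : ℝ) with hv₀
    set v : ℝ := (visits hist ζ : ℝ) with hv'
    have hv1 : (1 : ℝ) ≤ v₀ := by rw [hv₀]; exact_mod_cast h0
    have hvv : v ≤ 2 * v₀ := by rw [hv₀, hv']; exact_mod_cast hv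
    set d := stateDist θ ϑ k (ξ.last k) (ξ.age k)
    have hsv : 0 < √v₀ := Real.sqrt_pos.2 (by linarith)
    have hsq : √v₀ * √v₀ = v₀ := Real.mul_self_sqrt (by linarith)
    have h2 : d ≤ 2 * (ρ k / √v₀) + 32 / (T : ℝ) ^ 2 := by
      have e : v₀ * (2 * (ρ k / √v₀) + 32 / (T : ℝ) ^ 2) =
          ρ k * √v₀ + ρ k * √v₀ + v₀ * (2 * (16 / (T : ℝ) ^ 2)) := by
        have : v₀ * (2 * (ρ k / √v₀)) = 2 * (ρ k * √v₀) := by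
          calc v₀ * (2 * (ρ k / √v₀)) = √v₀ * √v₀ * (2 * (ρ k / √v₀)) := by rw [hsq]
            _ = _ := by field_simp
        rw [mul_add, this]; ring
      have : v₀ * d ≤ v₀ * (2 * (ρ k / √v₀) + 32 / (T : ℝ) ^ 2) := by rw [e]; linarith
      exact le_of_mul_le_mul_left this (by linarith)
    have h3 : √(max 1 v) ≤ √2 * √v₀ := by
      rw [← Real.sqrt_mul (by norm_num)]
      exact Real.sqrt_le_sqrt (max_le (by linarith) hvv)
    have h4 : ρ k / √v₀ ≤ √2 * (ρ k / √(max 1 v)) := by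
      have hm0 : 0 < √(max 1 v) := Real.sqrt_pos.2 (lt_max_of_lt_left one_pos)
      rw [← mul_div_assoc, div_le_div_iff₀ hsv hm0]
      nlinarith
    linarith

/-- The bound on the discrepancy between the true parameter and the parameter of the episode. -/
lemma discrepancy_le_of_validIn {τ : ℕ} {G : Set (Params S)} (hG : ∀ θ ∈ G, MixesWithin τ θ)
    {T : ℕ} (hT : 2 ≤ T) {m : ℕ} (hm : ⌈horizonMix τ T⌉₊ = m + 1) {ρ : Fin K → ℝ}
    (hρ : ∀ k, 1 ≤ ρ k) {θ : Params S} (hθ : θ ∈ G) {t : ℕ} {x : World S N × Params S}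
    (hx : ValidIn (horizonMix τ T) G t x) (A : Action K N) :
    discrepancy θ x.2 x.1.cur A ≤ 2 * √2 * visitWidth m ρ x.1.hist x.1.cur A +
      N * (32 / (T : ℝ) ^ 2) + 2 * N * (badInd m ρ (x.1.hist.take (x.1.start - 1)) θ +
        badInd m ρ (x.1.hist.take (x.1.start - 1)) x.2) := by
  have hρ0 : ∀ k, 0 ≤ ρ k := fun k => zero_le_one.trans (hρ k)
  have hw := visitWidth_nonneg (m := m) hρ0 x.1.hist x.1.cur A
  have hn1 : 0 ≤ (N : ℝ) * (32 / (T : ℝ) ^ 2) := by positivity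
  have hn2 : 0 ≤ 2 * √2 * visitWidth m ρ x.1.hist x.1.cur A := by positivity
  have hb1 := badInd_nonneg m ρ (x.1.hist.take (x.1.start - 1)) θ
  have hb2 := badInd_nonneg m ρ (x.1.hist.take (x.1.start - 1)) x.2
  have hN : (0 : ℝ) ≤ 2 * N := by positivity
  have hD := discrepancy_le θ x.2 x.1.cur A
  by_cases h1 : IsBad m ρ (x.1.hist.take (x.1.start - 1)) θ
  · have : badInd m ρ (x.1.hist.take (x.1.start - 1)) θ = 1 := if_pos h1
    rw [this]
    nlinarith [mul_nonneg hN hb2]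
  by_cases h2 : IsBad m ρ (x.1.hist.take (x.1.start - 1)) x.2
  · have : badInd m ρ (x.1.hist.take (x.1.start - 1)) x.2 = 1 := if_pos h2
    rw [this]
    nlinarith [mul_nonneg hN hb1]
  have hv : ∀ ζ : Cell S m, visits x.1.hist ζ ≤ 2 * visits (x.1.hist.take (x.1.start - 1)) ζ := by
    intro ζ
    have := hx.1.not_terminates
    rw [terminates_iff hm] at this
    push Not at this
    exact this.2 ζ
  have h3 : discrepancy θ x.2 x.1.cur A ≤
      2 * √2 * visitWidth m ρ x.1.hist x.1.cur A + N * (32 / (T : ℝ) ^ 2) := by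
    rw [discrepancy, visitWidth, Finset.mul_sum]
    refine (Finset.sum_le_sum fun k _ => stateDist_le_of_not_isBad (hG θ hθ) (hG _ hx.2) hT hm hρ
      h1 h2 x.1.cur k (hv _)).trans (le_of_eq ?_)
    rw [Finset.sum_add_distrib, Finset.sum_const, A.2, nsmul_eq_mul]
  nlinarith [mul_nonneg hN (add_nonneg hb1 hb2)]

end Discrepancy

/-! ### The regret in terms of the number of episodes and the discrepancy -/

section Core

variable {K N : ℕ} {S : Fin K → Type*} [∀ k, Fintype (S k)] [∀ k, DecidableEq (S k)]
variable {Q : Measure (Params S)} {μ : Params S → Policy S N} {ξ₁ : Meta S}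

/-- On valid worlds in the first round of an episode, all recorded rounds precede the episode. -/
lemma newInd_mul_take {w : World S N} (f : List (Round S N) → ℝ) :
    w.newInd * f (w.hist.take (w.start - 1)) = w.newInd * f w.hist := by
  rw [World.newInd]
  split_ifs with h
  · have h' : w.start = w.hist.length + 1 := h
    rw [h', Nat.add_sub_cancel, List.take_length]
  · simp

/-- The probability that the observations at the start of the current episode deviate. -/
lemma integral_badInd_take_le [IsProbabilityMeasure Q] {Tmix : ℝ}
    (hμ : ∀ (ξ : Meta S) (A : Action K N), MeasurableSet {θ | μ θ ξ = A}) (m : ℕ) (ρ : Fin K → ℝ)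
    (θ : Params S) {p : Params S → Params S} (hp : Measurable p) {t T : ℕ} (ht : t < T) :
    ∫ x, badInd m ρ (x.1.hist.take (x.1.start - 1)) (p x.2) ∂(obsLaw Q μ Tmix ξ₁ θ t) ≤
      ∑ i ∈ Finset.range T, ∫ x, x.1.newInd * badInd m ρ x.1.hist (p x.2)
        ∂(obsLaw Q μ Tmix ξ₁ θ i) := by
  have hF : Measurable fun x : World S N × Params S =>
      badInd m ρ (x.1.hist.take (x.1.start - 1)) (p x.2) :=
    measurable_from_prod_countable_right fun w =>
      (measurable_badInd m ρ (w.hist.take (w.start - 1))).comp hp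
  have h := integral_le_sum_newInd (Q := Q) (Tmix := Tmix) (ξ₁ := ξ₁) hμ θ hF
    (fun x => ⟨badInd_nonneg .., badInd_le_one ..⟩)
    (fun t w ϑ hw A s => by
      have h1 : (w.obs A s).hist = w.hist ++ [⟨w.cur, A, w.cur.next A s⟩] := rfl
      have h2 : (w.obs A s).start = w.start := rfl
      have h3 : w.start - 1 ≤ w.hist.length := by
        have := hw.start_le
        rw [hw.length_hist]; omega
      simp only [h1, h2, List.take_append_of_le_length h3]) t
  refine h.trans ?_
  simp only [fun x : World S N × Params S =>
    newInd_mul_take (w := x.1) fun l => badInd m ρ l (p x.2)]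
  refine Finset.sum_le_sum_of_subset_of_nonneg
    (Finset.range_subset_range.2 (by omega)) fun i _ _ => integral_nonneg fun x =>
      mul_nonneg x.1.newInd_nonneg (badInd_nonneg ..)

lemma measurable_subsolution_terms
    (hμ : ∀ (ξ : Meta S) (A : Action K N), MeasurableSet {θ | μ θ ξ = A}) {g : Params S → Meta S → ℝ}
    (hg : ∀ ξ, Measurable fun θ => g θ ξ) (θ : Params S) :
    Measurable fun x : World S N × Params S =>
      metaExp θ x.1.cur (μ x.2 x.1.cur) (g x.2) - g x.2 x.1.cur := by
  refine measurable_of_policy hμ (F := fun w A ϑ => metaExp θ w.cur A (g ϑ) - g ϑ w.cur)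
    fun w A => ?_
  simp only [metaExp_eq]
  exact (Finset.measurable_fun_sum _ fun s _ => (hg _).const_mul _).sub (hg _)

/-- The regret in a fixed system `θ`. The Bellman inequality of the episode parameter splits it into
a difference of gains, a telescoping bias, and an error from evaluating the bias of the episode
parameter under the observation law of `θ`. -/
lemma regret_le_of_subsolution [IsProbabilityMeasure Q] {r : ∀ k, S k → ℝ}
    (hr : ∀ k s, r k s ∈ Set.Icc (0 : ℝ) 1)
    (hμ : ∀ (ξ : Meta S) (A : Action K N), MeasurableSet {θ | μ θ ξ = A}) {τ : ℕ}
    {G : Set (Params S)} (hGm : MeasurableSet G) (hQ : ∀ᵐ ϑ ∂Q, ϑ ∈ G)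
    (hG : ∀ θ ∈ G, MixesWithin τ θ) {J : Params S → ℝ} (hJ : Measurable J)
    (hJN : ∀ θ, J θ ∈ Set.Icc (0 : ℝ) N) {g : Params S → Meta S → ℝ} {H : ℝ}
    (hg : ∀ ξ, Measurable fun θ => g θ ξ) (hgH : ∀ θ ξ, g θ ξ ∈ Set.Icc 0 H)
    (hsub : ∀ θ ∈ G, ∀ ξ, J θ + g θ ξ ≤ metaReward r θ ξ (μ θ ξ) + metaExp θ ξ (μ θ ξ) (g θ))
    {n : ℕ} (hn : 1 ≤ n) {m : ℕ} (hm : ⌈horizonMix τ (n + 1)⌉₊ = m + 1) {ρ : Fin K → ℝ}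
    (hρ : ∀ k, 1 ≤ ρ k) {a : ℝ} (ha : 0 < a) {θ : Params S} (hθ : θ ∈ G) :
    J θ * (n + 1 : ℕ) -
        ∫ x, totalReward r x.1.hist ∂(law Q μ (horizonMix τ (n + 1)) ξ₁ θ (n + 1)) ≤
      ∑ t ∈ Finset.range (n + 1), ∫ x, x.1.newInd * (x.1.remaining * (J θ - J x.2))
          ∂(obsLaw Q μ (horizonMix τ (n + 1)) ξ₁ θ t) +
      (N + H) * (n / a + a / 2 * (1 + Fintype.card (Cell S m) * Real.logb 2 (n + 1))) + H +
      (H + 1) / 2 * (5 * √2 * (√(∑ ζ : Cell S m, ρ ζ.1.1 ^ 2) * √(N * (n + 1 : ℕ) : ℝ)) +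
        32 * N / (n + 1 : ℕ) + 2 * N * ((n + 1 : ℕ) * (
          ∑ t ∈ Finset.range (n + 1), ∫ x, x.1.newInd * badInd m ρ x.1.hist θ
            ∂(obsLaw Q μ (horizonMix τ (n + 1)) ξ₁ θ t) +
          ∑ t ∈ Finset.range (n + 1), ∫ x, x.1.newInd * badInd m ρ x.1.hist x.2
            ∂(obsLaw Q μ (horizonMix τ (n + 1)) ξ₁ θ t)))) := by
  set T : ℕ := n + 1 with hT
  set L := obsLaw Q μ (horizonMix τ T) ξ₁ θ with hL
  have hT2 : 2 ≤ T := by omega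
  have hρ0 : ∀ k, 0 ≤ ρ k := fun k => zero_le_one.trans (hρ k)
  have hH0 : 0 ≤ H := (hgH θ ξ₁).1.trans (hgH θ ξ₁).2
  have hprob : ∀ t, IsProbabilityMeasure (L t) := fun t => isProbabilityMeasure_obsLaw hμ θ t
  -- the terms of the one-step inequality
  set fr : World S N × Params S → ℝ := fun x => metaReward r θ x.1.cur (μ x.2 x.1.cur) with hfr
  set fg : World S N × Params S → ℝ :=
    fun x => metaExp θ x.1.cur (μ x.2 x.1.cur) (g x.2) - g x.2 x.1.cur with hfg
  set fw : World S N × Params S → ℝ :=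
    fun x => visitWidth m ρ x.1.hist x.1.cur (μ x.2 x.1.cur) with hfw
  set b₁ : World S N × Params S → ℝ :=
    fun x => badInd m ρ (x.1.hist.take (x.1.start - 1)) θ with hb₁
  set b₂ : World S N × Params S → ℝ :=
    fun x => badInd m ρ (x.1.hist.take (x.1.start - 1)) x.2 with hb₂
  have hir : ∀ t, Integrable fr (L t) := fun t => by
    refine integrable_obsLaw hμ hGm hQ θ t (measurable_of_policy hμ
      (F := fun w A _ => metaReward r θ w.cur A) fun w A => measurable_const) (C := N) fun x _ => ?_
    rw [abs_of_nonneg (metaReward_mem_Icc hr ..).1]; exact (metaReward_mem_Icc hr ..).2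
  have hig : ∀ t, Integrable fg (L t) := fun t => by
    refine integrable_obsLaw hμ hGm hQ θ t (measurable_subsolution_terms hμ hg θ)
      (C := H) fun x _ => ?_
    have h1 := metaExp_mem_Icc θ x.1.cur (μ x.2 x.1.cur) (hgH x.2)
    have h2 := hgH x.2 x.1.cur
    rw [abs_le]
    constructor <;> linarith [h1.1, h1.2, h2.1, h2.2]
  have hiw : ∀ t, Integrable fw (L t) := fun t => by
    refine integrable_obsLaw hμ hGm hQ θ t (measurable_of_policy hμ
      (F := fun w A _ => visitWidth m ρ w.hist w.cur A) fun w A => measurable_const)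
      (C := ∑ k, ρ k) fun x _ => ?_
    rw [abs_of_nonneg (visitWidth_nonneg hρ0 ..)]; exact visitWidth_le hρ0 ..
  have hi1 : ∀ t, Integrable b₁ (L t) := fun t =>
    integrable_obsLaw hμ hGm hQ θ t
      (measurable_world (f := fun w => badInd m ρ (w.hist.take (w.start - 1)) θ)) (C := 1)
      fun x _ => by rw [abs_of_nonneg (badInd_nonneg ..)]; exact badInd_le_one ..
  have hi2 : ∀ t, Integrable b₂ (L t) := fun t => by
    refine integrable_obsLaw hμ hGm hQ θ t (measurable_from_prod_countable_right fun w =>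
      measurable_badInd m ρ (w.hist.take (w.start - 1))) (C := 1)
      fun x _ => by rw [abs_of_nonneg (badInd_nonneg ..)]; exact badInd_le_one ..
  have hiJ : ∀ t, Integrable (fun x => J x.2) (L t) := fun t =>
    integrable_obsLaw hμ hGm hQ θ t (hJ.comp measurable_snd) (C := N) fun x _ => by
      rw [abs_of_nonneg (hJN _).1]; exact (hJN _).2
  have hstep : ∀ t, ∫ x, J x.2 ∂(L t) ≤ ∫ x, fr x ∂(L t) + ∫ x, fg x ∂(L t) + (H + 1) / 2 *
      (2 * √2 * ∫ x, fw x ∂(L t) + N * (32 / (T : ℝ) ^ 2) +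
        2 * N * (∫ x, b₁ x ∂(L t) + ∫ x, b₂ x ∂(L t))) := by
    intro t
    have hi12 : Integrable (fun x => b₁ x + b₂ x) (L t) := (hi1 t).add (hi2 t)
    have hiA : Integrable (fun x => 2 * √2 * fw x + N * (32 / (T : ℝ) ^ 2)) (L t) :=
      ((hiw t).const_mul _).add (integrable_const _)
    have hiB : Integrable (fun x => 2 * N * (b₁ x + b₂ x)) (L t) := hi12.const_mul _
    have hiE : Integrable (fun x => (H + 1) / 2 *
      (2 * √2 * fw x + N * (32 / (T : ℝ) ^ 2) + 2 * N * (b₁ x + b₂ x))) (L t) :=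
      (hiA.add hiB).const_mul _
    have hirg : Integrable (fun x => fr x + fg x) (L t) := (hir t).add (hig t)
    have h1 : ∫ x, J x.2 ∂(L t) ≤ ∫ x, (fr x + fg x + (H + 1) / 2 *
        (2 * √2 * fw x + N * (32 / (T : ℝ) ^ 2) + 2 * N * (b₁ x + b₂ x))) ∂(L t) := by
      refine integral_mono_ae (hiJ t) (hirg.add hiE) ?_
      filter_upwards [ae_obsLaw hμ hGm hQ θ t] with x hx
      have h2 := gain_le_of_subsolution hr θ x.2 x.1.cur (μ x.2 x.1.cur) (hgH x.2)
        (hsub x.2 hx.2 x.1.cur)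
      have h3 := discrepancy_le_of_validIn hG hT2 hm hρ hθ hx (μ x.2 x.1.cur)
      have h4 := mul_le_mul_of_nonneg_left h3 (show 0 ≤ (H + 1) / 2 by linarith)
      exact h2.trans (add_le_add le_rfl h4)
    rw [integral_add hirg hiE, integral_add (hir t) (hig t), integral_const_mul,
      integral_add hiA hiB, integral_add ((hiw t).const_mul _) (integrable_const _),
      integral_const_mul (2 * √2), integral_const, integral_const_mul (2 * (N : ℝ)),
      integral_add (hi1 t) (hi2 t)] at h1
    simpa using h1
  have hgain := sum_integral_gain_le (Q := Q) (Tmix := horizonMix τ T) (ξ₁ := ξ₁) hμ hJ hJN θ n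
  have hbias := sum_integral_bias_le (Q := Q) (Tmix := horizonMix τ T) (ξ₁ := ξ₁) hμ hg hgH θ n
  have hepi := sum_integral_newInd_le (Q := Q) (ξ₁ := ξ₁) hμ hm ha θ n
  have hrew := sum_integral_metaReward_le (Q := Q) (Tmix := horizonMix τ T) (ξ₁ := ξ₁) hr hμ θ T
  have hwid := sum_integral_visitWidth_le (Q := Q) (Tmix := horizonMix τ T) (ξ₁ := ξ₁) (m := m)
    hμ hρ0 θ T
  have hbad1 : ∑ t ∈ Finset.range T, ∫ x, b₁ x ∂(L t) ≤ T * ∑ t ∈ Finset.range T,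
      ∫ x, x.1.newInd * badInd m ρ x.1.hist θ ∂(L t) := by
    refine (Finset.sum_le_card_nsmul _ _ _ fun t ht => integral_badInd_take_le hμ m ρ θ
      (measurable_const (a := θ)) (Finset.mem_range.1 ht)).trans (le_of_eq ?_)
    rw [Finset.card_range, nsmul_eq_mul]
  have hbad2 : ∑ t ∈ Finset.range T, ∫ x, b₂ x ∂(L t) ≤ T * ∑ t ∈ Finset.range T,
      ∫ x, x.1.newInd * badInd m ρ x.1.hist x.2 ∂(L t) := by
    refine (Finset.sum_le_card_nsmul _ _ _ fun t ht => integral_badInd_take_le hμ m ρ θ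
      measurable_id (Finset.mem_range.1 ht)).trans (le_of_eq ?_)
    rw [Finset.card_range, nsmul_eq_mul]
    rfl
  have hsum := Finset.sum_le_sum fun t (_ : t ∈ Finset.range T) => hstep t
  simp only [Finset.sum_add_distrib, ← Finset.mul_sum, Finset.sum_const, Finset.card_range,
    nsmul_eq_mul] at hsum
  have hJT : J θ * T = ∑ t ∈ Finset.range T, ∫ x, (J θ - J x.2) ∂(L t) +
      ∑ t ∈ Finset.range T, ∫ x, J x.2 ∂(L t) := by
    rw [← Finset.sum_add_distrib]
    have : ∀ t ∈ Finset.range T, ∫ x, (J θ - J x.2) ∂(L t) + ∫ x, J x.2 ∂(L t) = J θ := by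
      intro t _
      rw [integral_sub (integrable_const _) (hiJ t)]
      simp
    rw [Finset.sum_congr rfl this, Finset.sum_const, Finset.card_range, nsmul_eq_mul, mul_comm]
  have hT0 : (N : ℝ) * (T * (32 / (T : ℝ) ^ 2)) = 32 * N / T := by
    have : (T : ℝ) ≠ 0 := by positivity
    field_simp
  rw [hT0] at hsum
  set c := ∑ t ∈ Finset.range n, ∫ x, x.1.newInd ∂(L (t + 1)) with hc
  have hE := mul_le_mul_of_nonneg_left hepi (show 0 ≤ N + H by positivity)
  have hin : 2 * √2 * ∑ t ∈ Finset.range T, ∫ x, fw x ∂(L t) + 32 * N / T +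
      2 * N * (∑ t ∈ Finset.range T, ∫ x, b₁ x ∂(L t) + ∑ t ∈ Finset.range T, ∫ x, b₂ x ∂(L t)) ≤
      5 * √2 * (√(∑ ζ : Cell S m, ρ ζ.1.1 ^ 2) * √(N * T : ℝ)) + 32 * N / T + 2 * N * (T * (
          ∑ t ∈ Finset.range T, ∫ x, x.1.newInd * badInd m ρ x.1.hist θ ∂(L t) +
          ∑ t ∈ Finset.range T, ∫ x, x.1.newInd * badInd m ρ x.1.hist x.2 ∂(L t))) := by
    have h1 := mul_le_mul_of_nonneg_left hwid (show 0 ≤ 2 * √2 by positivity)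
    have h2 := mul_le_mul_of_nonneg_left (add_le_add hbad1 hbad2)
      (show (0 : ℝ) ≤ 2 * N by positivity)
    have h3 : 2 * √2 * (5 / 2 * (√(∑ ζ : Cell S m, ρ ζ.1.1 ^ 2) * √(N * T : ℝ))) =
      5 * √2 * (√(∑ ζ : Cell S m, ρ ζ.1.1 ^ 2) * √(N * T : ℝ)) := by ring
    rw [h3] at h1
    rw [← mul_add] at h2
    linarith
  have hin' := mul_le_mul_of_nonneg_left hin (show 0 ≤ (H + 1) / 2 by linarith)
  rw [hJT]
  have hEc : (N : ℝ) * c + H * (1 + c) ≤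
      (N + H) * (n / a + a / 2 * (1 + Fintype.card (Cell S m) * Real.logb 2 (n + 1))) + H := by
    linarith
  linarith

end Core

section BayesianCore

variable {K N : ℕ} {S : Fin K → Type*} [∀ k, Fintype (S k)] [∀ k, DecidableEq (S k)]
variable {Q : Measure (Params S)} {μ : Params S → Policy S N} {Tmix : ℝ} {ξ₁ : Meta S}

lemma integrable_integral_obsLaw [IsProbabilityMeasure Q]
    (hμ : ∀ (ξ : Meta S) (A : Action K N), MeasurableSet {θ | μ θ ξ = A}) (t : ℕ)
    {F : Params S × (World S N × Params S) → ℝ} (hF : Measurable F) {C : ℝ}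
    (hC : ∀ θ x, ValidIn Tmix Set.univ t x → |F (θ, x)| ≤ C) :
    Integrable (fun θ => ∫ x, F (θ, x) ∂(obsLaw Q μ Tmix ξ₁ θ t)) Q := by
  refine Integrable.of_bound (measurable_integral_obsLaw hμ t hF).aestronglyMeasurable C
    (ae_of_all _ fun θ => ?_)
  have := isProbabilityMeasure_obsLaw (Q := Q) (Tmix := Tmix) (ξ₁ := ξ₁) hμ θ t
  have h := norm_integral_le_of_norm_le_const (μ := obsLaw Q μ Tmix ξ₁ θ t)
    (f := fun x => F (θ, x)) (C := C) (by
      filter_upwards [ae_obsLaw (Q := Q) (ξ₁ := ξ₁) (Tmix := Tmix) hμ MeasurableSet.univ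
          (by simp) θ t] with x hx
      exact hC θ x hx)
  simpa using h

lemma integrable_integral_totalReward [IsProbabilityMeasure Q] {r : ∀ k, S k → ℝ}
    (hr : ∀ k s, r k s ∈ Set.Icc (0 : ℝ) 1)
    (hμ : ∀ (ξ : Meta S) (A : Action K N), MeasurableSet {θ | μ θ ξ = A}) (T : ℕ) :
    Integrable (fun θ => ∫ x, totalReward r x.1.hist ∂(law Q μ Tmix ξ₁ θ T)) Q := by
  simp only [integral_totalReward_eq hr hμ]
  have hF : Measurable fun p : Params S × (World S N × Params S) => totalReward r p.2.1.hist :=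
    (measurable_hist (f := totalReward r)).comp measurable_snd
  refine integrable_integral_obsLaw hμ T hF (C := N * T) fun θ x hx => ?_
  have := totalReward_mem_Icc hr x.1.hist
  rw [hx.1.length_hist] at this
  rw [abs_of_nonneg this.1]
  exact this.2

lemma World.newInd_mul (w : World S N) (y : ℝ) [Decidable w.IsNew] :
    w.newInd * y = if w.IsNew then y else 0 := by
  rw [World.newInd]
  split_ifs <;> simp

/-- At the start of an episode, its parameter has the same law as the true parameter, given the
observations. -/
lemma integral_newInd_mul_posterior [IsProbabilityMeasure Q]
    (hμ : ∀ (ξ : Meta S) (A : Action K N), MeasurableSet {θ | μ θ ξ = A}) (t : ℕ)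
    {g : World S N × Params S → ℝ} (hg : Measurable g) (h0 : ∀ x, 0 ≤ g x) {C : ℝ}
    (hC : ∀ x, ValidIn Tmix Set.univ t x → g x ≤ C) :
    ∫ θ, ∫ x, x.1.newInd * g x ∂(obsLaw Q μ Tmix ξ₁ θ t) ∂Q =
      ∫ θ, ∫ x, x.1.newInd * g (x.1, θ) ∂(obsLaw Q μ Tmix ξ₁ θ t) ∂Q := by
  classical
  have h := integral_isNew_posterior (Q := Q) (ξ₁ := ξ₁) (Tmix := Tmix) hμ MeasurableSet.univ
    (by simp) t hg h0 hC
  simp only [World.newInd_mul]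
  convert h using 1

/-- The parameters of the episodes have, at the starts of the episodes, the same average reward as
the true parameter in the mean. -/
lemma integral_gain_eq_zero [IsProbabilityMeasure Q]
    (hμ : ∀ (ξ : Meta S) (A : Action K N), MeasurableSet {θ | μ θ ξ = A}) {J : Params S → ℝ}
    (hJ : Measurable J) {B : ℝ} (hJB : ∀ θ, J θ ∈ Set.Icc 0 B) (t : ℕ) :
    ∫ θ, ∫ x, x.1.newInd * (x.1.remaining * (J θ - J x.2)) ∂(obsLaw Q μ Tmix ξ₁ θ t) ∂Q = 0 := by
  set R : World S N → ℝ := fun w => max 0 w.remaining with hR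
  have hRJ : ∀ (w : World S N), World.Valid Tmix t w → ∀ θ, R w * J θ ∈ Set.Icc 0 ((t + 1) * B) := by
    intro w hw θ
    have h1 := hw.remaining_mem
    have h2 : R w = w.remaining := max_eq_right (zero_le_one.trans h1.1)
    rw [h2]
    exact ⟨mul_nonneg (zero_le_one.trans h1.1) (hJB θ).1, mul_le_mul h1.2 (hJB θ).2 (hJB θ).1
      (by positivity)⟩
  have hm : ∀ {f : World S N → ℝ}, Measurable fun p : Params S × (World S N × Params S) => f p.2.1 :=
    fun {f} => (measurable_world (f := f)).comp measurable_snd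
  have hb : ∀ (w : World S N), World.Valid Tmix t w → ∀ θ,
      |w.newInd * (R w * J θ)| ≤ (t + 1) * B := by
    intro w hw θ
    rw [abs_of_nonneg (mul_nonneg w.newInd_nonneg (hRJ w hw θ).1)]
    exact (mul_le_of_le_one_left (hRJ w hw θ).1 w.newInd_le_one).trans (hRJ w hw θ).2
  have hm1 : Measurable fun p : Params S × (World S N × Params S) =>
      p.2.1.newInd * (R p.2.1 * J p.1) :=
    (hm (f := fun w => w.newInd)).mul ((hm (f := R)).mul (hJ.comp measurable_fst))
  have hm2 : Measurable fun p : Params S × (World S N × Params S) =>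
      p.2.1.newInd * (R p.2.1 * J p.2.2) :=
    (hm (f := fun w => w.newInd)).mul
      ((hm (f := R)).mul (hJ.comp (measurable_snd.comp measurable_snd)))
  have hi1 : Integrable (fun θ => ∫ x, x.1.newInd * (R x.1 * J θ) ∂(obsLaw Q μ Tmix ξ₁ θ t)) Q :=
    integrable_integral_obsLaw hμ t hm1 fun θ x hx => hb _ hx.1 _
  have hi2 : Integrable (fun θ => ∫ x, x.1.newInd * (R x.1 * J x.2) ∂(obsLaw Q μ Tmix ξ₁ θ t)) Q :=
    integrable_integral_obsLaw hμ t hm2 fun θ x hx => hb _ hx.1 _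
  have hsplit : ∀ θ, ∫ x, x.1.newInd * (x.1.remaining * (J θ - J x.2))
      ∂(obsLaw Q μ Tmix ξ₁ θ t) = ∫ x, x.1.newInd * (R x.1 * J θ) ∂(obsLaw Q μ Tmix ξ₁ θ t) -
        ∫ x, x.1.newInd * (R x.1 * J x.2) ∂(obsLaw Q μ Tmix ξ₁ θ t) := by
    intro θ
    have hj1 : Integrable (fun x => x.1.newInd * (R x.1 * J θ)) (obsLaw Q μ Tmix ξ₁ θ t) :=
      integrable_obsLaw hμ MeasurableSet.univ (by simp) θ t
        (measurable_world (f := fun w => w.newInd * (R w * J θ))) fun x hx => hb _ hx.1 _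
    have hj2 : Integrable (fun x => x.1.newInd * (R x.1 * J x.2)) (obsLaw Q μ Tmix ξ₁ θ t) :=
      integrable_obsLaw hμ MeasurableSet.univ (by simp) θ t
        (measurable_prod_section hm2 θ) fun x hx => hb _ hx.1 _
    rw [← integral_sub hj1 hj2]
    refine integral_congr_ae ?_
    filter_upwards [ae_obsLaw (Q := Q) (ξ₁ := ξ₁) (Tmix := Tmix) hμ MeasurableSet.univ
      (by simp) θ t] with x hx
    have h2 : R x.1 = x.1.remaining := max_eq_right (zero_le_one.trans hx.1.remaining_mem.1)
    simp only [h2]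
    ring
  simp only [hsplit]
  have hgm : Measurable fun x : World S N × Params S => R x.1 * J x.2 :=
    (measurable_world (f := R)).mul (hJ.comp measurable_snd)
  have h := integral_newInd_mul_posterior (Q := Q) (ξ₁ := ξ₁) (Tmix := Tmix) hμ t hgm
    (fun x => mul_nonneg (le_max_left _ _) (hJB _).1) fun x hx => (hRJ _ hx.1 _).2
  rw [integral_sub hi1 hi2, h, sub_self]

/-- The Bayesian regret relative to a subsolution of the Bellman equations. -/
lemma integral_regret_le_of_subsolution [IsProbabilityMeasure Q] {r : ∀ k, S k → ℝ}
    (hr : ∀ k s, r k s ∈ Set.Icc (0 : ℝ) 1)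
    (hμ : ∀ (ξ : Meta S) (A : Action K N), MeasurableSet {θ | μ θ ξ = A}) {τ : ℕ}
    {G : Set (Params S)} (hGm : MeasurableSet G) (hQ : ∀ᵐ ϑ ∂Q, ϑ ∈ G)
    (hG : ∀ θ ∈ G, MixesWithin τ θ) {J : Params S → ℝ} (hJ : Measurable J)
    (hJN : ∀ θ, J θ ∈ Set.Icc (0 : ℝ) N) {g : Params S → Meta S → ℝ} {H : ℝ} (hH : 0 ≤ H)
    (hg : ∀ ξ, Measurable fun θ => g θ ξ) (hgH : ∀ θ ξ, g θ ξ ∈ Set.Icc 0 H)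
    (hsub : ∀ θ ∈ G, ∀ ξ, J θ + g θ ξ ≤ metaReward r θ ξ (μ θ ξ) + metaExp θ ξ (μ θ ξ) (g θ))
    {n : ℕ} (hn : 1 ≤ n) {m : ℕ} (hm : ⌈horizonMix τ (n + 1)⌉₊ = m + 1) {ρ : Fin K → ℝ}
    (hρ : ∀ k, 1 ≤ ρ k) {a : ℝ} (ha : 0 < a) {δ : ℝ}
    (hδ : ∑ ζ : Cell S m, (n + 1 : ℕ) * 2 ^ Fintype.card (S ζ.1.1) *
      Real.exp (-(ρ ζ.1.1) ^ 2 / 2) ≤ δ) :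
    ∫ θ, (J θ * (n + 1 : ℕ) -
        ∫ x, totalReward r x.1.hist ∂(law Q μ (horizonMix τ (n + 1)) ξ₁ θ (n + 1))) ∂Q ≤
      (N + H) * (n / a + a / 2 * (1 + Fintype.card (Cell S m) * Real.logb 2 (n + 1))) + H +
      (H + 1) / 2 * (5 * √2 * (√(∑ ζ : Cell S m, ρ ζ.1.1 ^ 2) * √(N * (n + 1 : ℕ) : ℝ)) +
        32 * N / (n + 1 : ℕ) + 4 * N * (n + 1 : ℕ) ^ 2 * δ) := by
  set T : ℕ := n + 1 with hT
  set L := obsLaw Q μ (horizonMix τ T) ξ₁ with hL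
  have hρ0 : ∀ k, 0 ≤ ρ k := fun k => zero_le_one.trans (hρ k)
  have hprob : ∀ θ t, IsProbabilityMeasure (L θ t) := fun θ t => isProbabilityMeasure_obsLaw hμ θ t
  have hbb : ∀ (w : World S N) θ, |w.newInd * badInd m ρ w.hist θ| ≤ 1 := fun w θ => by
    rw [abs_of_nonneg (mul_nonneg w.newInd_nonneg (badInd_nonneg ..))]
    exact mul_le_one₀ w.newInd_le_one (badInd_nonneg ..) (badInd_le_one ..)
  have hmn : Measurable fun p : Params S × (World S N × Params S) => p.2.1.newInd :=
    (measurable_world (f := fun w => w.newInd)).comp measurable_snd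
  have hmb : Measurable fun q : World S N × Params S => badInd m ρ q.1.hist q.2 :=
    measurable_from_prod_countable_right fun w => measurable_badInd m ρ w.hist
  have hmb1 : Measurable fun p : Params S × (World S N × Params S) =>
      p.2.1.newInd * badInd m ρ p.2.1.hist p.1 := hmn.mul
    (hmb.comp (measurable_fst.comp measurable_snd |>.prodMk measurable_fst))
  have hmb2 : Measurable fun p : Params S × (World S N × Params S) =>
      p.2.1.newInd * badInd m ρ p.2.1.hist p.2.2 := hmn.mul (hmb.comp measurable_snd)
  have hmz : Measurable fun p : Params S × (World S N × Params S) =>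
      p.2.1.newInd * (p.2.1.remaining * (J p.1 - J p.2.2)) := hmn.mul
    (((measurable_world (f := fun w => w.remaining)).comp measurable_snd).mul
      ((hJ.comp measurable_fst).sub (hJ.comp (measurable_snd.comp measurable_snd))))
  have hi1 : ∀ t, Integrable (fun θ => ∫ x, x.1.newInd * badInd m ρ x.1.hist θ ∂(L θ t)) Q :=
    fun t => integrable_integral_obsLaw hμ t hmb1 fun θ x _ => hbb _ _
  have hi2 : ∀ t, Integrable (fun θ => ∫ x, x.1.newInd * badInd m ρ x.1.hist x.2 ∂(L θ t)) Q :=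
    fun t => integrable_integral_obsLaw hμ t hmb2 fun θ x _ => hbb _ _
  have hiz : ∀ t, Integrable (fun θ => ∫ x, x.1.newInd * (x.1.remaining * (J θ - J x.2))
      ∂(L θ t)) Q := fun t => by
    refine integrable_integral_obsLaw hμ t hmz (C := (t + 1) * N) fun θ x hx => ?_
    have h1 := hx.1.remaining_mem
    rw [abs_mul, abs_mul, abs_of_nonneg x.1.newInd_nonneg, abs_of_nonneg (zero_le_one.trans h1.1)]
    have h2 : |J θ - J x.2| ≤ N := by
      have := hJN θ
      have := hJN x.2
      rw [abs_le]
      constructor <;> linarith [(hJN θ).1, (hJN θ).2, (hJN x.2).1, (hJN x.2).2]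
    exact (mul_le_of_le_one_left (by positivity [zero_le_one.trans h1.1]) x.1.newInd_le_one).trans
      (mul_le_mul h1.2 h2 (abs_nonneg _) (by positivity))
  have hb1 : ∀ t ∈ Finset.range T,
      ∫ θ, ∫ x, x.1.newInd * badInd m ρ x.1.hist θ ∂(L θ t) ∂Q ≤ δ := by
    intro t ht
    have h1 : ∀ θ, ∫ x, x.1.newInd * badInd m ρ x.1.hist θ ∂(L θ t) ≤ δ := by
      intro θ
      refine le_trans ?_ (le_trans (integral_badInd_le (Q := Q) (Tmix := horizonMix τ T)
        (ξ₁ := ξ₁) (m := m) hμ hρ0 θ t) (le_trans ?_ hδ))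
      · refine integral_mono_of_nonneg (ae_of_all _ fun x =>
          mul_nonneg x.1.newInd_nonneg (badInd_nonneg ..))
          (integrable_obsLaw hμ MeasurableSet.univ (by simp) θ t
            (measurable_hist (f := fun l => badInd m ρ l θ)) (C := 1) fun x _ => by
              rw [abs_of_nonneg (badInd_nonneg ..)]; exact badInd_le_one ..)
          (ae_of_all _ fun x => mul_le_of_le_one_left (badInd_nonneg ..) x.1.newInd_le_one)
      · refine Finset.sum_le_sum fun ζ _ => ?_
        rw [neg_div]
        have : (t : ℝ) ≤ (T : ℕ) := by exact_mod_cast (Finset.mem_range.1 ht).le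
        gcongr
    have h2 := integral_mono (hi1 t) (integrable_const δ) h1
    simpa using h2
  have hb2 : ∀ t ∈ Finset.range T,
      ∫ θ, ∫ x, x.1.newInd * badInd m ρ x.1.hist x.2 ∂(L θ t) ∂Q ≤ δ := by
    intro t ht
    rw [integral_newInd_mul_posterior hμ t hmb (fun x => badInd_nonneg ..)
      (C := 1) fun x _ => badInd_le_one ..]
    exact hb1 t ht
  set c₁ : ℝ := (N + H) * (n / a + a / 2 * (1 + Fintype.card (Cell S m) * Real.logb 2 (n + 1))) + H
    with hc₁
  set c₂ : ℝ := 5 * √2 * (√(∑ ζ : Cell S m, ρ ζ.1.1 ^ 2) * √(N * T : ℝ)) + 32 * N / T with hc₂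
  have hJi : Integrable (fun θ => J θ * T) Q := by
    refine Integrable.mul_const (Integrable.of_bound hJ.aestronglyMeasurable N
      (ae_of_all _ fun θ => ?_)) _
    rw [Real.norm_eq_abs, abs_of_nonneg (hJN θ).1]; exact (hJN θ).2
  have hleft : Integrable (fun θ => J θ * T -
      ∫ x, totalReward r x.1.hist ∂(law Q μ (horizonMix τ T) ξ₁ θ T)) Q :=
    hJi.sub (integrable_integral_totalReward hr hμ T)
  have hsz : Integrable (fun θ => ∑ t ∈ Finset.range T,
      ∫ x, x.1.newInd * (x.1.remaining * (J θ - J x.2)) ∂(L θ t)) Q :=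
    integrable_finsetSum _ fun t _ => hiz t
  have hs1 : Integrable (fun θ => ∑ t ∈ Finset.range T,
      ∫ x, x.1.newInd * badInd m ρ x.1.hist θ ∂(L θ t)) Q := integrable_finsetSum _ fun t _ => hi1 t
  have hs2 : Integrable (fun θ => ∑ t ∈ Finset.range T,
      ∫ x, x.1.newInd * badInd m ρ x.1.hist x.2 ∂(L θ t)) Q :=
    integrable_finsetSum _ fun t _ => hi2 t
  have hs12 : Integrable (fun θ => (H + 1) / 2 * (2 * N * T) * (∑ t ∈ Finset.range T,
      ∫ x, x.1.newInd * badInd m ρ x.1.hist θ ∂(L θ t) + ∑ t ∈ Finset.range T,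
      ∫ x, x.1.newInd * badInd m ρ x.1.hist x.2 ∂(L θ t))) Q := (hs1.add hs2).const_mul _
  have hszc : Integrable (fun θ => ∑ t ∈ Finset.range T,
      ∫ x, x.1.newInd * (x.1.remaining * (J θ - J x.2)) ∂(L θ t) + (c₁ + (H + 1) / 2 * c₂)) Q :=
    hsz.add (integrable_const _)
  have hmono : ∫ θ, (J θ * T -
      ∫ x, totalReward r x.1.hist ∂(law Q μ (horizonMix τ T) ξ₁ θ T)) ∂Q ≤
      ∫ θ, ((∑ t ∈ Finset.range T,
      ∫ x, x.1.newInd * (x.1.remaining * (J θ - J x.2)) ∂(L θ t) + (c₁ + (H + 1) / 2 * c₂)) +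
        (H + 1) / 2 * (2 * N * T) * (∑ t ∈ Finset.range T,
      ∫ x, x.1.newInd * badInd m ρ x.1.hist θ ∂(L θ t) + ∑ t ∈ Finset.range T,
      ∫ x, x.1.newInd * badInd m ρ x.1.hist x.2 ∂(L θ t))) ∂Q := by
    refine integral_mono_ae hleft (hszc.add hs12) ?_
    filter_upwards [hQ] with θ hθ
    have h := regret_le_of_subsolution (ξ₁ := ξ₁) hr hμ hGm hQ hG hJ hJN hg hgH hsub hn hm hρ ha hθ
    refine h.trans (le_of_eq ?_)
    simp only [hc₁, hc₂]
    ring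
  refine hmono.trans ?_
  rw [integral_add hszc hs12, integral_add hsz (integrable_const _), integral_const_mul,
    integral_add hs1 hs2, integral_finsetSum _ fun t _ => hiz t,
    integral_finsetSum _ fun t _ => hi1 t, integral_finsetSum _ fun t _ => hi2 t,
    Finset.sum_eq_zero fun t _ => integral_gain_eq_zero hμ hJ hJN t]
  have h1 := Finset.sum_le_card_nsmul _ _ _ hb1
  have h2 := Finset.sum_le_card_nsmul _ _ _ hb2
  rw [Finset.card_range, nsmul_eq_mul] at h1 h2
  have h3 := mul_le_mul_of_nonneg_left (add_le_add h1 h2)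
    (show 0 ≤ (H + 1) / 2 * (2 * N * T) by positivity)
  simp only [integral_const, probReal_univ, one_smul, zero_add]
  refine (add_le_add le_rfl h3).trans (le_of_eq ?_)
  ring

end BayesianCore

/-! ### Measurable subsolutions -/

section Subsolution

variable {K N : ℕ} {S : Fin K → Type*} [∀ k, Fintype (S k)] [∀ k, DecidableEq (S k)]
variable {μ : Params S → Policy S N}

/-- Decreasing iterates of the Bellman operator, from the constant `H`. -/
def upperIter (r : ∀ k, S k → ℝ) (μ : Params S → Policy S N) (J : Params S → ℝ) (H : ℝ) :
    ℕ → Params S → Meta S → ℝ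
  | 0 => fun _ _ => H
  | n + 1 => fun θ ξ => min (upperIter r μ J H n θ ξ)
      (max 0 (metaReward r θ ξ (μ θ ξ) - J θ + metaExp θ ξ (μ θ ξ) (upperIter r μ J H n θ)))

lemma measurable_metaReward (r : ∀ k, S k → ℝ) (ξ : Meta S) (A : Action K N) :
    Measurable fun θ : Params S => metaReward r θ ξ A :=
  Finset.measurable_fun_sum _ fun _ _ => Finset.measurable_fun_sum _ fun _ _ =>
    (measurable_stateProb _ _ _ _).mul_const _

lemma measurable_metaExp {g : Params S → Meta S → ℝ} (hg : ∀ ξ, Measurable fun θ => g θ ξ)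
    (ξ : Meta S) (A : Action K N) : Measurable fun θ : Params S => metaExp θ ξ A (g θ) := by
  simp only [metaExp_eq]
  exact Finset.measurable_fun_sum _ fun s _ => (measurable_armsProb ξ s).mul (hg _)

lemma measurable_upperIter (hμ : ∀ (ξ : Meta S) (A : Action K N), MeasurableSet {θ | μ θ ξ = A})
    (r : ∀ k, S k → ℝ) {J : Params S → ℝ} (hJ : Measurable J) (H : ℝ) (n : ℕ) (ξ : Meta S) :
    Measurable fun θ => upperIter r μ J H n θ ξ := by
  induction n generalizing ξ with
  | zero => exact measurable_const
  | succ n ih =>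
    refine (ih ξ).min (measurable_const.max ?_)
    exact measurable_policy_apply hμ ξ (F := fun A θ => metaReward r θ ξ A - J θ +
      metaExp θ ξ A (upperIter r μ J H n θ)) fun A =>
        ((measurable_metaReward r ξ A).sub hJ).add (measurable_metaExp ih ξ A)

lemma upperIter_mem {r : ∀ k, S k → ℝ} {J : Params S → ℝ} {H : ℝ} (hH : 0 ≤ H) (n : ℕ)
    (θ : Params S) (ξ : Meta S) : upperIter r μ J H n θ ξ ∈ Set.Icc 0 H := by
  induction n with
  | zero => exact ⟨hH, le_rfl⟩
  | succ n ih => exact ⟨le_min ih.1 (le_max_left _ _), (min_le_left _ _).trans ih.2⟩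

/-- If the Bellman inequality for every good parameter has a solution with values in `[0, H]`, then
it has one that depends measurably on the parameter: the limit of the decreasing iterates from the
constant `H`, which stay above every solution. Bias functions are given parameter by parameter, so they
need not be measurable in it, while Bayesian expectations need this. -/
lemma exists_measurable_subsolution
    (hμ : ∀ (ξ : Meta S) (A : Action K N), MeasurableSet {θ | μ θ ξ = A}) (r : ∀ k, S k → ℝ)
    {J : Params S → ℝ} (hJ : Measurable J) {H : ℝ} (hH : 0 ≤ H) {G : Set (Params S)}
    (hG : ∀ θ ∈ G, ∃ h : Meta S → ℝ, (∀ ξ, h ξ ∈ Set.Icc 0 H) ∧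
      ∀ ξ, J θ + h ξ ≤ metaReward r θ ξ (μ θ ξ) + metaExp θ ξ (μ θ ξ) h) :
    ∃ g : Params S → Meta S → ℝ, (∀ ξ, Measurable fun θ => g θ ξ) ∧
      (∀ θ ξ, g θ ξ ∈ Set.Icc 0 H) ∧
      ∀ θ ∈ G, ∀ ξ, J θ + g θ ξ ≤ metaReward r θ ξ (μ θ ξ) + metaExp θ ξ (μ θ ξ) (g θ) := by
  set u := upperIter r μ J H with hu
  have hmem : ∀ n θ ξ, u n θ ξ ∈ Set.Icc 0 H := fun n θ ξ => upperIter_mem hH n θ ξ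
  have hbdd : ∀ θ ξ, BddBelow (Set.range fun n => u n θ ξ) := fun θ ξ =>
    ⟨0, by rintro _ ⟨n, rfl⟩; exact (hmem n θ ξ).1⟩
  have hlim : ∀ θ ξ, Tendsto (fun n => u n θ ξ) atTop (𝓝 (⨅ n, u n θ ξ)) := fun θ ξ =>
    tendsto_atTop_ciInf (antitone_nat_of_succ_le fun n => min_le_left _ _) (hbdd θ ξ)
  refine ⟨fun θ ξ => ⨅ n, u n θ ξ, fun ξ => ?_, fun θ ξ => ?_, fun θ hθ ξ => ?_⟩
  · exact measurable_of_tendsto_metrizable (fun n => measurable_upperIter hμ r hJ H n ξ)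
      (tendsto_pi_nhds.2 fun θ => hlim θ ξ)
  · exact ⟨le_ciInf fun n => (hmem n θ ξ).1, (ciInf_le (hbdd θ ξ) 0).trans (hmem 0 θ ξ).2⟩
  · obtain ⟨h, hh, hsub⟩ := hG θ hθ
    have hle : ∀ n ξ, h ξ ≤ u n θ ξ := by
      intro n
      induction n with
      | zero => exact fun ξ => (hh ξ).2
      | succ n ih =>
        intro ξ
        refine le_min (ih ξ) (le_max_of_le_right ?_)
        have := metaExp_mono θ ξ (μ θ ξ) ih
        linarith [hsub ξ]
    have hP : Tendsto (fun n => metaReward r θ ξ (μ θ ξ) + metaExp θ ξ (μ θ ξ) (u n θ)) atTop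
        (𝓝 (metaReward r θ ξ (μ θ ξ) + metaExp θ ξ (μ θ ξ) fun ξ => ⨅ n, u n θ ξ)) := by
      simp only [metaExp_eq]
      exact (tendsto_finsetSum _ fun s _ => (hlim θ _).const_mul _).const_add _
    refine ge_of_tendsto' hP fun n => ?_
    have h1 := metaExp_mono θ ξ (μ θ ξ) (hle n)
    have h2 : 0 ≤ metaReward r θ ξ (μ θ ξ) - J θ + metaExp θ ξ (μ θ ξ) (u n θ) := by
      linarith [hsub ξ, (hh ξ).1]
    have h3 : ⨅ n, u n θ ξ ≤ metaReward r θ ξ (μ θ ξ) - J θ + metaExp θ ξ (μ θ ξ) (u n θ) :=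
      (ciInf_le (hbdd θ ξ) (n + 1)).trans ((min_le_right _ _).trans (max_eq_right h2).le)
    linarith

lemma measurable_meanReward (hμ : ∀ (ξ : Meta S) (A : Action K N), MeasurableSet {θ | μ θ ξ = A})
    (r : ∀ k, S k → ℝ) (ξ : Meta S) (T : ℕ) :
    Measurable fun θ => meanReward r θ (μ θ) ξ T := by
  have h : ∀ t ξ, Measurable fun θ => expReward r θ (μ θ) t ξ := by
    intro t
    induction t with
    | zero =>
      exact fun ξ => measurable_policy_apply hμ ξ (F := fun A θ => metaReward r θ ξ A)
        fun A => measurable_metaReward r ξ A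
    | succ t ih =>
      intro ξ
      simp only [expReward_succ]
      exact measurable_policy_apply hμ ξ
        (F := fun A θ => metaExp θ ξ A (expReward r θ (μ θ) t)) fun A => measurable_metaExp ih ξ A
  exact (Finset.measurable_fun_sum _ fun t _ => h t ξ).const_mul _

lemma measurable_avgReward (hμ : ∀ (ξ : Meta S) (A : Action K N), MeasurableSet {θ | μ θ ξ = A})
    (r : ∀ k, S k → ℝ) (ξ : Meta S) : Measurable fun θ => avgReward r θ (μ θ) ξ :=
  (StronglyMeasurable.limUnder fun T => (measurable_meanReward hμ r ξ T).stronglyMeasurable).measurable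

end Subsolution

/-! ### The choice of the constants -/

section Constants

lemma episode_cost_le {n T X c : ℝ} (hX : 0 < X) (hT : 0 < T) (hnT : n ≤ T) (hc : c ≤ 2 * X) :
    n / (√T / √X) + √T / √X / 2 * c ≤ 2 * √(X * T) := by
  have h1 : 0 < √T := Real.sqrt_pos.2 hT
  have h2 : 0 < √X := Real.sqrt_pos.2 hX
  have e1 : T / (√T / √X) = √(X * T) := by
    rw [Real.sqrt_mul hX.le, div_div_eq_mul_div, div_eq_iff h1.ne']
    nlinarith [Real.mul_self_sqrt hT.le]
  have e2 : √T / √X / 2 * (2 * X) = √(X * T) := by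
    rw [Real.sqrt_mul hX.le]
    have := Real.mul_self_sqrt hX.le
    field_simp
    rw [sq, this]
  have h3 : n / (√T / √X) ≤ √(X * T) := by rw [← e1]; gcongr
  have h4 : √T / √X / 2 * c ≤ √(X * T) := by rw [← e2]; gcongr
  linarith

lemma width_cost_le {V σ N T M l H : ℝ} (hσ : 0 ≤ σ) (hN : 0 ≤ N) (hT : 0 ≤ T) (hH : 0 ≤ H)
    (hV : V ≤ 24 * l * M * σ ^ 2) (hl : 0 ≤ l) (hM : 0 ≤ M) :
    (H + 1) / 2 * (5 * √2 * (√V * √(N * T))) ≤ 18 * (H + 1) * σ * √(N * M * T * l) := by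
  have h1 : √2 * (√V * √(N * T)) ≤ 36 / 5 * (σ * √(N * M * T * l)) := by
    calc √2 * (√V * √(N * T)) ≤ √2 * (√(24 * l * M * σ ^ 2) * √(N * T)) := by gcongr
      _ = √(48 * (σ ^ 2 * (N * M * T * l))) := by
        rw [← Real.sqrt_mul (by positivity), ← Real.sqrt_mul (by norm_num)]
        congr 1; ring
      _ ≤ √((36 / 5) ^ 2 * (σ ^ 2 * (N * M * T * l))) := by gcongr; norm_num
      _ = _ := by
        rw [Real.sqrt_mul (by norm_num), Real.sqrt_sq (by norm_num), Real.sqrt_mul (by positivity),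
          Real.sqrt_sq hσ]
  have h2 := mul_le_mul_of_nonneg_left h1 (show 0 ≤ (H + 1) / 2 * 5 by positivity)
  calc (H + 1) / 2 * (5 * √2 * (√V * √(N * T))) = (H + 1) / 2 * 5 * (√2 * (√V * √(N * T))) := by ring
    _ ≤ _ := h2
    _ = _ := by ring

end Constants

/-! ### The regret bound -/

section RegretBound

variable {K N : ℕ} {S : Fin K → Type*} [∀ k, Fintype (S k)] [∀ k, DecidableEq (S k)]
variable {Q : Measure (Params S)} {μ : Params S → Policy S N} {ξ₁ : Meta S}

lemma action_card_le (A : Action K N) : N ≤ K := by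
  have := Finset.card_le_univ A.1
  rwa [A.2, Fintype.card_fin] at this

lemma le_sum_card (hS : ∀ k, Nonempty (S k)) (A : Action K N) :
    (N : ℝ) ≤ ∑ k, (Fintype.card (S k) : ℝ) := by
  calc (N : ℝ) ≤ K := by exact_mod_cast action_card_le A
    _ = ∑ k : Fin K, (1 : ℝ) := by simp
    _ ≤ _ := Finset.sum_le_sum fun k _ => by exact_mod_cast Fintype.card_pos

lemma episode_const_le {σ M T L m : ℝ} (hσ : 1 ≤ σ) (hM : 9 ≤ M) (hT : 2 ≤ T) (hm : m + 1 ≤ M + 1)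
    (hL : Real.log T ≤ L) : 1 + σ * (m + 1) * Real.logb 2 T ≤ 2 * (σ * M * L) := by
  have hln2 := Real.log_two_gt_d9
  have h0 : 0 ≤ Real.log T := Real.log_nonneg (by linarith)
  have h1 : Real.logb 2 T * Real.log 2 = Real.log T := by
    rw [Real.logb, div_mul_cancel₀ _ (by linarith)]
  have hlog2 : 1 ≤ Real.logb 2 T := by
    rw [Real.le_logb_iff_rpow_le (by norm_num) (by linarith)]; simpa using hT
  have hlb : Real.logb 2 T ≤ 1.45 * Real.log T := by nlinarith
  have hlT1 : 1 ≤ 1.45 * Real.log T := hlog2.trans hlb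
  calc 1 + σ * (m + 1) * Real.logb 2 T ≤ σ * (1.45 * Real.log T) +
        σ * (M + 1) * (1.45 * Real.log T) := by
        refine add_le_add (one_le_mul_of_one_le_of_one_le hσ hlT1) ?_
        gcongr
    _ = σ * Real.log T * (1.45 * (M + 2)) := by ring
    _ ≤ σ * Real.log T * (2 * M) := mul_le_mul_of_nonneg_left (by linarith) (by positivity)
    _ ≤ σ * L * (2 * M) := by gcongr
    _ = _ := by ring

lemma rest_cost_le {σ M T N m : ℝ} (hN : 0 ≤ N) (hNσ : N ≤ σ) (hM : 1 ≤ M)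
    (hm : m + 1 ≤ M + 1) (hT : 540 * (σ * M) ≤ T) (hT0 : 0 < T) :
    32 * N / T + 4 * N * T ^ 2 * (σ * (m + 1) * (T * Real.exp (-(5 * Real.log (M * T))))) ≤ 1 := by
  have hσ : 0 ≤ σ := hN.trans hNσ
  have hσM : σ ≤ σ * M := le_mul_of_one_le_right hσ hM
  have hexp : Real.exp (-(5 * Real.log (M * T))) ≤ 1 / T ^ 5 := by
    rw [Real.exp_neg, one_div]
    gcongr
    rw [show (5 : ℝ) * Real.log (M * T) = (5 : ℕ) * Real.log (M * T) by norm_num,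
      Real.exp_nat_mul, Real.exp_log (by positivity)]
    gcongr
    exact le_mul_of_one_le_left hT0.le hM
  have hcard : σ * (m + 1) ≤ T := by
    calc σ * (m + 1) ≤ σ * (M + 1) := by gcongr
      _ ≤ T := by linarith
  have h1 : 4 * N * T ^ 2 * (σ * (m + 1) * (T * Real.exp (-(5 * Real.log (M * T))))) ≤
      4 * N * T ^ 2 * (T * (T * (1 / T ^ 5))) := by gcongr
  have h2 : 4 * N * T ^ 2 * (T * (T * (1 / T ^ 5))) = 4 * N / T := by field_simp
  have h3 : 32 * N / T + 4 * N / T ≤ 1 := by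
    rw [← add_div, div_le_one hT0]
    linarith
  linarith

/-- The union bound over the counters, for the radius `√(12 |S_k| l)`: as `2 ≤ e ^ l`, the number
`2 ^ |S_k|` of sign vectors costs only a sixth of the exponent. -/
lemma sum_cell_exp_le (hS : ∀ k, Nonempty (S k)) {l : ℝ} (hl : Real.log 2 ≤ l) (m T : ℕ) :
    ∑ ζ : Cell S m, (T : ℝ) * 2 ^ Fintype.card (S ζ.1.1) *
      Real.exp (-(√(12 * Fintype.card (S ζ.1.1) * l)) ^ 2 / 2) ≤
      Fintype.card (Cell S m) * (T * Real.exp (-(5 * l))) := by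
  have hl0 : 0 < l := (Real.log_pos (by norm_num)).trans_le hl
  refine (Finset.sum_le_card_nsmul _ _ (T * Real.exp (-(5 * l))) fun ζ _ => ?_).trans (le_of_eq ?_)
  · have hc : (1 : ℝ) ≤ Fintype.card (S ζ.1.1) := by
      have := hS ζ.1.1
      exact_mod_cast Fintype.card_pos
    rw [neg_div, Real.sq_sqrt (by positivity), mul_assoc]
    refine mul_le_mul_of_nonneg_left ?_ (by positivity)
    have h2 : (2 : ℝ) ^ Fintype.card (S ζ.1.1) ≤ Real.exp (Fintype.card (S ζ.1.1) * l) := by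
      rw [Real.exp_nat_mul]
      gcongr
      rw [← Real.exp_log (show (0 : ℝ) < 2 by norm_num)]
      exact Real.exp_le_exp.2 hl
    calc (2 : ℝ) ^ Fintype.card (S ζ.1.1) * Real.exp (-(12 * Fintype.card (S ζ.1.1) * l / 2))
        ≤ Real.exp (Fintype.card (S ζ.1.1) * l) *
          Real.exp (-(12 * Fintype.card (S ζ.1.1) * l / 2)) := by gcongr
      _ = Real.exp (-(5 * (Fintype.card (S ζ.1.1) * l))) := by rw [← Real.exp_add]; congr 1; ring
      _ ≤ _ := by
        rw [Real.exp_le_exp]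
        nlinarith
  · rw [Finset.card_univ, nsmul_eq_mul]

lemma sum_cell_sq_le (hS : ∀ k, Nonempty (S k)) {l M : ℝ} (hl : 0 ≤ l) {m : ℕ}
    (hm : (m : ℝ) + 1 ≤ 2 * M) :
    ∑ ζ : Cell S m, √(12 * Fintype.card (S ζ.1.1) * l) ^ 2 ≤
      24 * l * M * (∑ k, (Fintype.card (S k) : ℝ)) ^ 2 := by
  have h1 : ∀ ζ : Cell S m, √(12 * Fintype.card (S ζ.1.1) * l) ^ 2 ≤
      12 * (∑ k, (Fintype.card (S k) : ℝ)) * l := by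
    intro ζ
    rw [Real.sq_sqrt (by positivity)]
    gcongr
    exact Finset.single_le_sum (f := fun k => (Fintype.card (S k) : ℝ))
      (fun k _ => Nat.cast_nonneg _) (Finset.mem_univ _)
  refine (Finset.sum_le_card_nsmul _ _ _ fun ζ _ => h1 ζ).trans ?_
  rw [Finset.card_univ, nsmul_eq_mul, card_cell]
  set σ := ∑ k, (Fintype.card (S k) : ℝ)
  have hσ : 0 ≤ σ := Finset.sum_nonneg fun k _ => Nat.cast_nonneg _
  calc σ * (m + 1) * (12 * σ * l) = (m + 1) * (12 * σ ^ 2 * l) := by ring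
    _ ≤ 2 * M * (12 * σ ^ 2 * l) := by gcongr
    _ = _ := by ring

/-- The Bayesian regret relative to solutions of the Bellman inequality with values in `[0, H]`. -/
lemma integral_regret_le [IsProbabilityMeasure Q] {r : ∀ k, S k → ℝ}
    (hr : ∀ k s, r k s ∈ Set.Icc (0 : ℝ) 1) (hN : 1 ≤ N)
    (hμ : ∀ (ξ : Meta S) (A : Action K N), MeasurableSet {θ | μ θ ξ = A}) {τ : ℕ} (hτ : 1 ≤ τ)
    {G : Set (Params S)} (hGm : MeasurableSet G) (hQ : ∀ᵐ ϑ ∂Q, ϑ ∈ G)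
    (hG : ∀ θ ∈ G, MixesWithin τ θ) {J : Params S → ℝ} (hJ : Measurable J)
    (hJN : ∀ θ, J θ ∈ Set.Icc (0 : ℝ) N) {H : ℝ} (hH : 0 ≤ H)
    (hh : ∀ θ ∈ G, ∃ h : Meta S → ℝ, (∀ ξ, h ξ ∈ Set.Icc 0 H) ∧
      ∀ ξ, J θ + h ξ ≤ metaReward r θ ξ (μ θ ξ) + metaExp θ ξ (μ θ ξ) h)
    {T : ℕ} (hT : 2 ≤ T) :
    ∫ θ, (J θ * T - ∫ x, totalReward r x.1.hist ∂(law Q μ (horizonMix τ T) ξ₁ θ T)) ∂Q ≤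
      2 * (H + N) * √((∑ k, (Fintype.card (S k) : ℝ)) * horizonMix τ T * T * Real.log (N * T)) +
      28 * (H + 1) * (∑ k, (Fintype.card (S k) : ℝ)) *
        √(N * horizonMix τ T * T * Real.log (horizonMix τ T * T)) := by
  obtain ⟨θ₀⟩ : Nonempty (Params S) := by
    by_contra h
    rw [not_nonempty_iff] at h
    have := measure_univ (μ := Q)
    rw [Set.univ_eq_empty_iff.2 h] at this
    simp at this
  have hS : ∀ k, Nonempty (S k) := fun k => ⟨ξ₁.last k⟩
  have hNσ := le_sum_card hS (μ θ₀ ξ₁)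
  have hcell : ∀ m, (Fintype.card (Cell S m) : ℝ) =
    (∑ k, (Fintype.card (S k) : ℝ)) * (m + 1) := card_cell
  have hwidth : ∀ {l M : ℝ}, 0 ≤ l → ∀ {m : ℕ}, (m : ℝ) + 1 ≤ 2 * M →
    ∑ ζ : Cell S m, √(12 * Fintype.card (S ζ.1.1) * l) ^ 2 ≤
      24 * l * M * (∑ k, (Fintype.card (S k) : ℝ)) ^ 2 := sum_cell_sq_le hS
  set σ : ℝ := ∑ k, (Fintype.card (S k) : ℝ) with hσ
  set M : ℝ := horizonMix τ T with hM
  set l : ℝ := Real.log (M * T) with hl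
  have hN1 : (1 : ℝ) ≤ N := by exact_mod_cast hN
  have hσ1 : 1 ≤ σ := hN1.trans hNσ
  have hT2 : (2 : ℝ) ≤ T := by exact_mod_cast hT
  have hT0 : (0 : ℝ) < T := by linarith
  have hlog2 : 1 ≤ Real.logb 2 T := by
    rw [Real.le_logb_iff_rpow_le (by norm_num) hT0]; simpa using hT2
  have hτ1 : (1 : ℝ) ≤ τ := by exact_mod_cast hτ
  have hM1 : 1 ≤ M := by rw [hM, horizonMix]; nlinarith
  have hlT : Real.log T ≤ l := Real.log_le_log hT0 (by nlinarith)
  have hl2 : Real.log 2 ≤ l := (Real.log_le_log (by norm_num) hT2).trans hlT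
  have hln2 := Real.log_two_gt_d9
  have hln2' := Real.log_two_lt_d9
  have hl0 : 0 < l := by linarith
  have hlNT : Real.log T ≤ Real.log (N * T) := Real.log_le_log hT0 (by nlinarith)
  have hlT0 : 0 < Real.log T := Real.log_pos (by linarith)
  have hX : 0 < σ * M * Real.log (N * T) := by
    have : 0 < Real.log (N * T) := by linarith
    positivity
  have hfirst : 0 ≤ 2 * (H + N) * √(σ * M * T * Real.log (N * T)) := by positivity
  rcases le_or_gt (T : ℝ) (784 * (σ * M * l)) with hsmall | hlarge
  · -- for small horizons, the second term exceeds the largest possible regret `N * T`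
    have h1 : ∫ θ, (J θ * T - ∫ x, totalReward r x.1.hist ∂(law Q μ M ξ₁ θ T)) ∂Q ≤ N * T := by
      have h2 : ∀ θ, J θ * T - ∫ x, totalReward r x.1.hist ∂(law Q μ M ξ₁ θ T) ≤ N * T := by
        intro θ
        have h3 : 0 ≤ ∫ x, totalReward r x.1.hist ∂(law Q μ M ξ₁ θ T) :=
          integral_nonneg fun x => (totalReward_mem_Icc hr _).1
        have h4 := mul_le_mul_of_nonneg_right (hJN θ).2 hT0.le
        linarith
      have hJi : Integrable (fun θ => J θ * T) Q := by
        refine Integrable.mul_const (Integrable.of_bound hJ.aestronglyMeasurable N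
          (ae_of_all _ fun θ => ?_)) _
        rw [Real.norm_eq_abs, abs_of_nonneg (hJN θ).1]; exact (hJN θ).2
      have h5 := integral_mono (hJi.sub (integrable_integral_totalReward (Tmix := M) (ξ₁ := ξ₁)
        hr hμ T)) (integrable_const ((N : ℝ) * T)) h2
      simpa using h5
    have h2 : (N : ℝ) * T ≤ 28 * σ * √(N * M * T * l) := by
      have h3 : ((N : ℝ) * T) ^ 2 ≤ (28 * σ) ^ 2 * (N * M * T * l) := by
        calc ((N : ℝ) * T) ^ 2 = N * T * (N * T) := by ring
          _ ≤ N * T * (σ * (784 * (σ * M * l))) := by gcongr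
          _ = _ := by ring
      calc (N : ℝ) * T = √(((N : ℝ) * T) ^ 2) := (Real.sqrt_sq (by positivity)).symm
        _ ≤ √((28 * σ) ^ 2 * (N * M * T * l)) := Real.sqrt_le_sqrt h3
        _ = _ := by rw [Real.sqrt_mul (by positivity), Real.sqrt_sq (by positivity)]
    have h3 : 28 * σ * √(N * M * T * l) ≤ 28 * (H + 1) * σ * √(N * M * T * l) := by
      have : 0 ≤ 28 * σ * √(N * M * T * l) := by positivity
      nlinarith
    linarith
  · obtain ⟨n, rfl⟩ : ∃ n, T = n + 1 := ⟨T - 1, by omega⟩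
    -- the horizon is large: `T > 540 σ M`, hence `T ≥ 512` and `M ≥ 9`
    have hσM : 540 * (σ * M) ≤ (n + 1 : ℕ) := by
      have : σ * M * 0.69 ≤ σ * M * l := by gcongr; linarith
      linarith
    have hσM1 : 1 ≤ σ * M := by nlinarith
    have hM9 : 9 ≤ M := by
      have h9 : 9 ≤ Real.logb 2 (n + 1 : ℕ) := by
        rw [Real.le_logb_iff_rpow_le (by norm_num) hT0]
        refine le_trans ?_ ((by linarith : (512 : ℝ) ≤ 540 * (σ * M)).trans hσM)
        rw [show (9 : ℝ) = (9 : ℕ) by norm_num, Real.rpow_natCast]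
        norm_num
      rw [hM, horizonMix]
      nlinarith
    obtain ⟨m, hm⟩ : ∃ m, ⌈M⌉₊ = m + 1 :=
      ⟨⌈M⌉₊ - 1, by have := Nat.ceil_pos.2 (show 0 < M by linarith); omega⟩
    have hmM : (m : ℝ) + 1 ≤ M + 1 := by
      have := (Nat.ceil_lt_add_one (show 0 ≤ M by linarith)).le
      rw [hm] at this
      exact_mod_cast this
    obtain ⟨g, hgm, hgH, hsub⟩ := exists_measurable_subsolution hμ r hJ hH hh
    set ρ : Fin K → ℝ := fun k => √(12 * Fintype.card (S k) * l) with hρ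
    have hρ1 : ∀ k, 1 ≤ ρ k := by
      intro k
      have hc : (1 : ℝ) ≤ Fintype.card (S k) := by
        have := hS k
        exact_mod_cast Fintype.card_pos
      refine Real.one_le_sqrt.2 ?_
      nlinarith
    have ha : 0 < √((n + 1 : ℕ) : ℝ) / √(σ * M * Real.log (N * (n + 1 : ℕ))) :=
      div_pos (Real.sqrt_pos.2 hT0) (Real.sqrt_pos.2 hX)
    have key := integral_regret_le_of_subsolution (ξ₁ := ξ₁) hr hμ hGm hQ hG hJ hJN hH hgm hgH hsub
      (n := n) (by omega) hm hρ1 ha (sum_cell_exp_le hS hl2 m (n + 1))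
    refine key.trans ?_
    rw [hcell m]
    set T : ℝ := ((n + 1 : ℕ) : ℝ) with hTdef
    have hTn : (n : ℝ) + 1 = T := by rw [hTdef]; push_cast; ring
    -- the episodes
    have hc : 1 + σ * (m + 1) * Real.logb 2 T ≤ 2 * (σ * M * Real.log (N * T)) :=
      episode_const_le hσ1 hM9 hT2 hmM hlNT
    have hepi := episode_cost_le hX hT0 (n := n) (by linarith) hc
    have hepi' := mul_le_mul_of_nonneg_left hepi (show 0 ≤ N + H by positivity)
    have e1 : σ * M * Real.log (N * T) * T = σ * M * T * Real.log (N * T) := by ring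
    rw [e1] at hepi'
    -- the confidence widths
    have hwid := width_cost_le (N := N) (T := T) (H := H) (by linarith) (by linarith) hT0.le hH
      (hwidth hl0.le (show (m : ℝ) + 1 ≤ 2 * M by linarith)) hl0.le (show 0 ≤ M by linarith)
    -- the remaining terms
    have hrest : 32 * N / T + 4 * N * T ^ 2 * (σ * (m + 1) * (T * Real.exp (-(5 * l)))) ≤ 1 :=
      rest_cost_le (by linarith) hNσ hM1 hmM hσM hT0
    have hrest' := mul_le_mul_of_nonneg_left hrest (show 0 ≤ (H + 1) / 2 by linarith)
    have hone : 1 ≤ σ * √(N * M * T * l) := by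
      have : 1 ≤ √(N * M * T * l) := by
        refine Real.one_le_sqrt.2 ?_
        have h1 : 1 ≤ N * M := one_le_mul_of_one_le_of_one_le hN1 hM1
        have h2 : 1 ≤ T * l := by
          have := mul_le_mul hT2 (show 0.69 ≤ l by linarith) (by norm_num) hT0.le
          linarith
        rw [mul_assoc (N * M)]
        exact one_le_mul_of_one_le_of_one_le h1 h2
      exact one_le_mul_of_one_le_of_one_le hσ1 this
    have hone' := mul_le_mul_of_nonneg_left hone (show 0 ≤ H + 1 by linarith)
    rw [hTn]
    simp only [hρ]
    linarith

end RegretBound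

/-! ### Bias functions, reversed rewards, and the order of the bound -/

section Final

variable {K N : ℕ} {S : Fin K → Type*} [∀ k, Fintype (S k)] [∀ k, DecidableEq (S k)]
variable {Q : Measure (Params S)} {μ : Params S → Policy S N} {ξ₁ : Meta S}

/-- A bias function with span at most `H` can be shifted to take values in `[0, H]`. -/
lemma IsBias.exists_mem_Icc {r : ∀ k, S k → ℝ} {θ : Params S} {π : Policy S N} {J H : ℝ}
    {h : Meta S → ℝ} (hb : IsBias r θ π J h) (hH : ∀ ξ ξ', h ξ - h ξ' ≤ H) (ξ₁ : Meta S) :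
    ∃ h' : Meta S → ℝ, (∀ ξ, h' ξ ∈ Set.Icc 0 H) ∧
      ∀ ξ, J + h' ξ = metaReward r θ ξ (π ξ) + metaExp θ ξ (π ξ) h' := by
  have : Nonempty (Meta S) := ⟨ξ₁⟩
  have hbdd : BddBelow (Set.range h) := ⟨0, by rintro _ ⟨ξ, rfl⟩; exact hb.1 ξ⟩
  refine ⟨fun ξ => h ξ - ⨅ ξ', h ξ', fun ξ => ⟨sub_nonneg.2 (ciInf_le hbdd ξ), ?_⟩, fun ξ => ?_⟩
  · have : h ξ - H ≤ ⨅ ξ', h ξ' := le_ciInf fun ξ' => by linarith [hH ξ ξ']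
    linarith
  · rw [metaExp_sub θ ξ (π ξ) h fun _ => ⨅ ξ', h ξ', metaExp_const]
    linarith [hb.2 ξ]

/-- The reversed rewards `1 - r` turn lower bounds on the regret into upper bounds. -/
lemma bellman_one_sub {r : ∀ k, S k → ℝ} {θ : Params S} {π : Policy S N} {J H : ℝ}
    {h : Meta S → ℝ} (hb : ∀ ξ, J + h ξ = metaReward r θ ξ (π ξ) + metaExp θ ξ (π ξ) h)
    (ξ : Meta S) : N - J + (H - h ξ) = metaReward (fun k s => 1 - r k s) θ ξ (π ξ) +
      metaExp θ ξ (π ξ) fun ξ => H - h ξ := by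
  rw [metaReward_one_sub, metaExp_sub θ ξ (π ξ) (fun _ => H) h, metaExp_const]
  linarith [hb ξ]

lemma totalReward_one_sub (r : ∀ k, S k → ℝ) (hist : List (Round S N)) :
    totalReward (fun k s => 1 - r k s) hist = N * hist.length - totalReward r hist := by
  induction hist using List.reverseRecOn with
  | nil => simp [totalReward]
  | append_singleton l z ih =>
    have happ : ∀ r : ∀ k, S k → ℝ, totalReward r (l ++ [z]) =
        totalReward r l + ∑ k ∈ z.act.1, r k (z.post.last k) := fun r => by simp [totalReward]
    rw [happ, happ, ih, Finset.sum_sub_distrib, Finset.sum_const, z.act.2, nsmul_one,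
      List.length_append, List.length_singleton]
    push_cast
    ring

lemma integral_totalReward_one_sub [IsProbabilityMeasure Q] {r : ∀ k, S k → ℝ}
    (hr : ∀ k s, r k s ∈ Set.Icc (0 : ℝ) 1)
    (hμ : ∀ (ξ : Meta S) (A : Action K N), MeasurableSet {θ | μ θ ξ = A}) (Tmix : ℝ) (θ : Params S)
    (T : ℕ) : ∫ x, totalReward (fun k s => 1 - r k s) x.1.hist ∂(law Q μ Tmix ξ₁ θ T) =
      N * T - ∫ x, totalReward r x.1.hist ∂(law Q μ Tmix ξ₁ θ T) := by
  have hr' : ∀ k s, 1 - r k s ∈ Set.Icc (0 : ℝ) 1 := fun k s =>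
    ⟨by linarith [(hr k s).2], by linarith [(hr k s).1]⟩
  have := isProbabilityMeasure_obsLaw (Q := Q) (Tmix := Tmix) (ξ₁ := ξ₁) hμ θ T
  rw [integral_totalReward_eq hr' hμ, integral_totalReward_eq hr hμ]
  have hi : Integrable (fun x => totalReward r x.1.hist) (obsLaw Q μ Tmix ξ₁ θ T) :=
    integrable_obsLaw hμ MeasurableSet.univ (by simp) θ T (measurable_hist (f := totalReward r))
      (C := N * T) fun x hx => by
        have := totalReward_mem_Icc hr x.1.hist
        rw [hx.1.length_hist] at this
        rw [abs_of_nonneg this.1]; exact this.2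
  have h1 : ∫ x, totalReward (fun k s => 1 - r k s) x.1.hist ∂(obsLaw Q μ Tmix ξ₁ θ T) =
      ∫ x, ((N : ℝ) * T - totalReward r x.1.hist) ∂(obsLaw Q μ Tmix ξ₁ θ T) := by
    refine integral_congr_ae ?_
    filter_upwards [ae_obsLaw (Q := Q) (ξ₁ := ξ₁) (Tmix := Tmix) hμ MeasurableSet.univ
      (by simp) θ T] with x hx
    rw [totalReward_one_sub, hx.1.length_hist]
  rw [h1, integral_sub (integrable_const _) hi]
  simp

/-- The regret bound is of the order `√T log T`. -/
lemma exists_regretBound_le {σ H : ℝ} (hσ : 0 ≤ σ) (hH : 0 ≤ H) {N : ℕ} (hN : 1 ≤ N) {τ : ℕ}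
    (hτ : 1 ≤ τ) : ∃ C : ℝ, ∀ᶠ T : ℕ in atTop,
      2 * (H + N) * √(σ * horizonMix τ T * T * Real.log (N * T)) +
      28 * (H + 1) * σ * √(N * horizonMix τ T * T * Real.log (horizonMix τ T * T)) ≤
        C * (√(T : ℝ) * Real.log T) := by
  refine ⟨2 * (H + N) * √(4 * σ * τ) + 28 * (H + 1) * σ * √(8 * N * τ), ?_⟩
  filter_upwards [eventually_ge_atTop (2 + N + τ)] with T hT
  have hTr : (2 : ℝ) + N + τ ≤ T := by exact_mod_cast hT
  have hN1 : (1 : ℝ) ≤ N := by exact_mod_cast hN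
  have hτ1 : (1 : ℝ) ≤ τ := by exact_mod_cast hτ
  have hT2 : (2 : ℝ) ≤ T := by linarith
  have hT0 : (0 : ℝ) < T := by linarith
  set L := Real.log T with hL
  have hL0 : 0 < L := Real.log_pos (by linarith)
  have hLT : L ≤ T := Real.log_le_self hT0.le
  have hln2 := Real.log_two_gt_d9
  have hM : horizonMix τ T ≤ 2 * τ * L := by
    have h1 : Real.logb 2 T ≤ 2 * L := by
      rw [Real.logb, div_le_iff₀ (by linarith)]
      nlinarith
    rw [horizonMix]
    nlinarith
  have hM0 : 0 < horizonMix τ T := mul_pos (Real.logb_pos (by norm_num) (by linarith)) (by linarith)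
  have h1 : Real.log (N * T) ≤ 2 * L := by
    calc Real.log (N * T) ≤ Real.log (T ^ 2) := by
          refine Real.log_le_log (by positivity) ?_
          nlinarith
      _ = 2 * L := by rw [Real.log_pow, Nat.cast_ofNat]
  have h2 : Real.log (horizonMix τ T * T) ≤ 4 * L := by
    calc Real.log (horizonMix τ T * T) ≤ Real.log (T ^ 4) := by
          refine Real.log_le_log (by positivity) ?_
          calc horizonMix τ T * T ≤ 2 * τ * L * T := by gcongr
            _ ≤ T * T * T * T := by gcongr; linarith
            _ = T ^ 4 := by ring
      _ = 4 * L := by rw [Real.log_pow, Nat.cast_ofNat]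
  have e : ∀ c : ℝ, 0 ≤ c → √(c * (T * L ^ 2)) = √c * (√(T : ℝ) * L) := by
    intro c hc
    rw [Real.sqrt_mul hc, Real.sqrt_mul hT0.le, Real.sqrt_sq hL0.le]
  have h3 : √(σ * horizonMix τ T * T * Real.log (N * T)) ≤ √(4 * σ * τ) * (√(T : ℝ) * L) := by
    rw [← e _ (by positivity)]
    refine Real.sqrt_le_sqrt ?_
    calc σ * horizonMix τ T * T * Real.log (N * T) ≤ σ * horizonMix τ T * T * (2 * L) := by gcongr
      _ ≤ σ * (2 * τ * L) * T * (2 * L) := by gcongr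
      _ = _ := by ring
  have h4 : √(N * horizonMix τ T * T * Real.log (horizonMix τ T * T)) ≤
      √(8 * N * τ) * (√(T : ℝ) * L) := by
    rw [← e _ (by positivity)]
    refine Real.sqrt_le_sqrt ?_
    calc N * horizonMix τ T * T * Real.log (horizonMix τ T * T) ≤
          N * horizonMix τ T * T * (4 * L) := by gcongr
      _ ≤ N * (2 * τ * L) * T * (4 * L) := by gcongr
      _ = _ := by ring
  calc _ ≤ 2 * (H + N) * (√(4 * σ * τ) * (√(T : ℝ) * L)) +
        28 * (H + 1) * σ * (√(8 * N * τ) * (√(T : ℝ) * L)) := by gcongr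
    _ = _ := by ring

lemma avgReward_eq_of_bias {r : ∀ k, S k → ℝ} {θ : Params S} {π : Policy S N} {J : ℝ}
    {h : Meta S → ℝ} (hb : IsBias r θ π J h) {C : ℝ} (hC : ∀ ξ ξ', h ξ - h ξ' ≤ C) (ξ : Meta S) :
    avgReward r θ π ξ = J := (tendsto_meanReward_of_bias hb hC ξ).limUnder_eq

lemma one_le_of_mixingTime_eq {α : Type*} [Fintype α] [DecidableEq α] {P : Matrix α α ℝ} {ε : ℝ}
    {τ : ℕ} (h : (τ : ℕ∞) = mixingTime P ε) : 1 ≤ τ := by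
  have : (1 : ℕ∞) ≤ mixingTime P ε := by
    refine le_sInf ?_
    rintro _ ⟨t, rfl, ht, -⟩
    exact_mod_cast ht
  rw [← h] at this
  exact_mod_cast this

end Final

end RestlessBandit

end

open RestlessBandit in
theorem theorem1 {K N : ℕ} (hN : 1 ≤ N) {S : Fin K → Type*}
    [∀ k, Fintype (S k)] [∀ k, DecidableEq (S k)]
    -- the reward functions
    (r : ∀ k, S k → ℝ) (hr : ∀ k s, r k s ∈ Set.Icc (0 : ℝ) 1)
    -- the prior; its support is the parameter space
    (Q : Measure (Params S)) [IsProbabilityMeasure Q]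
    -- the passive chains and their mixing time
    (hpassive : ∀ θ ∈ Q.support, ∀ k,
      IsIrreducible (Params.passive θ k) ∧ IsAperiodic (Params.passive θ k))
    (τ : ℕ)
    (hτ : IsGreatest
      {m : ℕ∞ | ∃ θ ∈ Q.support, ∃ k, m = mixingTime (Params.passive θ k) (1 / 4)} (τ : ℕ∞))
    -- the policy mapping
    (μ : Params S → Policy S N)
    (hμ : ∀ (ξ : Meta S) (A : Action K N), MeasurableSet {θ | μ θ ξ = A})
    (hspan : ∀ θ ∈ Q.support, BoundedSpan r θ (μ θ))
    -- the initial meta-state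
    (ξ₁ : Meta S) :
    -- the average rewards are well defined and come with bias functions of bounded span
    (∀ θ ∈ Q.support,
      (∀ ξ, Tendsto (meanReward r θ (μ θ) ξ) atTop (𝓝 (avgReward r θ (μ θ) ξ₁))) ∧
      ∃ h, IsBias r θ (μ θ) (avgReward r θ (μ θ) ξ₁) h ∧ ∃ C : ℝ, ∀ ξ ξ', h ξ - h ξ' ≤ C) ∧
    -- for every choice of bias functions with spans at most `H`, the regret bound holds
    ∀ (h : Params S → Meta S → ℝ) (H : ℝ),
      (∀ θ ∈ Q.support, IsBias r θ (μ θ) (avgReward r θ (μ θ) ξ₁) (h θ)) →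
      (∀ θ ∈ Q.support, ∀ ξ ξ', h θ ξ - h θ ξ' ≤ H) →
      (∀ T : ℕ, 2 ≤ T →
        Integrable (regret r Q μ τ ξ₁ T) Q ∧
        bayesRegret r Q μ τ ξ₁ T ≤
          2 * (H + N) * √((∑ k, (Fintype.card (S k) : ℝ)) * horizonMix τ T * T *
              Real.log (N * T)) +
          28 * (H + 1) * (∑ k, (Fintype.card (S k) : ℝ)) *
            √(N * horizonMix τ T * T * Real.log (horizonMix τ T * T))) ∧
      (fun T : ℕ => bayesRegret r Q μ τ ξ₁ T) =O[atTop] fun T : ℕ => √(T : ℝ) * Real.log T := by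
  have hlim : ∀ θ ∈ Q.support, ∀ ξ,
      Tendsto (meanReward r θ (μ θ) ξ) atTop (𝓝 (avgReward r θ (μ θ) ξ₁)) := by
    intro θ hθ ξ
    obtain ⟨J, h, hb, C, hC⟩ := exists_bias_of_boundedSpan hr θ (μ θ) (hspan θ hθ) ξ₁
    rw [avgReward_eq_of_bias hb hC]
    exact tendsto_meanReward_of_bias hb hC ξ
  refine ⟨fun θ hθ => ⟨hlim θ hθ, ?_⟩, fun h H hb hspanH => ?_⟩
  · obtain ⟨J, h, hb, C, hC⟩ := exists_bias_of_boundedSpan hr θ (μ θ) (hspan θ hθ) ξ₁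
    rw [avgReward_eq_of_bias hb hC]
    exact ⟨h, hb, C, hC⟩
  have hsupp : ∀ᵐ θ ∂Q, θ ∈ Q.support := Measure.support_mem_ae
  have hmeas : MeasurableSet Q.support := Measure.isClosed_support.measurableSet
  obtain ⟨θ₀, hθ₀, k₀, hτ₀⟩ := hτ.1
  have hτ1 : 1 ≤ τ := one_le_of_mixingTime_eq hτ₀
  have hmix : ∀ θ ∈ Q.support, MixesWithin τ θ := fun θ hθ =>
    mixesWithin_of_mixingTime_le fun k => hτ.2 ⟨θ, hθ, k, rfl⟩
  have hH : 0 ≤ H := by simpa using hspanH θ₀ hθ₀ ξ₁ ξ₁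
  have hr' : ∀ k s, 1 - r k s ∈ Set.Icc (0 : ℝ) 1 := fun k s =>
    ⟨by linarith [(hr k s).2], by linarith [(hr k s).1]⟩
  -- a version of the average reward with values in `[0, N]` everywhere
  set J : Params S → ℝ := fun θ => max 0 (min N (avgReward r θ (μ θ) ξ₁)) with hJdef
  have hJ : Measurable J :=
    measurable_const.max (measurable_const.min (measurable_avgReward hμ r ξ₁))
  have hJN : ∀ θ, J θ ∈ Set.Icc (0 : ℝ) N := fun θ =>
    ⟨le_max_left _ _, max_le (Nat.cast_nonneg _) (min_le_left _ _)⟩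
  have hJeq : ∀ θ ∈ Q.support, J θ = avgReward r θ (μ θ) ξ₁ := by
    intro θ hθ
    have h1 : avgReward r θ (μ θ) ξ₁ ∈ Set.Icc (0 : ℝ) N :=
      isClosed_Icc.mem_of_tendsto (hlim θ hθ ξ₁)
        (Eventually.of_forall fun T => meanReward_mem_Icc hr θ (μ θ) ξ₁ T)
    simp only [hJdef, min_eq_right h1.2, max_eq_right h1.1]
  have hbell : ∀ θ ∈ Q.support, ∃ h' : Meta S → ℝ, (∀ ξ, h' ξ ∈ Set.Icc 0 H) ∧
      ∀ ξ, J θ + h' ξ = metaReward r θ ξ (μ θ ξ) + metaExp θ ξ (μ θ ξ) h' := by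
    intro θ hθ
    rw [hJeq θ hθ]
    exact (hb θ hθ).exists_mem_Icc (hspanH θ hθ) ξ₁
  have hreg : ∀ T, (fun θ => J θ * T -
      ∫ x, totalReward r x.1.hist ∂(law Q μ (horizonMix τ T) ξ₁ θ T)) =ᵐ[Q]
      regret r Q μ τ ξ₁ T := by
    intro T
    filter_upwards [hsupp] with θ hθ
    rw [hJeq θ hθ, regret]
  have hJi : ∀ T : ℕ, Integrable (fun θ => J θ * T) Q := by
    intro T
    refine Integrable.mul_const (Integrable.of_bound hJ.aestronglyMeasurable N
      (ae_of_all _ fun θ => ?_)) _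
    rw [Real.norm_eq_abs, abs_of_nonneg (hJN θ).1]; exact (hJN θ).2
  set B : ℕ → ℝ := fun T =>
    2 * (H + N) * √((∑ k, (Fintype.card (S k) : ℝ)) * horizonMix τ T * T * Real.log (N * T)) +
    28 * (H + 1) * (∑ k, (Fintype.card (S k) : ℝ)) *
      √(N * horizonMix τ T * T * Real.log (horizonMix τ T * T)) with hB
  have hupper : ∀ T : ℕ, 2 ≤ T → bayesRegret r Q μ τ ξ₁ T ≤ B T := fun T hT => by
    rw [bayesRegret, ← integral_congr_ae (hreg T)]
    exact integral_regret_le hr hN hμ hτ1 hmeas hsupp hmix hJ hJN hH (fun θ hθ => by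
      obtain ⟨h', h1, h2⟩ := hbell θ hθ
      exact ⟨h', h1, fun ξ => (h2 ξ).le⟩) hT
  -- the lower bound is the upper bound for the rewards `1 - r`
  have hlower : ∀ T : ℕ, 2 ≤ T → -bayesRegret r Q μ τ ξ₁ T ≤ B T := fun T hT => by
    have h1 := integral_regret_le (ξ₁ := ξ₁) (J := fun θ => N - J θ) hr' hN hμ hτ1 hmeas hsupp hmix
      (measurable_const.sub hJ) (fun θ => ⟨by linarith [(hJN θ).2], by linarith [(hJN θ).1]⟩) hH
      (fun θ hθ => by
        obtain ⟨h', h1, h2⟩ := hbell θ hθ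
        exact ⟨fun ξ => H - h' ξ, fun ξ => ⟨by linarith [(h1 ξ).2], by linarith [(h1 ξ).1]⟩,
          fun ξ => (bellman_one_sub h2 ξ).le⟩) hT
    rw [bayesRegret, ← integral_congr_ae (hreg T), ← integral_neg]
    refine le_trans (le_of_eq (integral_congr_ae (ae_of_all _ fun θ => ?_))) h1
    simp only [integral_totalReward_one_sub hr hμ]
    ring
  refine ⟨fun T hT => ⟨?_, hupper T hT⟩, ?_⟩
  · exact ((hJi T).sub (integrable_integral_totalReward hr hμ T)).congr (hreg T)
  · obtain ⟨C, hC⟩ := exists_regretBound_le (σ := ∑ k, (Fintype.card (S k) : ℝ)) (τ := τ)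
      (Finset.sum_nonneg fun k _ => Nat.cast_nonneg _) hH hN hτ1
    refine Asymptotics.IsBigO.of_bound C ?_
    filter_upwards [hC, eventually_ge_atTop 2] with T hT hT2
    have hpos : 0 ≤ √(T : ℝ) * Real.log T :=
      mul_nonneg (Real.sqrt_nonneg _) (Real.log_natCast_nonneg T)
    rw [Real.norm_eq_abs, Real.norm_eq_abs, abs_of_nonneg hpos, abs_le']
    exact ⟨(hupper T hT2).trans hT, (hlower T hT2).trans hT⟩
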